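/- Let $\mathcal P$ be the class of real, integrable, bounded functions on $\mathbb R$ with support in $[-1,1]$; let $\Phi,\Psi\in\mathcal P$ and $\alpha,\beta\in\mathbb R$. For $q\in\mathcal P$, a *half-bound state* of $-\frac{d^2}{ds^2}+q$ is a nontrivial solution $u$ of $-u''+qu=0$ on $\mathbb R$ (with $u'$ locally absolutely continuous) that is bounded on $\mathbb R$. The *resonant set* $\Lambda_\Phi$ is the set of all $\alpha\in\mathbb R$ for which $-\frac{d^2}{ds^2}+\alpha\Phi$ has a half-bound state $u_\alpha$, and for $\alpha\in\Lambda_\Phi$ put $$\theta_\alpha=\frac{u_\alpha(1)}{u_\alpha(-1)},\qquad \kappa_\alpha=\frac{1}{u_\alpha(-1)\,u_\alpha(1)}\int_{\mathbb R}\Psi\,u_\alpha^2\,ds .$$ For $\varepsilon>0$ consider in $L_2(\mathbb R)$ the operator $$S_\varepsilon=-\frac{d^2}{dx^2}+\frac{\alpha}{\varepsilon^2}\,\Phi\!\left(\frac x\varepsilon\right)+\frac{\beta}{\varepsilon}\,\Psi\!\left(\frac x\varepsilon\right),\qquad \operatorname{dom}S_\varepsilon=W_2^2(\mathbb R),$$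 and for $\mu,\nu\in\mathbb R$, $\mu\neq0$, let $S(\mu,\nu)$ be the operator acting by $S(\mu,\nu)\varphi=-\varphi''$ on the domain $$\operatorname{dom}S(\mu,\nu)=\{\varphi\in W_2^2(\mathbb R\setminus\{0\}):\ \varphi(+0)=\mu\,\varphi(-0),\ \ \varphi'(+0)=\mu^{-1}\varphi'(-0)+\nu\,\varphi(-0)\}.$$ **Theorem.** Let $\alpha\in\Lambda_\Phi$. Then every half-bound state $u_\alpha$ satisfies $u_\alpha(\pm1)\neq0$, and $\theta_\alpha$, $\kappa_\alpha$ do not depend on the choice of $u_\alpha$. The operators $S_\varepsilon$ ($\varepsilon>0$) and $S(\theta_\alpha,\beta\kappa_\alpha)$ are self-adjoint, and $S_\varepsilon\to S(\theta_\alpha,\beta\kappa_\alpha)$ as $\varepsilon\to0^+$ in the norm resolvent sense, with rate $O(\varepsilon^{1/2})$: for every $\zeta\in\mathbb C$ with $\operatorname{Im}\zeta\neq0$ the resolvents exist as bounded operators on $L_2(\mathbb R)$, and there is a constant $C$, depending on $\zeta,\Phi,\Psi,\alpha,\beta$ only, such that $$\bigl\|(S_\varepsilon-\zeta)^{-1}-(S(\theta_\alpha,\beta\kappa_\alpha)-\zeta)^{-1}\bigr\|\le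 C\,\varepsilon^{1/2}\qquad\text{for all }\varepsilon>0 .$$ -/

import Mathlib

open MeasureTheory Filter Topology Set
open scoped ENNReal ContDiff

noncomputable section

namespace PointInteraction

/-! ### Potentials and half-bound states -/

/-- The class `𝒫` of real, integrable, bounded functions on `ℝ` with support in `[-1, 1]`. -/
structure Potential where
  toFun : ℝ → ℝ
  integrable' : Integrable toFun
  bounded' : ∃ C : ℝ, ∀ x, |toFun x| ≤ C
  support' : tsupport toFun ⊆ Icc (-1) 1

instance : CoeFun Potential (fun _ => ℝ → ℝ) := ⟨Potential.toFun⟩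

/-- `u` solves `-u'' + q u = 0` on `ℝ` in the usual (Carathéodory) sense: `u` is differentiable,
`u'` is locally absolutely continuous, and `u'' = q u` almost everywhere. The last two conditions
are expressed by saying that `u'` is an indefinite integral of `q u`. -/
def IsSolution (q u : ℝ → ℝ) : Prop :=
  Differentiable ℝ u ∧ LocallyIntegrable (fun t => q t * u t) ∧
    ∀ a b : ℝ, deriv u b - deriv u a = ∫ t in a..b, q t * u t

/-- A half-bound state of `-d²/ds² + q`: a nontrivial solution of `-u'' + q u = 0` that is bounded
on the whole line. -/
def IsHalfBoundState (q u : ℝ → ℝ) : Prop :=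
  IsSolution q u ∧ u ≠ 0 ∧ ∃ C : ℝ, ∀ s, |u s| ≤ C

/-- The resonant set `Λ_Φ`. -/
def resonantSet (Φ : Potential) : Set ℝ :=
  {α | ∃ u : ℝ → ℝ, IsHalfBoundState (fun s => α * Φ s) u}

/-- A half-bound state `u_α` of `-d²/ds² + α Φ`, for resonant `α`. -/
def halfBoundState (Φ : Potential) (α : resonantSet Φ) : ℝ → ℝ :=
  α.2.choose

/-- The resonant map `θ` of `Φ`. -/
def resonantMap (Φ : Potential) (α : resonantSet Φ) : ℝ :=
  halfBoundState Φ α 1 / halfBoundState Φ α (-1)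

/-- The intercoupling map `κ` of the pair `Φ`, `Ψ`. -/
def intercouplingMap (Φ Ψ : Potential) (α : resonantSet Φ) : ℝ :=
  1 / (halfBoundState Φ α (-1) * halfBoundState Φ α 1) *
    ∫ s, Ψ s * halfBoundState Φ α s ^ 2

/-! ### Sobolev spaces -/

/-- The complex Hilbert space `L₂(ℝ)`. -/
abbrev L2 : Type := Lp ℂ 2 (volume : Measure ℝ)

lemma locallyIntegrable_L2 (f : L2) : LocallyIntegrable (f : ℝ → ℂ) :=
  (Lp.memLp f).locallyIntegrable (by norm_num)

/-- `g` is the weak derivative of `f` on the open set `Ω`. -/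
def HasWeakDeriv (Ω : Set ℝ) (f g : L2) : Prop :=
  ∀ ψ : ℝ → ℝ, ContDiff ℝ ∞ ψ → HasCompactSupport ψ → tsupport ψ ⊆ Ω →
    ∫ x, deriv ψ x • f x = - ∫ x, ψ x • g x

lemma integrable_test (f : L2) {ψ : ℝ → ℝ} (h : Continuous ψ) (hc : HasCompactSupport ψ) :
    Integrable (fun x => ψ x • f x) :=
  (locallyIntegrable_L2 f).integrable_smul_left_of_hasCompactSupport h hc

lemma integrable_test_deriv (f : L2) {ψ : ℝ → ℝ} (h : ContDiff ℝ ∞ ψ)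
    (hc : HasCompactSupport ψ) : Integrable (fun x => deriv ψ x • f x) :=
  integrable_test f (h.continuous_deriv (by simp)) hc.deriv

lemma HasWeakDeriv.zero (Ω : Set ℝ) : HasWeakDeriv Ω 0 0 := by
  intro ψ _ _ _
  have h0 : ((0 : L2) : ℝ → ℂ) =ᵐ[volume] 0 := Lp.coeFn_zero _ _ _
  have h1 : ∫ x, deriv ψ x • (0 : L2) x = 0 := by
    rw [← integral_zero ℝ ℂ (μ := volume)]
    exact integral_congr_ae (by filter_upwards [h0] with x hx; rw [hx]; simp)
  have h2 : ∫ x, ψ x • (0 : L2) x = 0 := by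
    rw [← integral_zero ℝ ℂ (μ := volume)]
    exact integral_congr_ae (by filter_upwards [h0] with x hx; rw [hx]; simp)
  rw [h1, h2, neg_zero]

lemma HasWeakDeriv.add {Ω : Set ℝ} {f₁ g₁ f₂ g₂ : L2} (h₁ : HasWeakDeriv Ω f₁ g₁)
    (h₂ : HasWeakDeriv Ω f₂ g₂) : HasWeakDeriv Ω (f₁ + f₂) (g₁ + g₂) := by
  intro ψ hψ hc hs
  have e1 : ∫ x, deriv ψ x • (f₁ + f₂) x
      = (∫ x, deriv ψ x • f₁ x) + ∫ x, deriv ψ x • f₂ x := by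
    rw [← integral_add (integrable_test_deriv f₁ hψ hc) (integrable_test_deriv f₂ hψ hc)]
    refine integral_congr_ae ?_
    filter_upwards [Lp.coeFn_add f₁ f₂] with x hx
    rw [hx, Pi.add_apply, smul_add]
  have e2 : ∫ x, ψ x • (g₁ + g₂) x = (∫ x, ψ x • g₁ x) + ∫ x, ψ x • g₂ x := by
    rw [← integral_add (integrable_test g₁ hψ.continuous hc)
      (integrable_test g₂ hψ.continuous hc)]
    refine integral_congr_ae ?_
    filter_upwards [Lp.coeFn_add g₁ g₂] with x hx
    rw [hx, Pi.add_apply, smul_add]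
  rw [e1, e2, h₁ ψ hψ hc hs, h₂ ψ hψ hc hs, neg_add]

lemma HasWeakDeriv.smul {Ω : Set ℝ} {f g : L2} (c : ℂ) (h : HasWeakDeriv Ω f g) :
    HasWeakDeriv Ω (c • f) (c • g) := by
  intro ψ hψ hc hs
  have e1 : ∫ x, deriv ψ x • (c • f) x = c • ∫ x, deriv ψ x • f x := by
    rw [← integral_smul]
    refine integral_congr_ae ?_
    filter_upwards [Lp.coeFn_smul c f] with x hx
    rw [hx, Pi.smul_apply, smul_comm]
  have e2 : ∫ x, ψ x • (c • g) x = c • ∫ x, ψ x • g x := by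
    rw [← integral_smul]
    refine integral_congr_ae ?_
    filter_upwards [Lp.coeFn_smul c g] with x hx
    rw [hx, Pi.smul_apply, smul_comm]
  rw [e1, e2, h ψ hψ hc hs, smul_neg]

lemma HasWeakDeriv.unique {Ω : Set ℝ} (hΩ : IsOpen Ω) (hΩ' : volume Ωᶜ = 0) {f g₁ g₂ : L2}
    (h₁ : HasWeakDeriv Ω f g₁) (h₂ : HasWeakDeriv Ω f g₂) : g₁ = g₂ := by
  have key : ∀ᵐ x, x ∈ Ω → (g₁ x - g₂ x) = 0 := by
    refine hΩ.ae_eq_zero_of_integral_contDiff_smul_eq_zero (f := fun x => g₁ x - g₂ x)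
      (((locallyIntegrable_L2 g₁).sub (locallyIntegrable_L2 g₂)).locallyIntegrableOn Ω) ?_
    intro ψ hψ hc hs
    simp only [smul_sub]
    rw [integral_sub (integrable_test g₁ hψ.continuous hc)
      (integrable_test g₂ hψ.continuous hc), sub_eq_zero]
    have := (h₁ ψ hψ hc hs).symm.trans (h₂ ψ hψ hc hs)
    exact neg_injective this
  have hmem : ∀ᵐ x : ℝ, x ∈ Ω := hΩ'
  refine Lp.ext ?_
  filter_upwards [key, hmem] with x hx hxΩ
  exact sub_eq_zero.mp (hx hxΩ)

/-- The Sobolev space `W₂²(Ω)` of an open set `Ω ⊆ ℝ` whose complement is a null set (so that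
`L₂(Ω) = L₂(ℝ)`): the functions in `L₂` whose weak derivatives on `Ω` up to order two are
in `L₂`. It is used for `Ω = ℝ` and for `Ω = ℝ ∖ {0}`. -/
def W22 (Ω : Set ℝ) : Submodule ℂ L2 where
  carrier := {f | ∃ g h : L2, HasWeakDeriv Ω f g ∧ HasWeakDeriv Ω g h}
  zero_mem' := ⟨0, 0, HasWeakDeriv.zero Ω, HasWeakDeriv.zero Ω⟩
  add_mem' := by
    rintro _ _ ⟨g₁, h₁, a₁, b₁⟩ ⟨g₂, h₂, a₂, b₂⟩
    exact ⟨g₁ + g₂, h₁ + h₂, a₁.add a₂, b₁.add b₂⟩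
  smul_mem' := by
    rintro c _ ⟨g, h, a, b⟩
    exact ⟨c • g, c • h, a.smul c, b.smul c⟩

lemma exists_secondDeriv {Ω : Set ℝ} (f : W22 Ω) :
    ∃ h : L2, ∃ g : L2, HasWeakDeriv Ω f g ∧ HasWeakDeriv Ω g h := by
  obtain ⟨g, h, a, b⟩ := f.2
  exact ⟨h, g, a, b⟩

lemma secondDeriv_unique {Ω : Set ℝ} (hΩ : IsOpen Ω) (hΩ' : volume Ωᶜ = 0) {f h₁ h₂ : L2}
    (a₁ : ∃ g : L2, HasWeakDeriv Ω f g ∧ HasWeakDeriv Ω g h₁)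
    (a₂ : ∃ g : L2, HasWeakDeriv Ω f g ∧ HasWeakDeriv Ω g h₂) : h₁ = h₂ := by
  obtain ⟨g₁, b₁, c₁⟩ := a₁
  obtain ⟨g₂, b₂, c₂⟩ := a₂
  obtain rfl := b₁.unique hΩ hΩ' b₂
  exact c₁.unique hΩ hΩ' c₂

/-- The operator `-d²/dx²` in `L₂(ℝ)` with domain `W₂²(Ω)`. -/
def negSecondDeriv (Ω : Set ℝ) (hΩ : IsOpen Ω) (hΩ' : volume Ωᶜ = 0) : L2 →ₗ.[ℂ] L2 where
  domain := W22 Ω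
  toFun :=
    { toFun := fun f => -(exists_secondDeriv f).choose
      map_add' := by
        intro f₁ f₂
        rw [← neg_add]
        congr 1
        obtain ⟨g₁, a₁, b₁⟩ := (exists_secondDeriv f₁).choose_spec
        obtain ⟨g₂, a₂, b₂⟩ := (exists_secondDeriv f₂).choose_spec
        exact secondDeriv_unique hΩ hΩ' (exists_secondDeriv (f₁ + f₂)).choose_spec
          ⟨g₁ + g₂, a₁.add a₂, b₁.add b₂⟩
      map_smul' := by
        intro c f
        rw [RingHom.id_apply, smul_neg]
        congr 1
        obtain ⟨g, a, b⟩ := (exists_secondDeriv f).choose_spec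
        exact secondDeriv_unique hΩ hΩ' (exists_secondDeriv (c • f)).choose_spec
          ⟨c • g, a.smul c, b.smul c⟩ }

/-! ### The Schrödinger operators with squeezed potentials -/

/-- The operator of multiplication by a real function `V ∈ L_∞(ℝ)` in `L₂(ℝ)`. -/
def mulOp (V : ℝ → ℝ) (hV : MemLp V ∞) : L2 →ₗ[ℂ] L2 where
  toFun f := ((Lp.memLp f).smul (r := 2) hV).toLp (V • (f : ℝ → ℂ))
  map_add' f g := by
    rw [← MemLp.toLp_add]
    refine MemLp.toLp_congr _ _ ?_
    filter_upwards [Lp.coeFn_add f g] with x hx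
    simp only [Pi.smul_apply', Pi.add_apply, hx, smul_add]
  map_smul' c f := by
    rw [RingHom.id_apply, ← MemLp.toLp_const_smul]
    refine MemLp.toLp_congr _ _ ?_
    filter_upwards [Lp.coeFn_smul c f] with x hx
    simp only [Pi.smul_apply', Pi.smul_apply, hx, smul_comm c]

/-- The potential `V_ε(x) = α ε⁻² Φ(x/ε) + β ε⁻¹ Ψ(x/ε)`. -/
def squeezed (Φ Ψ : Potential) (α β ε : ℝ) (x : ℝ) : ℝ :=
  α / ε ^ 2 * Φ (x / ε) + β / ε * Ψ (x / ε)

lemma Potential.memLp_scaled (Φ : Potential) (c ε : ℝ) : MemLp (fun x => c * Φ (x / ε)) ∞ := by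
  obtain ⟨C, hC⟩ := Φ.bounded'
  refine MemLp.const_mul ?_ c
  refine memLp_top_of_bound ?_ C (Eventually.of_forall fun x => by
    rw [Real.norm_eq_abs]; exact hC _)
  rcases eq_or_ne ε 0 with rfl | hε
  · simpa using aestronglyMeasurable_const
  · exact (Φ.integrable'.comp_div hε).aestronglyMeasurable

lemma memLp_squeezed (Φ Ψ : Potential) (α β ε : ℝ) : MemLp (squeezed Φ Ψ α β ε) ∞ :=
  (Φ.memLp_scaled (α / ε ^ 2) ε).add (Ψ.memLp_scaled (β / ε) ε)

/-- The operator `S_ε = -d²/dx² + α ε⁻² Φ(x/ε) + β ε⁻¹ Ψ(x/ε)` with domain `W₂²(ℝ)`.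
Only `ε > 0` is meaningful. -/
def schrodingerOp (Φ Ψ : Potential) (α β ε : ℝ) : L2 →ₗ.[ℂ] L2 :=
  mulOp (squeezed Φ Ψ α β ε) (memLp_squeezed Φ Ψ α β ε) +ᵥ
    negSecondDeriv univ isOpen_univ (by simp)

/-! ### The point interaction operator -/

/-- The one-sided values at the origin of (a representative of) `f` and of its derivative:
`f` has a representative `φ`, differentiable on `ℝ ∖ {0}`, with `φ(-0) = a`, `φ'(-0) = a'`,
`φ(+0) = b`, `φ'(+0) = b'`. Such a representative is unique up to its value at `0`. -/
def HasTraces (f : L2) (a a' b b' : ℂ) : Prop :=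
  ∃ φ : ℝ → ℂ, (f : ℝ → ℂ) =ᵐ[volume] φ ∧ (∀ x, x ≠ 0 → DifferentiableAt ℝ φ x) ∧
    Tendsto φ (𝓝[<] 0) (𝓝 a) ∧ Tendsto (deriv φ) (𝓝[<] 0) (𝓝 a') ∧
    Tendsto φ (𝓝[>] 0) (𝓝 b) ∧ Tendsto (deriv φ) (𝓝[>] 0) (𝓝 b')

lemma HasTraces.zero : HasTraces 0 0 0 0 0 := by
  refine ⟨fun _ => 0, Lp.coeFn_zero _ _ _, fun x _ => by fun_prop, ?_⟩
  simp [deriv_const']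

lemma HasTraces.add {f₁ f₂ : L2} {a₁ a₁' b₁ b₁' a₂ a₂' b₂ b₂' : ℂ}
    (h₁ : HasTraces f₁ a₁ a₁' b₁ b₁') (h₂ : HasTraces f₂ a₂ a₂' b₂ b₂') :
    HasTraces (f₁ + f₂) (a₁ + a₂) (a₁' + a₂') (b₁ + b₂) (b₁' + b₂') := by
  obtain ⟨φ₁, e₁, d₁, p₁, q₁, r₁, s₁⟩ := h₁
  obtain ⟨φ₂, e₂, d₂, p₂, q₂, r₂, s₂⟩ := h₂
  have hd : ∀ x : ℝ, x ≠ 0 → (fun x => deriv φ₁ x + deriv φ₂ x) x = deriv (φ₁ + φ₂) x :=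
    fun x hx => (deriv_add (d₁ x hx) (d₂ x hx)).symm
  refine ⟨φ₁ + φ₂, (Lp.coeFn_add f₁ f₂).trans (e₁.add e₂),
    fun x hx => (d₁ x hx).add (d₂ x hx), p₁.add p₂, ?_, r₁.add r₂, ?_⟩
  · refine (q₁.add q₂).congr' ?_
    filter_upwards [self_mem_nhdsWithin] with x hx using hd x (ne_of_lt hx)
  · refine (s₁.add s₂).congr' ?_
    filter_upwards [self_mem_nhdsWithin] with x hx using hd x (ne_of_gt hx)

lemma HasTraces.smul {f : L2} {a a' b b' : ℂ} (c : ℂ) (h : HasTraces f a a' b b') :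
    HasTraces (c • f) (c * a) (c * a') (c * b) (c * b') := by
  obtain ⟨φ, e, d, p, q, r, s⟩ := h
  have hd : ∀ x : ℝ, x ≠ 0 → (fun x => c * deriv φ x) x = deriv (c • φ) x :=
    fun x hx => (deriv_const_smul c (d x hx)).symm
  refine ⟨c • φ, (Lp.coeFn_smul c f).trans (e.const_smul c),
    fun x hx => (d x hx).const_smul c, p.const_mul c, ?_, r.const_mul c, ?_⟩
  · refine (q.const_mul c).congr' ?_
    filter_upwards [self_mem_nhdsWithin] with x hx using hd x (ne_of_lt hx)
  · refine (s.const_mul c).congr' ?_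
    filter_upwards [self_mem_nhdsWithin] with x hx using hd x (ne_of_gt hx)

/-- The functions `φ` satisfying `φ(+0) = μ φ(-0)` and `φ'(+0) = μ⁻¹ φ'(-0) + ν φ(-0)`. -/
def couplingSubmodule (μ ν : ℝ) : Submodule ℂ L2 where
  carrier := {f | ∃ a a' b b' : ℂ, HasTraces f a a' b b' ∧
    b = μ * a ∧ b' = (μ : ℂ)⁻¹ * a' + ν * a}
  zero_mem' := ⟨0, 0, 0, 0, HasTraces.zero, by simp, by simp⟩
  add_mem' := by
    rintro _ _ ⟨a₁, a₁', _, _, h₁, rfl, rfl⟩ ⟨a₂, a₂', _, _, h₂, rfl, rfl⟩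
    exact ⟨_, _, _, _, h₁.add h₂, by ring, by ring⟩
  smul_mem' := by
    rintro c _ ⟨a, a', _, _, h, rfl, rfl⟩
    exact ⟨_, _, _, _, h.smul c, by ring, by ring⟩

/-- The point interaction operator `S(μ, ν)`: it acts as `-d²/dx²` on the functions in
`W₂²(ℝ ∖ {0})` that satisfy the coupling conditions at the origin. -/
def pointInteraction (μ ν : ℝ) : L2 →ₗ.[ℂ] L2 :=
  (negSecondDeriv {0}ᶜ isOpen_compl_singleton (by simp)).domRestrict (couplingSubmodule μ ν)

/-! ### Resolvents and norm resolvent convergence -/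

section Resolvent

variable {H : Type*} [NormedAddCommGroup H] [NormedSpace ℂ H]

/-- `R` is the resolvent `(A - ζ)⁻¹`: a bounded, everywhere defined two-sided inverse
of `A - ζ`. -/
def IsResolvent (A : H →ₗ.[ℂ] H) (ζ : ℂ) (R : H →L[ℂ] H) : Prop :=
  (∀ f : H, ∃ h : R f ∈ A.domain, A ⟨R f, h⟩ - ζ • R f = f) ∧
    ∀ u : A.domain, R (A u - ζ • (u : H)) = u

/-- The resolvent set of an unbounded operator. -/
def resolvents (A : H →ₗ.[ℂ] H) : Set ℂ := {ζ | ∃ R, IsResolvent A ζ R}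

open Classical in
/-- The resolvent `(A - ζ)⁻¹`; it is `0` by convention if `ζ` is not in the resolvent set. -/
def resolventAt (A : H →ₗ.[ℂ] H) (ζ : ℂ) : H →L[ℂ] H :=
  if h : ζ ∈ resolvents A then h.choose else 0

/-- Norm resolvent convergence of a family of operators `A i` to `A₀` along the filter `l`. -/
def NormResolventTendsto {ι : Type*} (A : ι → H →ₗ.[ℂ] H) (l : Filter ι)
    (A₀ : H →ₗ.[ℂ] H) : Prop :=
  ∀ ζ : ℂ, ζ.im ≠ 0 → ζ ∈ resolvents A₀ ∧ (∀ᶠ i in l, ζ ∈ resolvents (A i)) ∧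
    Tendsto (fun i => ‖resolventAt (A i) ζ - resolventAt A₀ ζ‖) l (𝓝 0)

end Resolvent

end PointInteraction

end

open PointInteraction

/-! Write `ε = δ²`. For `f ∈ L₂` let `w` and `v` be the images of `f` under the resolvents at `ζ` of
the squeezed operator and of the limit operator, let `d = w - v`, and let `z` be the image of `d`
under the limit resolvent at `conj ζ`. Symmetry of the limit operator gives `⟪d, v⟫ = ⟪z, f⟫`, hence
`‖d‖² = ⟪d, w⟫ - ⟪z, f⟫`. No approximate eigenfunction has to be built: it suffices to bound this
one expression by `const · δ ‖f‖ ‖d‖` (`exists_norm_resolventAt_sub_le`).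

Outside `[-δ², δ²]` the potential vanishes, so `w'' = -f - ζ w` and `z'' = -d - conj ζ z`, and
Green's formula turns the integral there into a boundary form in the traces at `±δ²`. On the short
interval both `w` and `z` are bounded, and Cauchy-Schwarz over a length `2δ²` yields a factor `δ`.
The boundary form would vanish if `w` and `z` satisfied the same coupling conditions exactly
(`norm_boundary_form_le` quantifies this). For `z` they hold at `0`, and its traces at `±δ²` differ
from those at `0` by `O(δ)`, because a function with second derivative in `L₂` has a Hölder-1/2
derivative.

For `w` the conditions hold approximately because of resonance. The rescaled function `Y(s) = w(δ²
s)` solves on `[-1, 1]` the equation `Y'' = (αΦ + δ²βΨ - δ⁴ζ) Y - r` with `∫ ‖r‖ = O(δ³)` and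
`Y'(-1) = O(δ²)`. Grönwall compares it with the half-bound state `u`, whose derivative vanishes at
`±1`: `Y = (Y(-1) / u(-1)) u + O(δ²)`, so `Y(1) ≈ θ Y(-1)`. The Wronskian of `Y` and `u` kills `αΦ`
and leaves `Y'(1) u(1) - Y'(-1) u(-1) ≈ δ² β (Y(-1) / u(-1)) ∫ Ψ u²`; division by `δ²` gives the
derivative condition with `ν = βκ` and error `O(δ)`.

Self-adjointness and the resolvent bounds come from a single criterion, `IsMaximalSymmetric`,
checked by Green's formula and by du Bois-Reymond's lemma. Throughout, a function on a half-line is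
represented by a primitive defined on all of `ℝ` (`IsRepOn`), so that one-sided traces become
ordinary values at the endpoint. -/

open MeasureTheory Filter Topology Set
open scoped ENNReal ContDiff ComplexConjugate

noncomputable section

namespace PointInteraction

/-! ### Primitives of locally integrable functions -/

/-- `F` is an indefinite integral of the locally integrable function `f`. -/
def IsPrimitive (F f : ℝ → ℂ) : Prop :=
  LocallyIntegrable f ∧ ∀ a b : ℝ, F b - F a = ∫ t in a..b, f t

lemma intervalIntegrable_of_locallyIntegrable {E : Type*} [NormedAddCommGroup E] {f : ℝ → E}
    (hf : LocallyIntegrable f) (a b : ℝ) : IntervalIntegrable f volume a b :=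
  (intervalIntegrable_iff' (by simp)).mpr (hf.integrableOn_isCompact isCompact_uIcc)

namespace IsPrimitive

variable {F f G g : ℝ → ℂ}

lemma intervalIntegrable (h : IsPrimitive F f) (a b : ℝ) : IntervalIntegrable f volume a b :=
  intervalIntegrable_of_locallyIntegrable h.1 a b

lemma integral (hf : LocallyIntegrable f) (a : ℝ) : IsPrimitive (fun x => ∫ t in a..x, f t) f := by
  refine ⟨hf, fun b c => ?_⟩
  exact intervalIntegral.integral_interval_sub_left
    (intervalIntegrable_of_locallyIntegrable hf _ _) (intervalIntegrable_of_locallyIntegrable hf _ _)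

lemma eq_add (h : IsPrimitive F f) (a x : ℝ) : F x = F a + ∫ t in a..x, f t := by
  rw [← h.2 a x]; ring

lemma continuous (h : IsPrimitive F f) : Continuous F := by
  have h1 : F = fun x => F 0 + ∫ t in (0 : ℝ)..x, f t := funext fun x => h.eq_add 0 x
  rw [h1]
  exact continuous_const.add (intervalIntegral.continuous_primitive (h.intervalIntegrable) 0)

lemma hasDerivAt (h : IsPrimitive F f) (hf : Continuous f) (x : ℝ) : HasDerivAt F (f x) x := by
  have h1 : F = fun x => F 0 + ∫ t in (0 : ℝ)..x, f t := funext fun x => h.eq_add 0 x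
  rw [h1]
  exact (intervalIntegral.integral_hasDerivAt_right (h.intervalIntegrable _ _)
    (hf.stronglyMeasurableAtFilter _ _) hf.continuousAt).const_add _

lemma of_hasDerivAt (h : ∀ x, HasDerivAt F (f x) x) (hf : LocallyIntegrable f) :
    IsPrimitive F f :=
  ⟨hf, fun a b => (intervalIntegral.integral_eq_sub_of_hasDerivAt (fun x _ => h x)
    (intervalIntegrable_of_locallyIntegrable hf a b)).symm⟩

lemma congr_ae (h : IsPrimitive F f) (hfg : f =ᵐ[volume] g) : IsPrimitive F g := by
  refine ⟨h.1.congr hfg, fun a b => ?_⟩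
  rw [h.2, intervalIntegral.integral_congr_ae]
  filter_upwards [hfg] with x hx _ using hx

lemma add (hF : IsPrimitive F f) (hG : IsPrimitive G g) :
    IsPrimitive (fun x => F x + G x) (fun x => f x + g x) := by
  refine ⟨hF.1.add hG.1, fun a b => ?_⟩
  rw [intervalIntegral.integral_add (hF.intervalIntegrable a b) (hG.intervalIntegrable a b),
    ← hF.2, ← hG.2]
  ring

lemma const_mul (hF : IsPrimitive F f) (c : ℂ) :
    IsPrimitive (fun x => c * F x) (fun x => c * f x) := by
  refine ⟨hF.1.smul c, fun a b => ?_⟩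
  rw [intervalIntegral.integral_const_mul, ← hF.2]
  ring

lemma neg (hF : IsPrimitive F f) : IsPrimitive (fun x => -F x) (fun x => -f x) := by
  simpa using hF.const_mul (-1)

lemma sub (hF : IsPrimitive F f) (hG : IsPrimitive G g) :
    IsPrimitive (fun x => F x - G x) (fun x => f x - g x) := by
  simpa [sub_eq_add_neg] using hF.add hG.neg

lemma conjugate (hF : IsPrimitive F f) :
    IsPrimitive (fun x => conj (F x)) (fun x => conj (f x)) := by
  refine ⟨?_, fun a b => ?_⟩
  · intro x
    obtain ⟨s, hs, hi⟩ := hF.1 x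
    exact ⟨s, hs, Complex.conjLIE.toContinuousLinearEquiv.toContinuousLinearMap.integrable_comp hi⟩
  · have := hF.2 a b
    rw [← map_sub, this]
    exact (Complex.conjLIE.toContinuousLinearEquiv.toContinuousLinearMap.intervalIntegral_comp_comm
      (hF.intervalIntegrable a b)).symm

lemma comp_mul (hF : IsPrimitive F f) {c : ℝ} (hc : c ≠ 0) :
    IsPrimitive (fun x => F (c * x)) (fun x => c * f (c * x)) := by
  refine ⟨?_, fun a b => ?_⟩
  · rw [locallyIntegrable_iff]
    intro k hk
    obtain ⟨a, ha⟩ := hk.bddBelow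
    obtain ⟨b, hb⟩ := hk.bddAbove
    have h1 : IntervalIntegrable (fun x => f (c * x)) volume a b := by
      have := (hF.intervalIntegrable (c * a) (c * b)).comp_mul_left (c := c)
      simpa [hc] using this
    rcases le_total a b with hab | hab
    · have h2 := (intervalIntegrable_iff_integrableOn_Icc_of_le hab (by simp)).mp h1
      exact (h2.mono_set fun x hx => ⟨ha hx, hb hx⟩).const_mul _
    · refine (IntegrableOn.mono_set (t := {a}) (by simp) fun x hx => ?_).const_mul _
      exact le_antisymm ((hb hx).trans hab) (ha hx)
  · rw [hF.2, intervalIntegral.integral_const_mul]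
    have := intervalIntegral.smul_integral_comp_mul_left (f := f) (a := a) (b := b) c
    rw [← this, Complex.real_smul]

lemma ae_hasDerivAt (hF : IsPrimitive F f) : ∀ᵐ x, HasDerivAt F (f x) x := by
  filter_upwards [_root_.LocallyIntegrable.ae_hasDerivAt_integral hF.1] with x hx
  have h1 : F = fun x => F 0 + ∫ t in (0 : ℝ)..x, f t := funext fun x => hF.eq_add 0 x
  rw [h1]
  exact (hx 0).const_add _

lemma norm_sub_le (hF : IsPrimitive F f) {a b : ℝ} (hab : a ≤ b) :
    ‖F b - F a‖ ≤ ∫ t in a..b, ‖f t‖ := by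
  rw [hF.2]
  exact intervalIntegral.norm_integral_le_integral_norm hab

/-- Increments of `F` are dominated by increments of the real primitive of `‖f‖`, which is
absolutely continuous. -/
lemma absolutelyContinuousOnInterval (hF : IsPrimitive F f) (a b : ℝ) :
    AbsolutelyContinuousOnInterval F a b := by
  have hn := ((hF.intervalIntegrable a b).norm).absolutelyContinuousOnInterval_intervalIntegral
    (c := a) (by simp)
  unfold AbsolutelyContinuousOnInterval at hn ⊢
  refine squeeze_zero (fun E => Finset.sum_nonneg fun _ _ => dist_nonneg) (fun E => ?_) hn
  refine Finset.sum_le_sum fun i _ => ?_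
  have hi : ∀ c d, IntervalIntegrable (fun x => ‖f x‖) volume c d :=
    fun c d => (hF.intervalIntegrable c d).norm
  rw [dist_comm, dist_eq_norm, dist_comm, Real.dist_eq, hF.2,
    intervalIntegral.integral_interval_sub_left (hi _ _) (hi _ _)]
  exact intervalIntegral.norm_integral_le_abs_integral_norm

/-- The product rule holds only almost everywhere here; absolute continuity is what upgrades it to
an integral identity. All integrations by parts rest on this. -/
lemma mul (hF : IsPrimitive F f) (hG : IsPrimitive G g) :
    IsPrimitive (fun x => F x * G x) (fun x => f x * G x + F x * g x) := by
  have hi : LocallyIntegrable (fun x => f x * G x + F x * g x) := by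
    have h1 : LocallyIntegrable (fun x => f x * G x) := by
      simpa [mul_comm] using (locallyIntegrableOn_univ.mp
        ((locallyIntegrableOn_univ.mpr hF.1).continuousOn_smul isOpen_univ.isLocallyClosed
          hG.continuous.continuousOn))
    have h2 : LocallyIntegrable (fun x => F x * g x) := by
      simpa using (locallyIntegrableOn_univ.mp
        ((locallyIntegrableOn_univ.mpr hG.1).continuousOn_smul isOpen_univ.isLocallyClosed
          hF.continuous.continuousOn))
    exact h1.add h2
  refine ⟨hi, fun a b => ?_⟩
  have hP := integral hi a
  have hac : AbsolutelyContinuousOnInterval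
      (fun x => F x * G x - ∫ t in a..x, (f t * G t + F t * g t)) a b :=
    ((hF.absolutelyContinuousOnInterval a b).smul (hG.absolutelyContinuousOnInterval a b)).sub
      (hP.absolutelyContinuousOnInterval a b)
  -- The product minus its candidate primitive is absolutely continuous with derivative zero almost
  -- everywhere, hence constant.
  obtain ⟨C, hC⟩ := hac.const_of_ae_hasDerivAt_zero (by
    filter_upwards [hF.ae_hasDerivAt, hG.ae_hasDerivAt, hP.ae_hasDerivAt] with x h1 h2 h3 _
    have := (h1.mul h2).sub h3
    rw [sub_self] at this
    exact this)
  have ha := hC a (by simp)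
  have hb := hC b (by simp)
  simp only [intervalIntegral.integral_same, sub_zero] at ha hb
  change F b * G b - F a * G a = _
  rw [ha, ← hb]
  ring

end IsPrimitive

/-! ### Maximal symmetric operators and their resolvents -/

section Abstract

variable {H : Type*} [NormedAddCommGroup H] [InnerProductSpace ℂ H]

/-- `A` is symmetric, and every formal eigenvector pair of the adjoint belongs to the graph
of `A`. -/
structure IsMaximalSymmetric (A : H →ₗ.[ℂ] H) : Prop where
  symm : ∀ u v : A.domain, inner ℂ (A u) (v : H) = inner ℂ (u : H) (A v)
  maximal : ∀ g h : H, (∀ φ : A.domain, inner ℂ h (φ : H) = inner ℂ g (A φ)) →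
    ∃ hg : g ∈ A.domain, A ⟨g, hg⟩ = h

namespace IsMaximalSymmetric

variable {A : H →ₗ.[ℂ] H}

/-- Since `V` is defined everywhere and symmetric, `V g` can be moved to the other side of the
adjoint identity; the domain does not change. -/
lemma vadd (hA : IsMaximalSymmetric A) {V : H →ₗ[ℂ] H}
    (hV : ∀ u v : H, inner ℂ (V u) v = inner ℂ u (V v)) : IsMaximalSymmetric (V +ᵥ A) := by
  refine ⟨fun u v => ?_, fun g h hgh => ?_⟩
  · change inner ℂ (V u + A u) (v : H) = inner ℂ (u : H) (V v + A v)
    rw [inner_add_left, inner_add_right, hV, hA.symm]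
  · obtain ⟨hg, e⟩ := hA.maximal g (h - V g) fun φ => by
      have : inner ℂ h (φ : H) = inner ℂ g (V φ + A φ) := hgh φ
      rw [inner_sub_left, this, inner_add_right, hV]
      ring
    refine ⟨hg, ?_⟩
    change V g + A ⟨g, hg⟩ = h
    rw [e]
    abel

/-- `⟪u, A u⟫` is real, so the imaginary part of `⟪u, (A - ζ) u⟫` is `-Im ζ ‖u‖²`; Cauchy-Schwarz
finishes. -/
lemma im_mul_norm_le (hA : IsMaximalSymmetric A) (ζ : ℂ) (u : A.domain) :
    |ζ.im| * ‖(u : H)‖ ≤ ‖A u - ζ • (u : H)‖ := by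
  have hreal : (inner ℂ (u : H) (A u)).im = 0 := by
    have h1 := inner_conj_symm (𝕜 := ℂ) (u : H) (A u)
    rw [hA.symm u u] at h1
    exact Complex.conj_eq_iff_im.mp h1
  have h2 : (inner ℂ (u : H) (A u - ζ • (u : H))).im = -(ζ.im * ‖(u : H)‖ ^ 2) := by
    rw [inner_sub_right, inner_smul_right, inner_self_eq_norm_sq_to_K, Complex.sub_im, hreal]
    norm_cast
    simp [Complex.mul_im, -Complex.ofReal_pow]
  have h3 : |ζ.im| * ‖(u : H)‖ ^ 2 ≤ ‖(u : H)‖ * ‖A u - ζ • (u : H)‖ := by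
    calc |ζ.im| * ‖(u : H)‖ ^ 2 = |(inner ℂ (u : H) (A u - ζ • (u : H))).im| := by
          rw [h2, abs_neg, abs_mul, abs_of_nonneg (sq_nonneg ‖(u : H)‖)]
      _ ≤ ‖inner ℂ (u : H) (A u - ζ • (u : H))‖ := Complex.abs_im_le_norm _
      _ ≤ _ := norm_inner_le_norm _ _
  rcases (norm_nonneg (u : H)).eq_or_lt with h0 | h0
  · rw [← h0, mul_zero]
    exact norm_nonneg _
  · nlinarith

lemma resolvent_norm_le (hA : IsMaximalSymmetric A) {ζ : ℂ} (hζ : ζ.im ≠ 0) {R : H →L[ℂ] H}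
    (hR : IsResolvent A ζ R) (f : H) : ‖R f‖ ≤ ‖f‖ / |ζ.im| := by
  obtain ⟨h, e⟩ := hR.1 f
  have := hA.im_mul_norm_le ζ ⟨R f, h⟩
  rw [e] at this
  rw [le_div_iff₀ (abs_pos.mpr hζ), mul_comm]
  exact this

lemma mem_resolvents_iff {ζ : ℂ} : ζ ∈ resolvents A ↔ IsResolvent A ζ (resolventAt A ζ) := by
  refine ⟨fun h => ?_, fun h => ⟨_, h⟩⟩
  rw [resolventAt, dif_pos h]
  exact h.choose_spec

variable [CompleteSpace H]

lemma isSelfAdjoint (hA : IsMaximalSymmetric A) : IsSelfAdjoint A := by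
  have hd : Dense (A.domain : Set H) := by
    rw [Submodule.dense_iff_topologicalClosure_eq_top, Submodule.topologicalClosure_eq_top_iff,
      Submodule.eq_bot_iff]
    intro f hf
    -- Density is a consequence of maximality: a vector `f` orthogonal to the domain makes `(0, f)`
    -- an adjoint pair, so `f = A 0 = 0`.
    obtain ⟨hg, e⟩ := hA.maximal 0 f fun φ => by
      rw [inner_zero_left]
      exact (Submodule.mem_orthogonal' _ _).mp hf φ φ.2
    rw [← e]
    exact map_zero A.toFun
  have hle : A.adjoint ≤ A := by
    refine ⟨fun g hg => ?_, fun g k hgk => ?_⟩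
    · obtain ⟨hg', -⟩ := hA.maximal g (A.adjoint ⟨g, hg⟩) fun φ =>
        LinearPMap.adjoint_isFormalAdjoint hd ⟨g, hg⟩ φ
      exact hg'
    · obtain ⟨hg', e⟩ := hA.maximal g (A.adjoint g) fun φ =>
        LinearPMap.adjoint_isFormalAdjoint hd g φ
      change A.adjoint g = A k
      rw [← e]
      congr 1
      exact Subtype.ext hgk
  exact le_antisymm hle (LinearPMap.IsFormalAdjoint.le_adjoint hd hA.symm)

/-- On the closed, hence complete, graph the map `A - ζ` is bounded and bounded below, so its range
is closed. A vector orthogonal to the range is an eigenvector of `A` for `conj ζ`, hence zero. -/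
lemma mem_resolvents (hA : IsMaximalSymmetric A) {ζ : ℂ} (hζ : ζ.im ≠ 0) : ζ ∈ resolvents A := by
  have hcl : IsClosed (A.graph : Set (H × H)) := hA.isSelfAdjoint.isClosed
  have : CompleteSpace A.graph := hcl.completeSpace_coe
  let B : A.graph →L[ℂ] H :=
    (ContinuousLinearMap.snd ℂ H H - ζ • ContinuousLinearMap.fst ℂ H H).comp A.graph.subtypeL
  have hB : ∀ p : A.graph, B p = (p : H × H).2 - ζ • (p : H × H).1 := fun p => rfl
  have hζ0 : 0 < |ζ.im| := abs_pos.mpr hζ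
  have hbd : ∀ p : A.graph, ‖p‖ ≤ (|ζ.im|⁻¹ + 1 + ‖ζ‖ * |ζ.im|⁻¹) * ‖B p‖ := by
    rintro ⟨p, hp⟩
    obtain ⟨u, h1, h2⟩ := (LinearPMap.mem_graph_iff _).mp hp
    have h3 := hA.im_mul_norm_le ζ u
    rw [h1, h2] at h3
    rw [hB]
    change ‖p‖ ≤ _ * ‖p.2 - ζ • p.1‖
    set q := ‖p.2 - ζ • p.1‖
    have hq : 0 ≤ q := norm_nonneg _
    have h4 : ‖p.1‖ ≤ |ζ.im|⁻¹ * q := by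
      rw [inv_mul_eq_div, le_div_iff₀ hζ0, mul_comm]
      exact h3
    have h5 : ‖p.2‖ ≤ q + ‖ζ‖ * (|ζ.im|⁻¹ * q) := by
      calc ‖p.2‖ = ‖(p.2 - ζ • p.1) + ζ • p.1‖ := by rw [sub_add_cancel]
        _ ≤ q + ‖ζ • p.1‖ := norm_add_le _ _
        _ ≤ q + ‖ζ‖ * (|ζ.im|⁻¹ * q) := by rw [norm_smul]; gcongr
    have h6 : 0 ≤ |ζ.im|⁻¹ * q := by positivity
    have h7 : 0 ≤ ‖ζ‖ * (|ζ.im|⁻¹ * q) := by positivity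
    refine max_le ?_ ?_ <;> nlinarith
  have hanti := AddMonoidHomClass.antilipschitz_of_bound B
    (K := ⟨|ζ.im|⁻¹ + 1 + ‖ζ‖ * |ζ.im|⁻¹, by positivity⟩) hbd
  have hker : B.ker = ⊥ := LinearMap.ker_eq_bot.mpr hanti.injective
  have hrange : B.range = ⊤ := by
    have hcr : IsClosed (B.range : Set H) := by
      have := hanti.isClosed_range B.uniformContinuous
      rwa [← ContinuousLinearMap.coe_coe B, ← LinearMap.coe_range] at this
    have : CompleteSpace B.range := hcr.completeSpace_coe
    rw [← Submodule.orthogonal_eq_bot_iff, Submodule.eq_bot_iff]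
    intro g hg
    -- Orthogonality to the range says that `(g, conj ζ g)` is an adjoint pair.
    obtain ⟨hg', e⟩ := hA.maximal g (conj ζ • g) fun φ => by
      have h1 := (Submodule.mem_orthogonal' _ _).mp hg (A φ - ζ • (φ : H))
        ⟨⟨((φ : H), A φ), A.mem_graph φ⟩, rfl⟩
      rw [inner_sub_right, inner_smul_right, sub_eq_zero] at h1
      rw [inner_smul_left, Complex.conj_conj, h1]
    have h2 := hA.im_mul_norm_le (conj ζ) ⟨g, hg'⟩
    rw [e, sub_self, norm_zero, Complex.conj_im, abs_neg] at h2
    have h3 : ‖g‖ ≤ 0 := by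
      by_contra hne
      push Not at hne
      exact absurd h2 (not_le.mpr (mul_pos hζ0 hne))
    exact norm_le_zero_iff.mp h3
  let e := ContinuousLinearEquiv.ofBijective B hker hrange
  refine ⟨(ContinuousLinearMap.fst ℂ H H).comp
    (A.graph.subtypeL.comp (e.symm : H →L[ℂ] A.graph)), fun f => ?_, fun u => ?_⟩
  · obtain ⟨u, h1, h2⟩ := (LinearPMap.mem_graph_iff _).mp (e.symm f).2
    have h3 : B (e.symm f) = f := e.apply_symm_apply f
    rw [hB, ← h1, ← h2] at h3
    have h4 : (u : H) = ((e.symm f : A.graph) : H × H).1 := h1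
    change ∃ h : ((e.symm f : A.graph) : H × H).1 ∈ A.domain,
      A ⟨((e.symm f : A.graph) : H × H).1, h⟩ - ζ • ((e.symm f : A.graph) : H × H).1 = f
    rw [← h4]
    exact ⟨u.2, h3⟩
  · have h1 : e ⟨((u : H), A u), A.mem_graph u⟩ = A u - ζ • (u : H) := rfl
    change ((e.symm (A u - ζ • (u : H)) : A.graph) : H × H).1 = u
    rw [← h1, e.symm_apply_apply]

end IsMaximalSymmetric

end Abstract

/-! ### Test functions and the lemma of du Bois-Reymond -/

lemma IsPrimitive.setIntegral_Ioi {F f : ℝ → ℂ} (h : IsPrimitive F f) {a : ℝ}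
    (hf : IntegrableOn f (Ioi a)) (h0 : Tendsto F atTop (𝓝 0)) : ∫ x in Ioi a, f x = -F a := by
  refine tendsto_nhds_unique (intervalIntegral_tendsto_integral_Ioi a hf tendsto_id) ?_
  simp only [← h.2, id]
  simpa using h0.sub_const (F a)

lemma IsPrimitive.setIntegral_Iic {F f : ℝ → ℂ} (h : IsPrimitive F f) {a : ℝ}
    (hf : IntegrableOn f (Iic a)) (h0 : Tendsto F atBot (𝓝 0)) : ∫ x in Iic a, f x = F a := by
  refine tendsto_nhds_unique (intervalIntegral_tendsto_integral_Iic a hf tendsto_id) ?_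
  simp only [← h.2, id]
  simpa using h0.const_sub (F a)

/-- `ψ` is a smooth real function with compact support in `Ω`. -/
structure IsTest (Ω : Set ℝ) (ψ : ℝ → ℝ) : Prop where
  contDiff : ContDiff ℝ ∞ ψ
  hasCompactSupport : HasCompactSupport ψ
  tsupport_subset : tsupport ψ ⊆ Ω

namespace IsTest

variable {Ω : Set ℝ} {φ ψ : ℝ → ℝ}

lemma mono (h : IsTest Ω ψ) {Ω' : Set ℝ} (hΩ : Ω ⊆ Ω') : IsTest Ω' ψ :=
  ⟨h.1, h.2, h.3.trans hΩ⟩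

lemma deriv (h : IsTest Ω ψ) : IsTest Ω (deriv ψ) :=
  ⟨(contDiff_infty_iff_deriv.mp h.1).2, h.2.deriv, tsupport_deriv_subset.trans h.3⟩

lemma hasDerivAt (h : IsTest Ω ψ) (x : ℝ) : HasDerivAt ψ (_root_.deriv ψ x) x :=
  ((h.1.differentiable (by simp)) x).hasDerivAt

lemma add (hφ : IsTest Ω φ) (hψ : IsTest Ω ψ) : IsTest Ω (φ + ψ) :=
  ⟨hφ.1.add hψ.1, hφ.2.add hψ.2,
    (tsupport_add φ ψ).trans (union_subset hφ.3 hψ.3)⟩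

lemma const_mul (hφ : IsTest Ω φ) (c : ℝ) : IsTest Ω (fun x => c * φ x) :=
  ⟨contDiff_const.mul hφ.1, hφ.2.mul_left, (tsupport_mul_subset_right).trans hφ.3⟩

lemma eq_zero (h : IsTest Ω ψ) {x : ℝ} (hx : x ∉ Ω) : ψ x = 0 :=
  image_eq_zero_of_notMem_tsupport fun hx' => hx (h.3 hx')

lemma integrable (h : IsTest Ω ψ) : Integrable ψ :=
  h.1.continuous.integrable_of_hasCompactSupport h.2

lemma integrable_smul (h : IsTest Ω ψ) {f : ℝ → ℂ} (hf : LocallyIntegrable f) :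
    Integrable (fun x => ψ x • f x) :=
  hf.integrable_smul_left_of_hasCompactSupport h.1.continuous h.2

lemma isPrimitive (h : IsTest Ω ψ) :
    IsPrimitive (fun x => (ψ x : ℂ)) (fun x => ((_root_.deriv ψ x : ℝ) : ℂ)) :=
  IsPrimitive.of_hasDerivAt (fun x => (h.hasDerivAt x).ofReal_comp)
    (Complex.continuous_ofReal.comp h.deriv.1.continuous).locallyIntegrable

lemma exists_integral_eq_one (hΩ : IsOpen Ω) (hne : Ω.Nonempty) :
    ∃ ρ : ℝ → ℝ, IsTest Ω ρ ∧ ∫ x, ρ x = 1 := by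
  obtain ⟨c, hc⟩ := hne
  obtain ⟨r, hr, hrΩ⟩ := Metric.isOpen_iff.mp hΩ c hc
  let f : ContDiffBump c := ⟨r / 4, r / 2, by positivity, by linarith⟩
  refine ⟨f.normed volume, ⟨f.contDiff_normed, f.hasCompactSupport_normed, ?_⟩,
    f.integral_normed⟩
  rw [f.tsupport_normed_eq]
  exact (Metric.closedBall_subset_ball (by change r / 2 < r; linarith)).trans hrΩ

/-- The primitive from `-∞` vanishes to the left of the support of `φ`, and by the zero mean also to
the right. Its support lies between the extreme points of that of `φ`, which stays in `Ω` by
order-connectedness. -/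
lemma exists_antideriv (hΩ : OrdConnected Ω) (h : IsTest Ω φ) (h0 : ∫ x, φ x = 0) :
    ∃ ψ, IsTest Ω ψ ∧ _root_.deriv ψ = φ := by
  rcases (tsupport φ).eq_empty_or_nonempty with he | hne
  · have : φ = 0 := tsupport_eq_empty_iff.mp he
    subst this
    refine ⟨0, h, ?_⟩
    ext x
    simp
  have hK : IsCompact (tsupport φ) := h.2
  obtain ⟨a, haK, ha⟩ := hK.exists_isLeast hne
  obtain ⟨b, hbK, hb⟩ := hK.exists_isGreatest hne
  let ψ : ℝ → ℝ := fun x => ∫ t in Iic x, φ t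
  have hd : ∀ x, HasDerivAt ψ (φ x) x := fun x => by
    have e : ψ = fun x => (∫ t in Iic 0, φ t) + ∫ t in (0 : ℝ)..x, φ t := by
      ext x
      rw [← intervalIntegral.integral_Iic_sub_Iic h.integrable.integrableOn
        h.integrable.integrableOn]
      ring
    rw [e]
    exact (intervalIntegral.integral_hasDerivAt_right (h.integrable.intervalIntegrable)
      (h.1.continuous.stronglyMeasurableAtFilter _ _) h.1.continuous.continuousAt).const_add _
  have hder : _root_.deriv ψ = φ := funext fun x => (hd x).deriv
  have hsupp : Function.support ψ ⊆ Icc a b := by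
    intro x hx
    by_contra hxab
    rw [mem_Icc, not_and_or, not_le, not_le] at hxab
    apply hx
    rcases hxab with hxa | hxb
    · refine setIntegral_eq_zero_of_forall_eq_zero fun t ht => ?_
      exact image_eq_zero_of_notMem_tsupport fun ht' =>
        absurd (ha ht') (not_le.mpr (lt_of_le_of_lt ht hxa))
    · change ∫ t in Iic x, φ t = 0
      rw [setIntegral_eq_integral_of_forall_compl_eq_zero, h0]
      intro t ht
      refine image_eq_zero_of_notMem_tsupport fun ht' => ht ?_
      exact (hb ht').trans hxb.le
  have htsupp : tsupport ψ ⊆ Icc a b := closure_minimal hsupp isClosed_Icc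
  refine ⟨ψ, ⟨?_, ?_, htsupp.trans (hΩ.out (h.3 haK) (h.3 hbK))⟩, hder⟩
  · rw [contDiff_infty_iff_deriv, hder]
    exact ⟨fun x => (hd x).differentiableAt, h.1⟩
  · exact isCompact_Icc.of_isClosed_subset (isClosed_tsupport ψ) htsupp

lemma exists_antideriv_sub (hΩ : OrdConnected Ω) {ρ : ℝ → ℝ} (hρ : IsTest Ω ρ)
    (hρ1 : ∫ x, ρ x = 1) (h : IsTest Ω φ) :
    ∃ ψ, IsTest Ω ψ ∧ ∀ x, _root_.deriv ψ x = φ x - (∫ t, φ t) * ρ x := by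
  have h1 := h.add (hρ.const_mul (-∫ t, φ t))
  obtain ⟨ψ, h2, h3⟩ := h1.exists_antideriv hΩ (by
    change ∫ x, (φ x + (-∫ t, φ t) * ρ x) = 0
    rw [integral_add h.integrable (hρ.integrable.const_mul _), integral_const_mul, hρ1]
    ring)
  refine ⟨ψ, h2, fun x => ?_⟩
  rw [h3]
  change φ x + (-∫ t, φ t) * ρ x = _
  ring

end IsTest

/-- Integration by parts on a right half-line against a test function. -/
lemma IsPrimitive.setIntegral_Ioi_deriv_smul {F f : ℝ → ℂ} (h : IsPrimitive F f) {Ω : Set ℝ}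
    {ψ : ℝ → ℝ} (hψ : IsTest Ω ψ) (a : ℝ) :
    ∫ x in Ioi a, deriv ψ x • F x = -(ψ a • F a) - ∫ x in Ioi a, ψ x • f x := by
  have hp := hψ.isPrimitive.mul h
  have i1 := hψ.deriv.integrable_smul h.continuous.locallyIntegrable
  have i2 := hψ.integrable_smul h.1
  have hz : Tendsto (fun x => (ψ x : ℂ) * F x) atTop (𝓝 0) := by
    refine tendsto_const_nhds.congr' ?_
    obtain ⟨b, hb⟩ := hψ.2.isCompact.bddAbove
    filter_upwards [eventually_gt_atTop b] with x hx
    rw [image_eq_zero_of_notMem_tsupport fun hx' => absurd (hb hx') (not_le.mpr hx)]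
    simp
  have := hp.setIntegral_Ioi (a := a) (by simpa [Pi.add_def] using (i1.add i2).integrableOn) hz
  rw [eq_sub_iff_add_eq, ← integral_add i1.integrableOn i2.integrableOn]
  simpa using this

/-- Integration by parts on a left half-line against a test function. -/
lemma IsPrimitive.setIntegral_Iic_deriv_smul {F f : ℝ → ℂ} (h : IsPrimitive F f) {Ω : Set ℝ}
    {ψ : ℝ → ℝ} (hψ : IsTest Ω ψ) (a : ℝ) :
    ∫ x in Iic a, deriv ψ x • F x = ψ a • F a - ∫ x in Iic a, ψ x • f x := by
  have hp := hψ.isPrimitive.mul h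
  have i1 := hψ.deriv.integrable_smul h.continuous.locallyIntegrable
  have i2 := hψ.integrable_smul h.1
  have hz : Tendsto (fun x => (ψ x : ℂ) * F x) atBot (𝓝 0) := by
    refine tendsto_const_nhds.congr' ?_
    obtain ⟨b, hb⟩ := hψ.2.isCompact.bddBelow
    filter_upwards [eventually_lt_atBot b] with x hx
    rw [image_eq_zero_of_notMem_tsupport fun hx' => absurd (hb hx') (not_le.mpr hx)]
    simp
  have := hp.setIntegral_Iic (a := a) (by simpa [Pi.add_def] using (i1.add i2).integrableOn) hz
  rw [eq_sub_iff_add_eq, ← integral_add i1.integrableOn i2.integrableOn]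
  simpa using this

lemma IsPrimitive.integral_deriv_smul {F f : ℝ → ℂ} (h : IsPrimitive F f) {Ω : Set ℝ}
    {ψ : ℝ → ℝ} (hψ : IsTest Ω ψ) : ∫ x, deriv ψ x • F x = -∫ x, ψ x • f x := by
  rw [← intervalIntegral.integral_Iic_add_Ioi (b := 0)
      (hψ.deriv.integrable_smul h.continuous.locallyIntegrable).integrableOn
      (hψ.deriv.integrable_smul h.continuous.locallyIntegrable).integrableOn,
    ← intervalIntegral.integral_Iic_add_Ioi (b := 0)
      (hψ.integrable_smul h.1).integrableOn (hψ.integrable_smul h.1).integrableOn,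
    h.setIntegral_Iic_deriv_smul hψ, h.setIntegral_Ioi_deriv_smul hψ]
  ring

section DuBoisReymond

variable {Ω : Set ℝ}

lemma ae_eq_const_of_integral_deriv_smul_eq_zero (hΩ : IsOpen Ω) (hc : OrdConnected Ω)
    (hne : Ω.Nonempty) {k : ℝ → ℂ} (hk : LocallyIntegrable k)
    (h : ∀ ψ, IsTest Ω ψ → ∫ x, deriv ψ x • k x = 0) : ∃ c : ℂ, ∀ᵐ x, x ∈ Ω → k x = c := by
  obtain ⟨ρ, hρ, hρ1⟩ := IsTest.exists_integral_eq_one hΩ hne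
  refine ⟨∫ x, ρ x • k x, ?_⟩
  set c := ∫ x, ρ x • k x with hcdef
  have key := hΩ.ae_eq_zero_of_integral_contDiff_smul_eq_zero (f := fun x => k x - c)
    (μ := volume) ((hk.sub (locallyIntegrable_const c)).locallyIntegrableOn Ω) fun φ h1 h2 h3 => by
      have hφ : IsTest Ω φ := ⟨h1, h2, h3⟩
      -- Subtracting `(∫ φ) ρ` makes any test function `φ` a derivative of a test function; the
      -- constant is therefore `∫ ρ k`.
      obtain ⟨ψ, hψ, hψ'⟩ := IsTest.exists_antideriv_sub hc hρ hρ1 hφ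
      have := h ψ hψ
      simp only [hψ', sub_smul, mul_smul] at this
      have i2 : Integrable (fun x => (∫ t, φ t) • ρ x • k x) := 
        (hρ.integrable_smul hk).fun_smul (∫ t, φ t)
      rw [integral_sub (hφ.integrable_smul hk) i2,
        integral_smul, ← hcdef] at this
      simp only [smul_sub]
      rw [integral_sub (hφ.integrable_smul hk) (hφ.integrable.smul_const c),
        integral_smul_const, this]
  filter_upwards [key] with x hx hxΩ
  exact sub_eq_zero.mp (hx hxΩ)

/-- A function with a locally integrable weak derivative on an open interval has an absolutely
continuous representative there. -/
lemma exists_isPrimitive_of_weakDeriv (hΩ : IsOpen Ω) (hc : OrdConnected Ω)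
    (hne : Ω.Nonempty) {f g : ℝ → ℂ} (hf : LocallyIntegrable f) (hg : LocallyIntegrable g)
    (h : ∀ ψ, IsTest Ω ψ → ∫ x, deriv ψ x • f x = -∫ x, ψ x • g x) :
    ∃ F, IsPrimitive F g ∧ ∀ᵐ x, x ∈ Ω → f x = F x := by
  have hG := IsPrimitive.integral hg 0
  obtain ⟨c, hc⟩ := ae_eq_const_of_integral_deriv_smul_eq_zero hΩ hc hne
    (hf.sub hG.continuous.locallyIntegrable) fun ψ hψ => by
      simp only [Pi.sub_apply, smul_sub]
      rw [integral_sub (hψ.deriv.integrable_smul hf)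
        (hψ.deriv.integrable_smul hG.continuous.locallyIntegrable), h ψ hψ,
        hG.integral_deriv_smul hψ, sub_self]
  refine ⟨fun x => (∫ t in (0 : ℝ)..x, g t) + c, ⟨hg, fun a b => ?_⟩, ?_⟩
  · rw [← hG.2]
    ring
  · filter_upwards [hc] with x hx hxΩ
    rw [← hx hxΩ]
    simp

/-- A function with a locally integrable weak second derivative on an open interval has a
continuously differentiable representative there. -/
lemma exists_isPrimitive_of_weakSecondDeriv (hΩ : IsOpen Ω) (hc : OrdConnected Ω)
    (hne : Ω.Nonempty) {f h : ℝ → ℂ} (hf : LocallyIntegrable f) (hh : LocallyIntegrable h)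
    (hw : ∀ ψ, IsTest Ω ψ → ∫ x, deriv (deriv ψ) x • f x = ∫ x, ψ x • h x) :
    ∃ y y', IsPrimitive y y' ∧ IsPrimitive y' h ∧ ∀ᵐ x, x ∈ Ω → f x = y x := by
  have hG := IsPrimitive.integral hh 0
  have hGG := IsPrimitive.integral hG.continuous.locallyIntegrable 0
  set G := fun x => ∫ t in (0 : ℝ)..x, h t
  set k := fun x => f x - ∫ t in (0 : ℝ)..x, G t
  have hk : LocallyIntegrable k := hf.sub hGG.continuous.locallyIntegrable
  have hk0 : ∀ ψ, IsTest Ω ψ → ∫ x, deriv (deriv ψ) x • k x = 0 := fun ψ hψ => by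
    simp only [k, smul_sub]
    rw [integral_sub (hψ.deriv.deriv.integrable_smul hf)
      (hψ.deriv.deriv.integrable_smul hGG.continuous.locallyIntegrable), hw ψ hψ,
      hGG.integral_deriv_smul hψ.deriv, hG.integral_deriv_smul hψ, neg_neg, sub_self]
  obtain ⟨ρ, hρ, hρ1⟩ := IsTest.exists_integral_eq_one hΩ hne
  -- After the double primitive of `h` is removed, `k` has weak second derivative zero. Testing with
  -- `ψ'' = φ' - (∫ φ) ρ'` shows that its weak first derivative is the constant `-∫ ρ' k`, so the
  -- first-order lemma applies.
  obtain ⟨F, hF, hFk⟩ := exists_isPrimitive_of_weakDeriv hΩ hc hne hk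
    (g := fun _ => -∫ x, deriv ρ x • k x) (locallyIntegrable_const _) fun φ hφ => by
      obtain ⟨ψ, hψ, hψ'⟩ := IsTest.exists_antideriv_sub hc hρ hρ1 hφ
      have h1 := hk0 ψ hψ
      have h2 : deriv (deriv ψ) = fun x => deriv φ x - (∫ t, φ t) * deriv ρ x := by
        ext x
        rw [funext hψ']
        exact ((hφ.hasDerivAt x).sub ((hρ.hasDerivAt x).const_mul _)).deriv
      simp only [h2, sub_smul, mul_smul] at h1
      have i2 : Integrable (fun x => (∫ t, φ t) • deriv ρ x • k x) :=
        (hρ.deriv.integrable_smul hk).fun_smul (∫ t, φ t)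
      rw [integral_sub (hφ.deriv.integrable_smul hk) i2,
        integral_smul, sub_eq_zero] at h1
      rw [h1, integral_smul_const, smul_neg, neg_neg]
  have hc' : IsPrimitive (fun _ : ℝ => -∫ x, deriv ρ x • k x) (fun _ => 0) :=
    IsPrimitive.of_hasDerivAt (fun x => hasDerivAt_const x _) (locallyIntegrable_const _)
  refine ⟨_, _, hGG.add hF, by simpa using hG.add hc', ?_⟩
  filter_upwards [hFk] with x hx hxΩ
  rw [← hx hxΩ]
  simp [k]

end DuBoisReymond

/-! ### Trace estimates and Green's formula on half-lines -/

lemma locallyIntegrable_norm {f : ℝ → ℂ} (hf : LocallyIntegrable f) :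
    LocallyIntegrable fun x => ‖f x‖ := fun x => by
  obtain ⟨s, hs, hi⟩ := hf x
  exact ⟨s, hs, hi.norm⟩

lemma exists_mul_le_integral {φ : ℝ → ℝ} (hφ : Continuous φ) {a b : ℝ} (hab : a ≤ b) :
    ∃ s ∈ Icc a b, (b - a) * φ s ≤ ∫ x in a..b, φ x := by
  obtain ⟨s, hs, hmin⟩ := isCompact_Icc.exists_isMinOn (nonempty_Icc.mpr hab) hφ.continuousOn
  refine ⟨s, hs, ?_⟩
  have := intervalIntegral.integral_mono_on (μ := volume) (f := fun _ => φ s) hab (by simp)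
    (hφ.intervalIntegrable _ _) fun x hx => hmin hx
  simpa using this

lemma intervalIntegral_mono_set_of_nonneg {φ : ℝ → ℝ} (hφ : LocallyIntegrable φ)
    (h0 : ∀ x, 0 ≤ φ x) {a b c d : ℝ} (hca : c ≤ a) (hab : a ≤ b) (hbd : b ≤ d) :
    ∫ x in a..b, φ x ≤ ∫ x in c..d, φ x :=
  intervalIntegral.integral_mono_interval hca hab hbd (Eventually.of_forall h0)
    (intervalIntegrable_of_locallyIntegrable hφ _ _)

/-- Cauchy-Schwarz, obtained by integrating `((b - a) φ - m)² ≥ 0` with `m = ∫ φ`. -/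
lemma sq_intervalIntegral_le {φ : ℝ → ℝ} {a b : ℝ} (hab : a ≤ b)
    (h1 : IntervalIntegrable φ volume a b) (h2 : IntervalIntegrable (fun x => φ x ^ 2) volume a b) :
    (∫ x in a..b, φ x) ^ 2 ≤ (b - a) * ∫ x in a..b, φ x ^ 2 := by
  rcases hab.eq_or_lt with rfl | hlt
  · simp
  set m := ∫ x in a..b, φ x
  have h3 : 0 ≤ ∫ x in a..b, ((b - a) ^ 2 * φ x ^ 2 - 2 * (b - a) * m * φ x + m ^ 2) :=
    intervalIntegral.integral_nonneg hab fun x _ => by nlinarith [sq_nonneg ((b - a) * φ x - m)]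
  rw [intervalIntegral.integral_add ((h2.const_mul _).sub (h1.const_mul _)) (by simp),
    intervalIntegral.integral_sub (h2.const_mul _) (h1.const_mul _),
    intervalIntegral.integral_const_mul, intervalIntegral.integral_const_mul,
    intervalIntegral.integral_const, smul_eq_mul] at h3
  have h4 : 0 ≤ (b - a) * ((b - a) * (∫ x in a..b, φ x ^ 2) - m ^ 2) := by
    change 0 ≤ (b - a) ^ 2 * (∫ x in a..b, φ x ^ 2) - 2 * (b - a) * m * m + (b - a) * m ^ 2 at h3
    nlinarith
  have h5 := nonneg_of_mul_nonneg_right h4 (sub_pos.mpr hlt)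
  linarith

/-- `y` is a continuously differentiable function with derivative `y'` and second derivative `h`
that represents `f` on `S`. -/
structure IsRepOn (S : Set ℝ) (f h y y' : ℝ → ℂ) : Prop where
  primitive : IsPrimitive y y'
  primitive' : IsPrimitive y' h
  ae_eq : ∀ᵐ x, x ∈ S → f x = y x

namespace IsRepOn

variable {S : Set ℝ} {f h y y' : ℝ → ℂ}

lemma mono (hy : IsRepOn S f h y y') {T : Set ℝ} (hT : T ⊆ S) : IsRepOn T f h y y' :=
  ⟨hy.1, hy.2, by filter_upwards [hy.3] with x hx hxT using hx (hT hxT)⟩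

lemma hasDerivAt (hy : IsRepOn S f h y y') (x : ℝ) : HasDerivAt y (y' x) x :=
  hy.1.hasDerivAt hy.2.continuous x

lemma continuous (hy : IsRepOn S f h y y') : Continuous y := hy.1.continuous

lemma continuous' (hy : IsRepOn S f h y y') : Continuous y' := hy.2.continuous

/-- Interpolation on a unit window: two points where `y` is small, at distance at least `1/3`,
control `y'` through the difference quotient, since `y'` oscillates by at most `∫ ‖h‖`; integrating
back controls `y`. -/
lemma norm_le (hy : IsRepOn S f h y y') {a t : ℝ} (ht : t ∈ Icc a (a + 1)) :
    ‖y t‖ ≤ 21 * ((∫ x in a..a + 1, ‖y x‖) + ∫ x in a..a + 1, ‖h x‖) ∧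
      ‖y' t‖ ≤ 21 * ((∫ x in a..a + 1, ‖y x‖) + ∫ x in a..a + 1, ‖h x‖) := by
  set Y := ∫ x in a..a + 1, ‖y x‖
  set K := ∫ x in a..a + 1, ‖h x‖
  have hyn : LocallyIntegrable fun x => ‖y x‖ := hy.continuous.norm.locallyIntegrable
  have hhn : LocallyIntegrable fun x => ‖h x‖ := locallyIntegrable_norm hy.2.1
  have hK : 0 ≤ K := intervalIntegral.integral_nonneg (by linarith) fun _ _ => norm_nonneg _
  -- In each outer third there is a point with `‖y‖ ≤ 3Y`. Hence `‖y'‖ ≤ 18Y + K`, and then `‖y‖ ≤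
  -- 3Y + (18Y + 2K)`, which explains the constant `21`.
  obtain ⟨s, hs, hs'⟩ := exists_mul_le_integral hy.continuous.norm
    (show a ≤ a + 1 / 3 by linarith)
  obtain ⟨r, hr, hr'⟩ := exists_mul_le_integral hy.continuous.norm
    (show a + 2 / 3 ≤ a + 1 by linarith)
  have hsY := intervalIntegral_mono_set_of_nonneg hyn (fun _ => norm_nonneg _)
    le_rfl (show a ≤ a + 1 / 3 by linarith) (show a + 1 / 3 ≤ a + 1 by linarith)
  have hrY := intervalIntegral_mono_set_of_nonneg hyn (fun _ => norm_nonneg _)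
    (show a ≤ a + 2 / 3 by linarith) (show a + 2 / 3 ≤ a + 1 by linarith) le_rfl
  have hosc : ∀ p ∈ Icc a (a + 1), ∀ q ∈ Icc a (a + 1), ‖y' p - y' q‖ ≤ K := by
    have haux : ∀ p ∈ Icc a (a + 1), ∀ q ∈ Icc a (a + 1), p ≤ q → ‖y' q - y' p‖ ≤ K :=
      fun p hp q hq hpq => (hy.2.norm_sub_le hpq).trans
        (intervalIntegral_mono_set_of_nonneg hhn (fun _ => norm_nonneg _) hp.1 hpq hq.2)
    intro p hp q hq
    rcases le_total p q with hpq | hpq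
    · rw [norm_sub_rev]
      exact haux p hp q hq hpq
    · exact haux q hq p hp hpq
  have hsI : s ∈ Icc a (a + 1) := ⟨hs.1, by linarith [hs.2]⟩
  have hrI : r ∈ Icc a (a + 1) := ⟨by linarith [hr.1], hr.2⟩
  have hsr : s ≤ r := by linarith [hs.2, hr.1]
  have hiy : ∀ p q, IntervalIntegrable y' volume p q :=
    fun p q => hy.continuous'.intervalIntegrable p q
  have h1 : ‖y r - y s - (r - s : ℝ) • y' t‖ ≤ K * |r - s| := by
    rw [hy.1.2, ← intervalIntegral.integral_const,
      ← intervalIntegral.integral_sub (hiy _ _) (by simp)]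
    refine intervalIntegral.norm_integral_le_of_norm_le_const fun x hx => ?_
    rw [uIoc_of_le hsr] at hx
    exact hosc x ⟨hsI.1.trans hx.1.le, hx.2.trans hrI.2⟩ t ht
  rw [abs_of_nonneg (by linarith)] at h1
  have h2 : (r - s) * ‖y' t‖ ≤ ‖y r‖ + ‖y s‖ + K * (r - s) := by
    calc (r - s) * ‖y' t‖ = ‖(r - s : ℝ) • y' t‖ := by
          rw [norm_smul, Real.norm_eq_abs, abs_of_nonneg (by linarith)]
      _ = ‖(y r - y s) - (y r - y s - (r - s : ℝ) • y' t)‖ := by rw [sub_sub_cancel]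
      _ ≤ ‖y r - y s‖ + _ := norm_sub_le _ _
      _ ≤ _ := by linarith [norm_sub_le (y r) (y s)]
  have hy' : ∀ t ∈ Icc a (a + 1), (r - s) * ‖y' t‖ ≤ ‖y r‖ + ‖y s‖ + K * (r - s) →
      ‖y' t‖ ≤ 18 * Y + K := fun t _ h2 => by
    have h3 : (r - s) * (‖y' t‖ - K) ≤ 6 * Y := by linarith
    by_contra hcon
    push Not at hcon
    have hY : 0 ≤ Y := intervalIntegral.integral_nonneg (by linarith) fun _ _ => norm_nonneg _
    nlinarith [hs.2, hr.1]
  have hY : 0 ≤ Y := intervalIntegral.integral_nonneg (by linarith) fun _ _ => norm_nonneg _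
  have hyt := hy' t ht h2
  refine ⟨?_, by linarith⟩
  have h4 : ‖y t - y s‖ ≤ (18 * Y + 2 * K) * |t - s| := by
    rw [hy.1.2]
    refine intervalIntegral.norm_integral_le_of_norm_le_const fun x hx => ?_
    have hx' : x ∈ Icc a (a + 1) := by
      have := uIoc_subset_uIcc hx
      exact uIcc_subset_Icc hsI ht this
    have := hosc x hx' t ht
    have h5 : ‖y' x‖ ≤ ‖y' x - y' t‖ + ‖y' t‖ := by
      simpa using norm_add_le (y' x - y' t) (y' t)
    linarith
  have h6 : |t - s| ≤ 1 := abs_le.mpr ⟨by linarith [ht.1, hsI.2], by linarith [ht.2, hsI.1]⟩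
  have h7 : (18 * Y + 2 * K) * |t - s| ≤ 18 * Y + 2 * K := by
    have : 0 ≤ 18 * Y + 2 * K := by linarith
    nlinarith
  have h8 : ‖y t‖ ≤ ‖y t - y s‖ + ‖y s‖ := by simpa using norm_add_le (y t - y s) (y s)
  linarith

end IsRepOn

/-- The energy density of the pair `f`, `h`. -/
def energy (f h : L2) (x : ℝ) : ℝ := ‖f x‖ ^ 2 + ‖h x‖ ^ 2

lemma integrable_norm_sq (f : L2) : Integrable fun x => ‖f x‖ ^ 2 :=
  (memLp_two_iff_integrable_sq_norm (Lp.memLp f).1).mp (Lp.memLp f)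

lemma integral_norm_sq (f : L2) : ∫ x, ‖f x‖ ^ 2 = ‖f‖ ^ 2 := by
  have h := inner_self_eq_norm_sq (𝕜 := ℂ) f
  rw [L2.inner_def] at h
  have h2 : ∀ x, inner ℂ (f x) (f x) = ((‖f x‖ ^ 2 : ℝ) : ℂ) := fun x => by
    rw [inner_self_eq_norm_sq_to_K]
    norm_cast
  simp only [h2] at h
  rw [integral_complex_ofReal] at h
  exact h

lemma energy_nonneg (f h : L2) (x : ℝ) : 0 ≤ energy f h x := by
  unfold energy
  positivity

lemma integrable_energy (f h : L2) : Integrable (energy f h) :=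
  (integrable_norm_sq f).add (integrable_norm_sq h)

lemma intervalIntegral_energy_le (f h : L2) {a b : ℝ} (hab : a ≤ b) :
    ∫ x in a..b, energy f h x ≤ ‖f‖ ^ 2 + ‖h‖ ^ 2 := by
  rw [intervalIntegral.integral_of_le hab]
  refine (setIntegral_le_integral (integrable_energy f h)
    (Eventually.of_forall (energy_nonneg f h))).trans_eq ?_
  rw [← integral_norm_sq, ← integral_norm_sq]
  exact integral_add (integrable_norm_sq f) (integrable_norm_sq h)

lemma sq_intervalIntegral_norm_le (f : L2) {a b : ℝ} (hab : a ≤ b) :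
    (∫ x in a..b, ‖f x‖) ^ 2 ≤ (b - a) * ∫ x in a..b, ‖f x‖ ^ 2 :=
  sq_intervalIntegral_le hab
    (intervalIntegrable_of_locallyIntegrable (locallyIntegrable_norm (locallyIntegrable_L2 f)) _ _)
    (integrable_norm_sq f).intervalIntegrable

lemma intervalIntegral_norm_le (f : L2) {a b : ℝ} (hab : a ≤ b) :
    ∫ x in a..b, ‖f x‖ ≤ √(b - a) * ‖f‖ := by
  refine le_of_sq_le_sq ?_ (by positivity)
  rw [mul_pow, Real.sq_sqrt (by linarith)]
  refine (sq_intervalIntegral_norm_le f hab).trans ?_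
  refine mul_le_mul_of_nonneg_left ?_ (by linarith)
  rw [intervalIntegral.integral_of_le hab, ← integral_norm_sq]
  exact setIntegral_le_integral (integrable_norm_sq f)
    (Eventually.of_forall fun _ => by positivity)

/-- The window integral is the convolution of `E` with the indicator of `[-1, 0)`. It serves as an
integrable majorant of `‖y'‖²`, so `y'` is in `L₂` without a separate interpolation inequality. -/
lemma integrable_intervalIntegral_add_one {E : ℝ → ℝ} (hE : Integrable E) :
    Integrable fun t => ∫ x in t..t + 1, E x := by
  have hg : Integrable (indicator (Ico (-1 : ℝ) 0) (fun _ => (1 : ℝ))) :=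
    (integrable_indicator_iff measurableSet_Ico).mpr (by simp)
  refine (hE.integrable_convolution (ContinuousLinearMap.mul ℝ ℝ) hg).congr
    (Eventually.of_forall fun t => ?_)
  simp only [convolution_def]
  rw [intervalIntegral.integral_of_le (by linarith), ← integral_indicator measurableSet_Ioc]
  congr 1
  ext x
  simp only [indicator, mem_Ico, mem_Ioc, ContinuousLinearMap.mul_apply']
  by_cases hx : t < x ∧ x ≤ t + 1
  · rw [if_pos hx, if_pos ⟨by linarith, by linarith⟩, mul_one]
  · rw [if_neg hx, if_neg, mul_zero]
    rintro ⟨h1, h2⟩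
    exact hx ⟨by linarith, by linarith⟩

lemma tendsto_intervalIntegral_add_one_atTop {E : ℝ → ℝ} (hE : Integrable E) :
    Tendsto (fun t => ∫ x in t..t + 1, E x) atTop (𝓝 0) := by
  have h1 := intervalIntegral_tendsto_integral_Ioi 0 hE.integrableOn
    (tendsto_atTop_add_const_right atTop (1 : ℝ) tendsto_id)
  have h2 := intervalIntegral_tendsto_integral_Ioi 0 hE.integrableOn
    (tendsto_id (α := ℝ) (x := atTop))
  have := h1.sub h2
  rw [sub_self] at this
  refine this.congr fun t => ?_
  exact intervalIntegral.integral_interval_sub_left hE.intervalIntegrable hE.intervalIntegrable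

lemma tendsto_intervalIntegral_sub_one_atBot {E : ℝ → ℝ} (hE : Integrable E) :
    Tendsto (fun t => ∫ x in (t - 1)..(t - 1) + 1, E x) atBot (𝓝 0) := by
  have h1 := intervalIntegral_tendsto_integral_Iic 0 hE.integrableOn
    (tendsto_atBot_add_const_right atBot (-1 : ℝ) tendsto_id)
  have h2 := intervalIntegral_tendsto_integral_Iic 0 hE.integrableOn
    (tendsto_id (α := ℝ) (x := atBot))
  have := h1.sub h2
  rw [sub_self] at this
  refine this.congr fun t => ?_
  simp only [id, sub_add_cancel, ← sub_eq_add_neg]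
  rw [sub_eq_iff_eq_add,
    intervalIntegral.integral_add_adjacent_intervals hE.intervalIntegrable hE.intervalIntegrable]

/-! ### Trace bounds, decay at infinity and Green's formula for `L₂` data -/

namespace IsRepOn

variable {S : Set ℝ} {f h : L2} {y y' : ℝ → ℂ}

lemma norm_sq_le (hy : IsRepOn S f h y y') {a t : ℝ} (hS : Ioo a (a + 1) ⊆ S)
    (ht : t ∈ Icc a (a + 1)) :
    ‖y t‖ ^ 2 ≤ 882 * ∫ x in a..a + 1, energy f h x ∧
      ‖y' t‖ ^ 2 ≤ 882 * ∫ x in a..a + 1, energy f h x := by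
  obtain ⟨h1, h2⟩ := hy.norm_le ht
  have hab : a ≤ a + 1 := by linarith
  have he : ∫ x in a..a + 1, ‖y x‖ = ∫ x in a..a + 1, ‖f x‖ := by
    rw [intervalIntegral.integral_of_le hab, intervalIntegral.integral_of_le hab,
      integral_Ioc_eq_integral_Ioo, integral_Ioc_eq_integral_Ioo]
    refine setIntegral_congr_ae measurableSet_Ioo ?_
    filter_upwards [hy.ae_eq] with x hx hxI
    rw [hx (hS hxI)]
  rw [he] at h1 h2
  have h3 := sq_intervalIntegral_norm_le f hab
  have h4 := sq_intervalIntegral_norm_le h hab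
  have h5 : ∫ x in a..a + 1, energy f h x
      = (∫ x in a..a + 1, ‖f x‖ ^ 2) + ∫ x in a..a + 1, ‖h x‖ ^ 2 :=
    intervalIntegral.integral_add (integrable_norm_sq f).intervalIntegrable
      (integrable_norm_sq h).intervalIntegrable
  rw [add_sub_cancel_left, one_mul] at h3 h4
  set p := ∫ x in a..a + 1, ‖f x‖
  set q := ∫ x in a..a + 1, ‖h x‖
  -- `882 = 2 · 21²`, from `(p + q)² ≤ 2 (p² + q²)`. The constant `30` in the global trace bound
  -- comes from `882 ≤ 30²`.
  have h6 : (21 * (p + q)) ^ 2 ≤ 882 * ∫ x in a..a + 1, energy f h x := by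
    rw [h5]
    nlinarith [sq_nonneg (p - q)]
  exact ⟨(pow_le_pow_left₀ (norm_nonneg _) h1 2).trans h6,
    (pow_le_pow_left₀ (norm_nonneg _) h2 2).trans h6⟩

lemma norm_trace_le (hy : IsRepOn S f h y y') {a t : ℝ} (hS : Ioo a (a + 1) ⊆ S)
    (ht : t ∈ Icc a (a + 1)) :
    ‖y t‖ ≤ 30 * (‖f‖ + ‖h‖) ∧ ‖y' t‖ ≤ 30 * (‖f‖ + ‖h‖) := by
  obtain ⟨h1, h2⟩ := hy.norm_sq_le hS ht
  have h3 := intervalIntegral_energy_le f h (show a ≤ a + 1 by linarith)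
  have h4 := mul_nonneg (norm_nonneg f) (norm_nonneg h)
  have h5 : 882 * ∫ x in a..a + 1, energy f h x ≤ (30 * (‖f‖ + ‖h‖)) ^ 2 := by
    nlinarith [sq_nonneg ‖f‖, sq_nonneg ‖h‖]
  exact ⟨le_of_sq_le_sq (h1.trans h5) (by positivity),
    le_of_sq_le_sq (h2.trans h5) (by positivity)⟩

/-- The values at `t` are controlled by the energy of the window `[t, t + 1]`, which tends to zero.
This removes the boundary terms at infinity in Green's formula. -/
lemma tendsto_atTop (hy : IsRepOn S f h y y') {a : ℝ} (hS : Ioi a ⊆ S) :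
    Tendsto y atTop (𝓝 0) ∧ Tendsto y' atTop (𝓝 0) := by
  have hE := (tendsto_intervalIntegral_add_one_atTop (integrable_energy f h)).const_mul 882
  rw [mul_zero] at hE
  have hb : ∀ᶠ t in atTop, ‖y t‖ ^ 2 ≤ 882 * (∫ x in t..t + 1, energy f h x) ∧
      ‖y' t‖ ^ 2 ≤ 882 * (∫ x in t..t + 1, energy f h x) := by
    filter_upwards [eventually_ge_atTop a] with t ht
    exact hy.norm_sq_le ((Ioo_subset_Ioi_self.trans (Ioi_subset_Ioi ht)).trans hS)
      ⟨le_rfl, by linarith⟩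
  have key : ∀ w : ℝ → ℂ, (∀ᶠ t in atTop, ‖w t‖ ^ 2 ≤ 882 * ∫ x in t..t + 1, energy f h x) →
      Tendsto w atTop (𝓝 0) := fun w hw => by
    have h2 : Tendsto (fun t => ‖w t‖ ^ 2) atTop (𝓝 0) :=
      squeeze_zero' (Eventually.of_forall fun _ => by positivity) hw hE
    have h3 := h2.sqrt
    simp only [Real.sqrt_sq (norm_nonneg _), Real.sqrt_zero] at h3
    exact tendsto_zero_iff_norm_tendsto_zero.mpr h3
  exact ⟨key y (hb.mono fun _ h => h.1), key y' (hb.mono fun _ h => h.2)⟩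

lemma tendsto_atBot (hy : IsRepOn S f h y y') {a : ℝ} (hS : Iio a ⊆ S) :
    Tendsto y atBot (𝓝 0) ∧ Tendsto y' atBot (𝓝 0) := by
  have hE := (tendsto_intervalIntegral_sub_one_atBot (integrable_energy f h)).const_mul 882
  rw [mul_zero] at hE
  have hb : ∀ᶠ t in atBot, ‖y t‖ ^ 2 ≤ 882 * (∫ x in (t - 1)..(t - 1) + 1, energy f h x) ∧
      ‖y' t‖ ^ 2 ≤ 882 * (∫ x in (t - 1)..(t - 1) + 1, energy f h x) := by
    filter_upwards [eventually_le_atBot a] with t ht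
    refine hy.norm_sq_le ((Ioo_subset_Iio_self.trans (Iio_subset_Iio ?_)).trans hS)
      ⟨by linarith, by linarith⟩
    linarith
  have key : ∀ w : ℝ → ℂ,
      (∀ᶠ t in atBot, ‖w t‖ ^ 2 ≤ 882 * ∫ x in (t - 1)..(t - 1) + 1, energy f h x) →
      Tendsto w atBot (𝓝 0) := fun w hw => by
    have h2 : Tendsto (fun t => ‖w t‖ ^ 2) atBot (𝓝 0) :=
      squeeze_zero' (Eventually.of_forall fun _ => by positivity) hw hE
    have h3 := h2.sqrt
    simp only [Real.sqrt_sq (norm_nonneg _), Real.sqrt_zero] at h3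
    exact tendsto_zero_iff_norm_tendsto_zero.mpr h3
  exact ⟨key y (hb.mono fun _ h => h.1), key y' (hb.mono fun _ h => h.2)⟩

lemma memLp_of_norm_sq_le {u : ℝ → ℂ} (hu : Continuous u) {T : Set ℝ}
    (hT : MeasurableSet T) {B : ℝ → ℝ} (hB : Integrable B) (h : ∀ t ∈ T, ‖u t‖ ^ 2 ≤ B t) :
    MemLp u 2 (volume.restrict T) := by
  rw [memLp_two_iff_integrable_sq_norm hu.aestronglyMeasurable]
  refine Integrable.mono' hB.integrableOn (hu.norm.pow 2).aestronglyMeasurable ?_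
  filter_upwards [ae_restrict_mem hT] with t ht
  rw [Real.norm_of_nonneg (by positivity)]
  exact h t ht

lemma memLp_deriv_Ioi (hy : IsRepOn S f h y y') {a : ℝ} (hS : Ioi a ⊆ S) :
    MemLp y' 2 (volume.restrict (Ioi a)) := by
  refine memLp_of_norm_sq_le hy.continuous' measurableSet_Ioi
    ((integrable_intervalIntegral_add_one (integrable_energy f h)).const_mul 882) fun t ht => ?_
  refine (hy.norm_sq_le ?_ ⟨le_rfl, by linarith⟩).2
  exact (Ioo_subset_Ioi_self.trans (Ioi_subset_Ioi (le_of_lt ht))).trans hS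

lemma memLp_deriv_Iio (hy : IsRepOn S f h y y') {a : ℝ} (hS : Iio a ⊆ S) :
    MemLp y' 2 (volume.restrict (Iio a)) := by
  refine memLp_of_norm_sq_le hy.continuous' measurableSet_Iio
    (((integrable_intervalIntegral_add_one (integrable_energy f h)).comp_sub_right 1).const_mul 882)
    fun t ht => ?_
  refine (hy.norm_sq_le ?_ ⟨by linarith, by linarith⟩).2
  refine (Ioo_subset_Iio_self.trans (Iio_subset_Iio ?_)).trans hS
  linarith [mem_Iio.mp ht]

variable {g k : L2} {z z' : ℝ → ℂ} {T : Set ℝ}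

lemma isPrimitive_wronskian {f h g k : ℝ → ℂ} (hy : IsRepOn S f h y y')
    (hz : IsRepOn T g k z z') :
    IsPrimitive (fun x => y' x * conj (z x) - y x * conj (z' x))
      (fun x => h x * conj (z x) - y x * conj (k x)) := by
  have := (hy.2.mul hz.1.conjugate).sub (hy.1.mul hz.2.conjugate)
  convert this using 2
  ring

/-- Green's formula on a right half-line. -/
lemma green_Ioi (hy : IsRepOn S f h y y') (hz : IsRepOn T g k z z') {a : ℝ} (hS : Ioi a ⊆ S)
    (hT : Ioi a ⊆ T) :
    ∫ x in Ioi a, (inner ℂ (g x) (h x) - inner ℂ (k x) (f x)) =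
      y a * conj (z' a) - y' a * conj (z a) := by
  have hW := hy.isPrimitive_wronskian hz
  have hi : Integrable fun x => inner ℂ (g x) (h x) - inner ℂ (k x) (f x) :=
    (L2.integrable_inner g h).sub (L2.integrable_inner k f)
  have hae : (fun x => inner ℂ (g x) (h x) - inner ℂ (k x) (f x)) =ᵐ[volume.restrict (Ioi a)]
      fun x => h x * conj (z x) - y x * conj (k x) := by
    filter_upwards [ae_restrict_of_ae hy.ae_eq, ae_restrict_of_ae hz.ae_eq,
      ae_restrict_mem measurableSet_Ioi] with x h1 h2 h3
    rw [RCLike.inner_apply, RCLike.inner_apply, h1 (hS h3), h2 (hT h3)]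
  rw [integral_congr_ae hae, hW.setIntegral_Ioi (hi.integrableOn.congr hae)]
  · ring
  · have hc := hy.tendsto_atTop hS
    have hc' := hz.tendsto_atTop hT
    have cc : Tendsto (fun w : ℂ => conj w) (𝓝 0) (𝓝 0) := by
      simpa using Complex.continuous_conj.tendsto 0
    simpa using (hc.2.mul (cc.comp hc'.1)).sub (hc.1.mul (cc.comp hc'.2))

/-- Green's formula on a left half-line. -/
lemma green_Iic (hy : IsRepOn S f h y y') (hz : IsRepOn T g k z z') {a : ℝ} (hS : Iio a ⊆ S)
    (hT : Iio a ⊆ T) :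
    ∫ x in Iic a, (inner ℂ (g x) (h x) - inner ℂ (k x) (f x)) =
      y' a * conj (z a) - y a * conj (z' a) := by
  have hW := hy.isPrimitive_wronskian hz
  have hi : Integrable fun x => inner ℂ (g x) (h x) - inner ℂ (k x) (f x) :=
    (L2.integrable_inner g h).sub (L2.integrable_inner k f)
  have hae : (fun x => inner ℂ (g x) (h x) - inner ℂ (k x) (f x)) =ᵐ[volume.restrict (Iic a)]
      fun x => h x * conj (z x) - y x * conj (k x) := by
    rw [← restrict_Iio_eq_restrict_Iic]
    filter_upwards [ae_restrict_of_ae hy.ae_eq, ae_restrict_of_ae hz.ae_eq,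
      ae_restrict_mem measurableSet_Iio] with x h1 h2 h3
    rw [RCLike.inner_apply, RCLike.inner_apply, h1 (hS h3), h2 (hT h3)]
  rw [integral_congr_ae hae, hW.setIntegral_Iic (hi.integrableOn.congr hae)]
  · have hc := hy.tendsto_atBot hS
    have hc' := hz.tendsto_atBot hT
    have cc : Tendsto (fun w : ℂ => conj w) (𝓝 0) (𝓝 0) := by
      simpa using Complex.continuous_conj.tendsto 0
    simpa using (hc.2.mul (cc.comp hc'.1)).sub (hc.1.mul (cc.comp hc'.2))

end IsRepOn

/-! ### The second derivative operator -/

lemma exists_isRepOn_of_weakSecondDeriv {I : Set ℝ} (hI : IsOpen I) (hc : OrdConnected I)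
    (hne : I.Nonempty) {f h : L2}
    (hw : ∀ ψ, IsTest I ψ → ∫ x, deriv (deriv ψ) x • f x = ∫ x, ψ x • h x) :
    ∃ y y', IsRepOn I f h y y' := by
  obtain ⟨y, y', h1, h2, h3⟩ := exists_isPrimitive_of_weakSecondDeriv hI hc hne
    (locallyIntegrable_L2 f) (locallyIntegrable_L2 h) hw
  exact ⟨y, y', h1, h2, h3⟩

lemma HasWeakDeriv.exists_isRepOn {Ω : Set ℝ} {f g h : L2} (h1 : HasWeakDeriv Ω f g)
    (h2 : HasWeakDeriv Ω g h) {I : Set ℝ} (hI : IsOpen I) (hc : OrdConnected I)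
    (hne : I.Nonempty) (hIΩ : I ⊆ Ω) : ∃ y y', IsRepOn I f h y y' := by
  refine exists_isRepOn_of_weakSecondDeriv hI hc hne fun ψ hψ => ?_
  have hψ' := hψ.mono hIΩ
  rw [h1 _ hψ'.deriv.1 hψ'.deriv.2 hψ'.deriv.3, h2 _ hψ'.1 hψ'.2 hψ'.3, neg_neg]

lemma exists_piecewise_L2 {u v : ℝ → ℂ} (hu : MemLp u 2 (volume.restrict (Iio 0)))
    (hv : MemLp v 2 (volume.restrict (Ioi 0))) :
    ∃ g : L2, (∀ᵐ x, x ∈ Iio (0 : ℝ) → g x = u x) ∧ ∀ᵐ x, x ∈ Ioi (0 : ℝ) → g x = v x := by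
  have h := ((memLp_indicator_iff_restrict measurableSet_Iio).mpr hu).add
    ((memLp_indicator_iff_restrict measurableSet_Ioi).mpr hv)
  refine ⟨h.toLp _, ?_, ?_⟩
  · filter_upwards [h.coeFn_toLp] with x hx hx0
    rw [hx, Pi.add_apply, indicator_of_mem hx0, indicator_of_notMem, add_zero]
    exact not_lt.mpr (le_of_lt (mem_Iio.mp hx0))
  · filter_upwards [h.coeFn_toLp] with x hx hx0
    rw [hx, Pi.add_apply, indicator_of_mem hx0, indicator_of_notMem, zero_add]
    exact not_lt.mpr (le_of_lt (mem_Ioi.mp hx0))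

/-- Integration by parts on each half-line leaves `ψ 0 • (yl 0 - yr 0)`. The alternative in `h0`
covers both uses: matching traces for `Ω = ℝ`, and test functions vanishing at `0` for the punctured
line. -/
lemma hasWeakDeriv_of_piecewise {Ω : Set ℝ} {f g : L2} {yl yr ul ur : ℝ → ℂ}
    (hl : IsPrimitive yl ul) (hr : IsPrimitive yr ur)
    (fl : ∀ᵐ x, x ∈ Iio (0 : ℝ) → f x = yl x) (fr : ∀ᵐ x, x ∈ Ioi (0 : ℝ) → f x = yr x)
    (gl : ∀ᵐ x, x ∈ Iio (0 : ℝ) → g x = ul x) (gr : ∀ᵐ x, x ∈ Ioi (0 : ℝ) → g x = ur x)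
    (h0 : ∀ ψ, IsTest Ω ψ → ψ 0 = 0 ∨ yl 0 = yr 0) : HasWeakDeriv Ω f g := by
  intro ψ a1 a2 a3
  have hψ : IsTest Ω ψ := ⟨a1, a2, a3⟩
  have i1 := hψ.deriv.integrable_smul (locallyIntegrable_L2 f)
  have i2 := hψ.integrable_smul (locallyIntegrable_L2 g)
  rw [← intervalIntegral.integral_Iic_add_Ioi (b := 0) i1.integrableOn i1.integrableOn,
    ← intervalIntegral.integral_Iic_add_Ioi (b := 0) i2.integrableOn i2.integrableOn]
  simp only [integral_Iic_eq_integral_Iio]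
  have e1 : ∫ x in Iio 0, deriv ψ x • f x = ∫ x in Iic 0, deriv ψ x • yl x := by
    rw [integral_Iic_eq_integral_Iio]
    refine setIntegral_congr_ae measurableSet_Iio ?_
    filter_upwards [fl] with x hx hx0
    rw [hx hx0]
  have e2 : ∫ x in Ioi 0, deriv ψ x • f x = ∫ x in Ioi 0, deriv ψ x • yr x := by
    refine setIntegral_congr_ae measurableSet_Ioi ?_
    filter_upwards [fr] with x hx hx0
    rw [hx hx0]
  have e3 : ∫ x in Iio 0, ψ x • g x = ∫ x in Iic 0, ψ x • ul x := by
    rw [integral_Iic_eq_integral_Iio]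
    refine setIntegral_congr_ae measurableSet_Iio ?_
    filter_upwards [gl] with x hx hx0
    rw [hx hx0]
  have e4 : ∫ x in Ioi 0, ψ x • g x = ∫ x in Ioi 0, ψ x • ur x := by
    refine setIntegral_congr_ae measurableSet_Ioi ?_
    filter_upwards [gr] with x hx hx0
    rw [hx hx0]
  rw [e1, e2, e3, e4, hl.setIntegral_Iic_deriv_smul hψ, hr.setIntegral_Ioi_deriv_smul hψ]
  rcases h0 ψ hψ with h | h
  · rw [h, zero_smul, zero_smul]
    ring
  · rw [h]
    ring

/-- Sufficient condition for membership in `W₂²(Ω)` in terms of one-sided representatives. -/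
lemma exists_hasWeakDeriv_of_isRepOn {Ω : Set ℝ} {f h : L2} {yl yl' yr yr' : ℝ → ℂ}
    (hl : IsRepOn (Iio 0) f h yl yl') (hr : IsRepOn (Ioi 0) f h yr yr')
    (h0 : ∀ ψ, IsTest Ω ψ → ψ 0 = 0 ∨ yl 0 = yr 0 ∧ yl' 0 = yr' 0) :
    ∃ g : L2, HasWeakDeriv Ω f g ∧ HasWeakDeriv Ω g h := by
  obtain ⟨g, gl, gr⟩ := exists_piecewise_L2 (hl.memLp_deriv_Iio subset_rfl)
    (hr.memLp_deriv_Ioi subset_rfl)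
  exact ⟨g, hasWeakDeriv_of_piecewise hl.1 hr.1 hl.3 hr.3 gl gr
      fun ψ hψ => (h0 ψ hψ).imp_right And.left,
    hasWeakDeriv_of_piecewise hl.2 hr.2 gl gr (by simp) (by simp)
      fun ψ hψ => (h0 ψ hψ).imp_right And.right⟩

lemma exists_hasWeakDeriv_univ {f h : L2} {y y' : ℝ → ℂ} (hy : IsRepOn univ f h y y') :
    ∃ g : L2, HasWeakDeriv univ f g ∧ HasWeakDeriv univ g h :=
  exists_hasWeakDeriv_of_isRepOn (hy.mono (subset_univ _)) (hy.mono (subset_univ _))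
    fun _ _ => Or.inr ⟨rfl, rfl⟩

lemma exists_hasWeakDeriv_compl_zero {f h : L2} {yl yl' yr yr' : ℝ → ℂ}
    (hl : IsRepOn (Iio 0) f h yl yl') (hr : IsRepOn (Ioi 0) f h yr yr') :
    ∃ g : L2, HasWeakDeriv {0}ᶜ f g ∧ HasWeakDeriv {0}ᶜ g h :=
  exists_hasWeakDeriv_of_isRepOn hl hr fun _ hψ => Or.inl (hψ.eq_zero (by simp))

section

variable {Ω : Set ℝ} (hΩ : IsOpen Ω) (hΩ' : volume Ωᶜ = 0)

lemma negSecondDeriv_spec (u : (negSecondDeriv Ω hΩ hΩ').domain) :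
    ∃ h : L2, negSecondDeriv Ω hΩ hΩ' u = -h ∧
      ∃ g : L2, HasWeakDeriv Ω (u : L2) g ∧ HasWeakDeriv Ω g h := by
  let u' : W22 Ω := u
  exact ⟨(exists_secondDeriv u').choose, rfl, (exists_secondDeriv u').choose_spec⟩

lemma negSecondDeriv_eq {f h : L2} (hf : ∃ g : L2, HasWeakDeriv Ω f g ∧ HasWeakDeriv Ω g h) :
    ∃ hf' : f ∈ (negSecondDeriv Ω hΩ hΩ').domain, negSecondDeriv Ω hΩ hΩ' ⟨f, hf'⟩ = -h := by
  obtain ⟨g, h1, h2⟩ := hf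
  refine ⟨⟨g, h, h1, h2⟩, ?_⟩
  let u' : W22 Ω := ⟨f, ⟨g, h, h1, h2⟩⟩
  change -(exists_secondDeriv u').choose = -h
  rw [secondDeriv_unique hΩ hΩ' (exists_secondDeriv u').choose_spec ⟨g, h1, h2⟩]

end

lemma IsTest.memLp {Ω : Set ℝ} {ψ : ℝ → ℝ} (hψ : IsTest Ω ψ) (μ : Measure ℝ)
    [IsFiniteMeasureOnCompacts μ] : MemLp (fun x => (ψ x : ℂ)) 2 μ := by
  refine (Complex.continuous_ofReal.comp hψ.1.continuous).memLp_of_hasCompactSupport ?_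
  exact hψ.2.comp_left (g := fun x : ℝ => (x : ℂ)) Complex.ofReal_zero

/-- A test function as an element of the domain of the second derivative operator. -/
lemma IsTest.exists_L2 {Ω : Set ℝ} {ψ : ℝ → ℝ} (hψ : IsTest Ω ψ) :
    ∃ f h : L2, f =ᵐ[volume] (fun x => (ψ x : ℂ)) ∧
      h =ᵐ[volume] (fun x => ((_root_.deriv (_root_.deriv ψ) x : ℝ) : ℂ)) ∧
      IsRepOn univ f h (fun x => (ψ x : ℂ)) (fun x => ((_root_.deriv ψ x : ℝ) : ℂ)) := by
  have h1 := hψ.memLp volume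
  have h2 := hψ.deriv.deriv.memLp volume
  refine ⟨h1.toLp _, h2.toLp _, h1.coeFn_toLp, h2.coeFn_toLp, hψ.isPrimitive,
    hψ.deriv.isPrimitive.congr_ae h2.coeFn_toLp.symm, ?_⟩
  filter_upwards [h1.coeFn_toLp] with x hx _ using hx

/-- The weak form of the adjoint equation gives a weak second derivative. -/
lemma weakSecondDeriv_of_inner {g h : L2} {ψ : ℝ → ℝ} {f k : L2}
    (hf : f =ᵐ[volume] (fun x => (ψ x : ℂ)))
    (hk : k =ᵐ[volume] (fun x => ((deriv (deriv ψ) x : ℝ) : ℂ)))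
    (e : inner ℂ h f = inner ℂ g (-k)) :
    ∫ x, deriv (deriv ψ) x • g x = ∫ x, ψ x • (-h : L2) x := by
  rw [inner_neg_right, ← inner_conj_symm h f, ← inner_conj_symm g k, ← map_neg] at e
  have e1 := (starRingEnd ℂ).injective e
  have e2 : inner ℂ f h = ∫ x, ψ x • h x := by
    rw [L2.inner_def]
    refine integral_congr_ae ?_
    filter_upwards [hf] with x hx
    rw [hx, RCLike.inner_apply, Complex.conj_ofReal, Complex.real_smul, mul_comm]
  have e3 : inner ℂ k g = ∫ x, deriv (deriv ψ) x • g x := by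
    rw [L2.inner_def]
    refine integral_congr_ae ?_
    filter_upwards [hk] with x hx
    rw [hx, RCLike.inner_apply, Complex.conj_ofReal, Complex.real_smul, mul_comm]
  rw [← e3, eq_comm, ← neg_eq_iff_eq_neg.mpr e1, e2, ← integral_neg]
  refine integral_congr_ae ?_
  filter_upwards [Lp.coeFn_neg h] with x hx
  rw [hx, Pi.neg_apply, smul_neg]

/-- Green's formula on the line cut at the origin. -/
lemma inner_sub_inner_eq {f h g k : L2} {yl yl' yr yr' zl zl' zr zr' : ℝ → ℂ}
    (hl : IsRepOn (Iio 0) f h yl yl') (hr : IsRepOn (Ioi 0) f h yr yr')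
    (gl : IsRepOn (Iio 0) g k zl zl') (gr : IsRepOn (Ioi 0) g k zr zr') :
    inner ℂ g h - inner ℂ k f = (yl' 0 * conj (zl 0) - yl 0 * conj (zl' 0)) -
      (yr' 0 * conj (zr 0) - yr 0 * conj (zr' 0)) := by
  have i1 := L2.integrable_inner (𝕜 := ℂ) g h
  have i2 := L2.integrable_inner (𝕜 := ℂ) k f
  have i3 : Integrable fun x => inner ℂ (g x) (h x) - inner ℂ (k x) (f x) := i1.sub i2
  rw [L2.inner_def, L2.inner_def, ← integral_sub i1 i2,
    ← intervalIntegral.integral_Iic_add_Ioi (b := 0) i3.integrableOn i3.integrableOn,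
    hl.green_Iic gl subset_rfl subset_rfl, hr.green_Ioi gr subset_rfl subset_rfl]
  ring

theorem isMaximalSymmetric_negSecondDeriv_univ :
    IsMaximalSymmetric (negSecondDeriv univ isOpen_univ (by simp)) := by
  refine ⟨fun u v => ?_, fun g h hgh => ?_⟩
  · obtain ⟨h, eh, g, h1, h2⟩ := negSecondDeriv_spec isOpen_univ (by simp) u
    obtain ⟨k, ek, g', k1, k2⟩ := negSecondDeriv_spec isOpen_univ (by simp) v
    obtain ⟨y, y', hy⟩ := h1.exists_isRepOn h2 isOpen_univ ordConnected_univ univ_nonempty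
      subset_rfl
    obtain ⟨z, z', hz⟩ := k1.exists_isRepOn k2 isOpen_univ ordConnected_univ univ_nonempty
      subset_rfl
    -- With the same representative on both sides of the cut, the two boundary terms at `0` cancel.
    have := inner_sub_inner_eq (hz.mono (subset_univ _)) (hz.mono (subset_univ _))
      (hy.mono (subset_univ _)) (hy.mono (subset_univ _))
    rw [sub_self, sub_eq_zero] at this
    rw [eh, ek, inner_neg_left, inner_neg_right, this]
  -- Tested against smooth compactly supported functions alone, the adjoint identity already says
  -- that `g'' = -h` weakly.
  · obtain ⟨y, y', hy⟩ := exists_isRepOn_of_weakSecondDeriv (f := g) (h := -h) isOpen_univ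
      ordConnected_univ univ_nonempty fun ψ hψ => by
        obtain ⟨f, k, hf, hk, hrep⟩ := hψ.exists_L2
        obtain ⟨hd, e⟩ := negSecondDeriv_eq isOpen_univ (by simp) (exists_hasWeakDeriv_univ hrep)
        refine weakSecondDeriv_of_inner hf hk ?_
        rw [← e]
        exact hgh ⟨f, hd⟩
    obtain ⟨hd, e⟩ := negSecondDeriv_eq isOpen_univ (by simp) (exists_hasWeakDeriv_univ hy)
    exact ⟨hd, by rw [e, neg_neg]⟩

/-! ### The point interaction operator is self-adjoint -/

/-- Two continuous functions that agree almost everywhere on an open half-line agree there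
everywhere. Hence the traces do not depend on the representative chosen, and the coupling conditions
become statements about values at `0`. -/
lemma HasTraces.eq_of_isRepOn {f h : L2} {a a' b b' : ℂ} (ht : HasTraces f a a' b b')
    {yl yl' yr yr' : ℝ → ℂ} (hl : IsRepOn (Iio 0) f h yl yl')
    (hr : IsRepOn (Ioi 0) f h yr yr') : yl 0 = a ∧ yl' 0 = a' ∧ yr 0 = b ∧ yr' 0 = b' := by
  obtain ⟨φ, e, d, p, q, r, s⟩ := ht
  have hφl : EqOn φ yl (Iio 0) := by
    refine Measure.eqOn_open_of_ae_eq (μ := volume) ?_ isOpen_Iio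
      (fun x hx => (d x (ne_of_lt hx)).continuousAt.continuousWithinAt) hl.continuous.continuousOn
    filter_upwards [ae_restrict_of_ae e, ae_restrict_of_ae hl.3, ae_restrict_mem measurableSet_Iio]
      with x h1 h2 h3
    rw [← h1, h2 h3]
  have hφr : EqOn φ yr (Ioi 0) := by
    refine Measure.eqOn_open_of_ae_eq (μ := volume) ?_ isOpen_Ioi
      (fun x hx => (d x (ne_of_gt hx)).continuousAt.continuousWithinAt) hr.continuous.continuousOn
    filter_upwards [ae_restrict_of_ae e, ae_restrict_of_ae hr.3, ae_restrict_mem measurableSet_Ioi]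
      with x h1 h2 h3
    rw [← h1, h2 h3]
  have dl : EqOn (deriv φ) yl' (Iio 0) := fun x hx => by
    rw [(hφl.eventuallyEq_of_mem (isOpen_Iio.mem_nhds hx)).deriv_eq, (hl.hasDerivAt x).deriv]
  have dr : EqOn (deriv φ) yr' (Ioi 0) := fun x hx => by
    rw [(hφr.eventuallyEq_of_mem (isOpen_Ioi.mem_nhds hx)).deriv_eq, (hr.hasDerivAt x).deriv]
  exact ⟨tendsto_nhds_unique (hl.continuous.continuousWithinAt (s := Iio 0))
      (p.congr' (hφl.eventuallyEq_of_mem self_mem_nhdsWithin)),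
    tendsto_nhds_unique (hl.continuous'.continuousWithinAt (s := Iio 0))
      (q.congr' (dl.eventuallyEq_of_mem self_mem_nhdsWithin)),
    tendsto_nhds_unique (hr.continuous.continuousWithinAt (s := Ioi 0))
      (r.congr' (hφr.eventuallyEq_of_mem self_mem_nhdsWithin)),
    tendsto_nhds_unique (hr.continuous'.continuousWithinAt (s := Ioi 0))
      (s.congr' (dr.eventuallyEq_of_mem self_mem_nhdsWithin))⟩

lemma hasTraces_of_isRepOn {f h : L2} {yl yl' yr yr' : ℝ → ℂ}
    (hl : IsRepOn (Iio 0) f h yl yl') (hr : IsRepOn (Ioi 0) f h yr yr') :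
    HasTraces f (yl 0) (yl' 0) (yr 0) (yr' 0) := by
  classical
  let φ : ℝ → ℂ := fun x => if x < 0 then yl x else yr x
  have el : EqOn φ yl (Iio 0) := fun x hx => if_pos hx
  have er : EqOn φ yr (Ioi 0) := fun x hx => if_neg (not_lt.mpr (le_of_lt hx))
  have dl : ∀ x ∈ Iio (0 : ℝ), HasDerivAt φ (yl' x) x := fun x hx =>
    (hl.hasDerivAt x).congr_of_eventuallyEq (el.eventuallyEq_of_mem (isOpen_Iio.mem_nhds hx))
  have dr : ∀ x ∈ Ioi (0 : ℝ), HasDerivAt φ (yr' x) x := fun x hx =>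
    (hr.hasDerivAt x).congr_of_eventuallyEq (er.eventuallyEq_of_mem (isOpen_Ioi.mem_nhds hx))
  refine ⟨φ, ?_, fun x hx => ?_, ?_, ?_, ?_, ?_⟩
  · have h0 : ∀ᵐ x : ℝ, x ≠ 0 := by simp [ae_iff]
    filter_upwards [hl.3, hr.3, h0] with x h1 h2 h3
    rcases lt_or_gt_of_ne h3 with hx | hx
    · rw [h1 hx, el hx]
    · rw [h2 hx, er hx]
  · rcases lt_or_gt_of_ne hx with hx | hx
    · exact (dl x hx).differentiableAt
    · exact (dr x hx).differentiableAt
  · exact (hl.continuous.continuousWithinAt (s := Iio 0) (x := 0)).tendsto.congr'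
      (el.symm.eventuallyEq_of_mem self_mem_nhdsWithin)
  · refine (hl.continuous'.continuousWithinAt (s := Iio 0) (x := 0)).tendsto.congr' ?_
    filter_upwards [self_mem_nhdsWithin] with x hx using (dl x hx).deriv.symm
  · exact (hr.continuous.continuousWithinAt (s := Ioi 0) (x := 0)).tendsto.congr'
      (er.symm.eventuallyEq_of_mem self_mem_nhdsWithin)
  · refine (hr.continuous'.continuousWithinAt (s := Ioi 0) (x := 0)).tendsto.congr' ?_
    filter_upwards [self_mem_nhdsWithin] with x hx using (dr x hx).deriv.symm

lemma pointInteraction_spec {μ ν : ℝ} (u : (pointInteraction μ ν).domain) :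
    ∃ (h : L2) (yl yl' yr yr' : ℝ → ℂ), pointInteraction μ ν u = -h ∧
      IsRepOn (Iio 0) (u : L2) h yl yl' ∧ IsRepOn (Ioi 0) (u : L2) h yr yr' ∧
      yr 0 = μ * yl 0 ∧ yr' 0 = (μ : ℂ)⁻¹ * yl' 0 + ν * yl 0 := by
  obtain ⟨h, eh, g, h1, h2⟩ := negSecondDeriv_spec isOpen_compl_singleton (by simp)
    ⟨(u : L2), u.2.2⟩
  obtain ⟨yl, yl', hl⟩ := h1.exists_isRepOn h2 isOpen_Iio ordConnected_Iio nonempty_Iio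
    (I := Iio 0) (fun x hx => ne_of_lt hx)
  obtain ⟨yr, yr', hr⟩ := h1.exists_isRepOn h2 isOpen_Ioi ordConnected_Ioi nonempty_Ioi
    (I := Ioi 0) (fun x hx => ne_of_gt hx)
  obtain ⟨a, a', b, b', ht, e1, e2⟩ := u.2.1
  obtain ⟨rfl, rfl, rfl, rfl⟩ := ht.eq_of_isRepOn hl hr
  exact ⟨h, yl, yl', yr, yr', eh, hl, hr, e1, e2⟩

lemma pointInteraction_eq {μ ν : ℝ} {f h : L2} {yl yl' yr yr' : ℝ → ℂ}
    (hl : IsRepOn (Iio 0) f h yl yl') (hr : IsRepOn (Ioi 0) f h yr yr')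
    (e1 : yr 0 = μ * yl 0) (e2 : yr' 0 = (μ : ℂ)⁻¹ * yl' 0 + ν * yl 0) :
    ∃ hf : f ∈ (pointInteraction μ ν).domain, pointInteraction μ ν ⟨f, hf⟩ = -h := by
  obtain ⟨hd, e⟩ := negSecondDeriv_eq isOpen_compl_singleton (by simp)
    (exists_hasWeakDeriv_compl_zero hl hr)
  exact ⟨⟨⟨_, _, _, _, hasTraces_of_isRepOn hl hr, e1, e2⟩, hd⟩, e⟩

/-- The second derivative may be changed off `I`: integrating `h` twice from the endpoint `c` with
the Cauchy data of `y` reproduces `y` on `I`. This is how the potential is discarded outside its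
support. -/
lemma exists_isRepOn_of_eqOn {I : Set ℝ} {c : ℝ} (hI : ∀ x ∈ I, ∀ t ∈ uIcc c x, t ≠ c → t ∈ I)
    {f h y y' k : ℝ → ℂ} (hh : LocallyIntegrable h) (hy : IsPrimitive y y')
    (hy' : IsPrimitive y' k) (hf : ∀ᵐ x, x ∈ I → f x = y x) (hk : ∀ᵐ x, x ∈ I → h x = k x) :
    ∃ w w', IsRepOn I f h w w' ∧ w c = y c ∧ w' c = y' c := by
  have shift : ∀ {F p : ℝ → ℂ} (b : ℂ), IsPrimitive F p → IsPrimitive (fun x => b + F x) p :=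
    fun b hF => ⟨hF.1, fun _ _ => by rw [← hF.2]; ring⟩
  have h0 : ∀ᵐ x : ℝ, x ≠ c := by simp [ae_iff]
  have w1 := shift (y' c) (IsPrimitive.integral hh c)
  have w2 := shift (y c) (IsPrimitive.integral w1.continuous.locallyIntegrable c)
  have e1 : ∀ x ∈ I, y' c + ∫ t in c..x, h t = y' x := fun x hx => by
    rw [hy'.eq_add c x]
    congr 1
    refine intervalIntegral.integral_congr_ae ?_
    filter_upwards [hk, h0] with t ht ht0 htx using ht (hI x hx t (uIoc_subset_uIcc htx) ht0)
  refine ⟨_, _, ⟨w2, w1, ?_⟩, by simp, by simp⟩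
  filter_upwards [hf] with x hx hxI
  rw [hx hxI, hy.eq_add c x]
  congr 1
  refine intervalIntegral.integral_congr_ae ?_
  filter_upwards [h0] with t ht0 htx
  exact (e1 t (hI x hxI t (uIoc_subset_uIcc htx) ht0)).symm

/-- On each side the combination `c χ + c' x χ` has Cauchy data `(c, c')` at `0`, where the cutoff
`χ` equals `1` near `0`. These functions probe the coupling conditions in the maximality proof. -/
lemma exists_isRepOn_with_traces (a a' b b' : ℂ) :
    ∃ (f h : L2) (yl yl' yr yr' : ℝ → ℂ), IsRepOn (Iio 0) f h yl yl' ∧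
      IsRepOn (Ioi 0) f h yr yr' ∧ yl 0 = a ∧ yl' 0 = a' ∧ yr 0 = b ∧ yr' 0 = b' := by
  let χ : ContDiffBump (0 : ℝ) := ⟨1, 2, one_pos, one_lt_two⟩
  have h1 : IsTest univ χ := ⟨χ.contDiff, χ.hasCompactSupport, subset_univ _⟩
  have h2 : IsTest univ (fun x => x * χ x) :=
    ⟨contDiff_id.mul χ.contDiff, χ.hasCompactSupport.mul_left, subset_univ _⟩
  have hχ0 : χ 0 = 1 := χ.one_of_mem_closedBall (Metric.mem_closedBall_self zero_le_one)
  have hχ' : deriv χ 0 = 0 := by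
    have : (χ : ℝ → ℝ) =ᶠ[𝓝 0] fun _ => 1 := χ.eventuallyEq_one
    rw [this.deriv_eq, deriv_const]
  have h2' : deriv (fun x => x * χ x) 0 = 1 := by
    have := ((hasDerivAt_id (0 : ℝ)).mul (h1.hasDerivAt 0)).deriv
    simp only [id, hχ', hχ0] at this
    refine Eq.trans ?_ (this.trans (by norm_num))
    rfl
  have key : ∀ c c' : ℂ, ∃ y y' k : ℝ → ℂ, IsPrimitive y y' ∧ IsPrimitive y' k ∧
      MemLp y 2 volume ∧ MemLp k 2 volume ∧ y 0 = c ∧ y' 0 = c' := fun c c' => by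
    refine ⟨_, _, _, (h1.isPrimitive.const_mul c).add (h2.isPrimitive.const_mul c'),
      (h1.deriv.isPrimitive.const_mul c).add (h2.deriv.isPrimitive.const_mul c'),
      ((h1.memLp _).const_mul c).add ((h2.memLp _).const_mul c'),
      ((h1.deriv.deriv.memLp _).const_mul c).add ((h2.deriv.deriv.memLp _).const_mul c'), ?_, ?_⟩
    · simp [hχ0]
    · simp only [hχ', h2']
      simp
  obtain ⟨yl, yl', kl, p1, p2, p3, p4, p5, p6⟩ := key a a'
  obtain ⟨yr, yr', kr, q1, q2, q3, q4, q5, q6⟩ := key b b'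
  obtain ⟨f, fl, fr⟩ := exists_piecewise_L2 (p3.restrict _) (q3.restrict _)
  obtain ⟨h, hl, hr⟩ := exists_piecewise_L2 (p4.restrict _) (q4.restrict _)
  obtain ⟨wl, wl', r1, r2, r3⟩ := exists_isRepOn_of_eqOn (I := Iio 0) (c := 0) (fun x hx t ht ht0 => by
    rw [uIcc_of_ge (le_of_lt hx)] at ht
    exact lt_of_le_of_ne ht.2 ht0) (locallyIntegrable_L2 h) p1 p2 fl hl
  obtain ⟨wr, wr', s1, s2, s3⟩ := exists_isRepOn_of_eqOn (I := Ioi 0) (c := 0) (fun x hx t ht ht0 => by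
    rw [uIcc_of_le (le_of_lt hx)] at ht
    exact lt_of_le_of_ne ht.1 ht0.symm) (locallyIntegrable_L2 h) q1 q2 fr hr
  exact ⟨f, h, wl, wl', wr, wr', r1, s1, r2.trans p5, r3.trans p6, s2.trans q5, s3.trans q6⟩

theorem isMaximalSymmetric_pointInteraction {μ : ℝ} (hμ : μ ≠ 0) (ν : ℝ) :
    IsMaximalSymmetric (pointInteraction μ ν) := by
  have hμ' : (μ : ℂ) ≠ 0 := Complex.ofReal_ne_zero.mpr hμ
  refine ⟨fun u v => ?_, fun g h hgh => ?_⟩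
  · obtain ⟨h, yl, yl', yr, yr', eh, hl, hr, e1, e2⟩ := pointInteraction_spec u
    obtain ⟨k, zl, zl', zr, zr', ek, gl, gr, e3, e4⟩ := pointInteraction_spec v
    have := inner_sub_inner_eq gl gr hl hr
    rw [e1, e2, e3, e4] at this
    simp only [map_add, map_mul, map_inv₀, Complex.conj_ofReal] at this
    rw [eh, ek, inner_neg_left, inner_neg_right, neg_inj, eq_comm, ← sub_eq_zero, this]
    field_simp
    ring
  -- Test functions supported away from `0` have zero traces, so they lie in the domain; they give
  -- the regularity of `g` on each half-line.
  · have hw : ∀ ψ, IsTest {0}ᶜ ψ → ∫ x, deriv (deriv ψ) x • g x = ∫ x, ψ x • (-h : L2) x := by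
      intro ψ hψ
      obtain ⟨f, k, hf, hk, hrep⟩ := hψ.exists_L2
      obtain ⟨hd, e⟩ := pointInteraction_eq (μ := μ) (ν := ν) (hrep.mono (subset_univ _))
        (hrep.mono (subset_univ _)) (by simp [hψ.eq_zero]) (by simp [hψ.eq_zero, hψ.deriv.eq_zero])
      refine weakSecondDeriv_of_inner hf hk ?_
      rw [← e]
      exact hgh ⟨f, hd⟩
    obtain ⟨zl, zl', gl⟩ := exists_isRepOn_of_weakSecondDeriv isOpen_Iio ordConnected_Iio
      nonempty_Iio (I := Iio 0) fun ψ hψ => hw ψ (hψ.mono fun x hx => ne_of_lt hx)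
    obtain ⟨zr, zr', gr⟩ := exists_isRepOn_of_weakSecondDeriv isOpen_Ioi ordConnected_Ioi
      nonempty_Ioi (I := Ioi 0) fun ψ hψ => hw ψ (hψ.mono fun x hx => ne_of_gt hx)
    -- The boundary form must vanish against every admissible set of traces. The left data `(0, 1)`
    -- and `(1, 0)` then yield the two coupling conditions for `g`.
    have key : ∀ a a' : ℂ, a' * conj (zl 0) - a * conj (zl' 0) =
        ((μ : ℂ)⁻¹ * a' + ν * a) * conj (zr 0) - μ * a * conj (zr' 0) := fun a a' => by
      obtain ⟨f, k, yl, yl', yr, yr', hl, hr, e1, e2, e3, e4⟩ :=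
        exists_isRepOn_with_traces a a' (μ * a) ((μ : ℂ)⁻¹ * a' + ν * a)
      obtain ⟨hd, e⟩ := pointInteraction_eq (μ := μ) (ν := ν) hl hr (by rw [e3, e1])
        (by rw [e4, e1, e2])
      have h1 := hgh ⟨f, hd⟩
      have h2 := inner_sub_inner_eq hl hr gl gr
      rw [e, inner_neg_right] at h1
      rw [inner_neg_left, e1, e2, e3, e4] at h2
      change inner ℂ h f = -inner ℂ g k at h1
      rw [h1, neg_neg, sub_self] at h2
      exact sub_eq_zero.mp h2.symm
    have k1 := key 0 1
    have k2 := key 1 0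
    simp only [one_mul, zero_mul, mul_zero, sub_zero, add_zero, zero_add, zero_sub, mul_one]
      at k1 k2
    have t1 : zr 0 = μ * zl 0 := by
      have := congrArg conj k1
      simp only [map_mul, map_inv₀, Complex.conj_ofReal, Complex.conj_conj] at this
      rw [this]
      field_simp
    have t2 : zr' 0 = (μ : ℂ)⁻¹ * zl' 0 + ν * zl 0 := by
      have := congrArg conj k2
      simp only [map_mul, map_sub, map_neg, Complex.conj_ofReal, Complex.conj_conj] at this
      rw [t1] at this
      field_simp
      linear_combination this
    obtain ⟨hd, e⟩ := pointInteraction_eq gl gr t1 t2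
    exact ⟨hd, by rw [e, neg_neg]⟩

/-! ### The Schrödinger operators are self-adjoint -/

lemma inner_mulOp (V : ℝ → ℝ) (hV : MemLp V ∞) (u v : L2) :
    inner ℂ (mulOp V hV u) v = inner ℂ u (mulOp V hV v) := by
  rw [L2.inner_def, L2.inner_def]
  have h1 := ((Lp.memLp u).smul (r := 2) hV).coeFn_toLp
  have h2 := ((Lp.memLp v).smul (r := 2) hV).coeFn_toLp
  refine integral_congr_ae ?_
  filter_upwards [h1, h2] with x h1 h2
  change mulOp V hV u x = _ at h1
  change mulOp V hV v x = _ at h2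
  rw [h1, h2, RCLike.inner_apply, RCLike.inner_apply, Pi.smul_apply', Pi.smul_apply',
    Complex.real_smul, Complex.real_smul, map_mul, Complex.conj_ofReal]
  ring

theorem isMaximalSymmetric_schrodingerOp (Φ Ψ : Potential) (α β ε : ℝ) :
    IsMaximalSymmetric (schrodingerOp Φ Ψ α β ε) :=
  isMaximalSymmetric_negSecondDeriv_univ.vadd (inner_mulOp _ _)

lemma schrodingerOp_spec {Φ Ψ : Potential} {α β ε : ℝ} (u : (schrodingerOp Φ Ψ α β ε).domain) :
    ∃ (h : L2) (y y' : ℝ → ℂ), IsRepOn univ (u : L2) h y y' ∧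
      ∀ᵐ x, h x = squeezed Φ Ψ α β ε x * y x - schrodingerOp Φ Ψ α β ε u x := by
  obtain ⟨h, eh, g, h1, h2⟩ := negSecondDeriv_spec isOpen_univ (by simp) ⟨(u : L2), u.2⟩
  obtain ⟨y, y', hy⟩ := h1.exists_isRepOn h2 isOpen_univ ordConnected_univ univ_nonempty subset_rfl
  refine ⟨h, y, y', hy, ?_⟩
  have e1 : schrodingerOp Φ Ψ α β ε u = mulOp _ (memLp_squeezed Φ Ψ α β ε) u + -h := by
    rw [← eh]
    rfl
  have e2 := ((Lp.memLp (u : L2)).smul (r := 2) (memLp_squeezed Φ Ψ α β ε)).coeFn_toLp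
  filter_upwards [e2, Lp.coeFn_add (mulOp _ (memLp_squeezed Φ Ψ α β ε) u) (-h), Lp.coeFn_neg h,
    hy.3] with x p1 p2 p3 p4
  change mulOp _ (memLp_squeezed Φ Ψ α β ε) u x = _ at p1
  rw [e1, p2, Pi.add_apply, p3, p1, Pi.smul_apply', Complex.real_smul, Pi.neg_apply,
    p4 (mem_univ x)]
  ring

/-! ### Grönwall estimates for second order equations -/

/-- The differential Grönwall inequality is applied to the right-hand side of the hypothesis, which
is differentiable although `φ` need not be. -/
lemma le_mul_exp_of_le_add_mul_integral {φ : ℝ → ℝ} (hφ : Continuous φ) (h0 : ∀ s, 0 ≤ φ s)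
    {A K a b : ℝ} (hA : 0 ≤ A) (hK : 0 ≤ K)
    (h : ∀ s ∈ Icc a b, φ s ≤ A + K * ∫ t in a..s, φ t) :
    ∀ s ∈ Icc a b, φ s ≤ A * Real.exp (K * (s - a)) := by
  intro s hs
  have hd : ∀ x, HasDerivAt (fun s => A + K * ∫ t in a..s, φ t) (K * φ x) x := fun x =>
    ((intervalIntegral.integral_hasDerivAt_right (hφ.intervalIntegrable _ _)
      (hφ.stronglyMeasurableAtFilter _ _) hφ.continuousAt).const_mul K).const_add A
  have := norm_le_gronwallBound_of_norm_deriv_right_le (f := fun s => A + K * ∫ t in a..s, φ t)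
    (f' := fun x => K * φ x) (δ := A) (K := K) (ε := 0) (a := a) (b := b)
    (fun x _ => (hd x).continuousAt.continuousWithinAt) (fun x _ => (hd x).hasDerivWithinAt)
    (by simp [abs_of_nonneg hA]) (fun x hx => by
      rw [add_zero, Real.norm_of_nonneg (mul_nonneg hK (h0 x)), Real.norm_eq_abs]
      exact mul_le_mul_of_nonneg_left ((h x ⟨hx.1, hx.2.le⟩).trans (le_abs_self _)) hK) s hs
  rw [gronwallBound_ε0] at this
  exact (h s hs).trans ((le_abs_self _).trans this)

/-- Grönwall's inequality for `y'' = h` with `|h| ≤ M |y| + r`. -/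
lemma IsPrimitive.norm_add_norm_le {y y' h : ℝ → ℂ} (hy : IsPrimitive y y')
    (hy' : IsPrimitive y' h) {a b M : ℝ} (hM : 0 ≤ M) {r : ℝ → ℝ} (hr : LocallyIntegrable r)
    (hr0 : ∀ x, 0 ≤ r x) (hh : ∀ᵐ x, x ∈ Icc a b → ‖h x‖ ≤ M * ‖y x‖ + r x) :
    ∀ s ∈ Icc a b, ‖y s‖ + ‖y' s‖ ≤
      (‖y a‖ + ‖y' a‖ + ∫ x in a..b, r x) * Real.exp ((M + 1) * (b - a)) := by
  intro s hs
  have hab : a ≤ b := hs.1.trans hs.2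
  have hR : 0 ≤ ∫ x in a..b, r x := intervalIntegral.integral_nonneg hab fun x _ => hr0 x
  have hyc := hy.continuous
  have hyc' := hy'.continuous
  have hint : ∀ s ∈ Icc a b, ‖y s‖ + ‖y' s‖ ≤ (‖y a‖ + ‖y' a‖ + ∫ x in a..b, r x) +
      (M + 1) * ∫ t in a..s, (‖y t‖ + ‖y' t‖) := by
    intro s hs
    have h1 : ‖y s - y a‖ ≤ ∫ t in a..s, ‖y' t‖ := hy.norm_sub_le hs.1
    have h2 : ‖y' s - y' a‖ ≤ ∫ t in a..s, ‖h t‖ := hy'.norm_sub_le hs.1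
    have iy : IntervalIntegrable (fun t => ‖y t‖) volume a s := hyc.norm.intervalIntegrable _ _
    have iy' : IntervalIntegrable (fun t => ‖y' t‖) volume a s := hyc'.norm.intervalIntegrable _ _
    have ir : IntervalIntegrable r volume a s := intervalIntegrable_of_locallyIntegrable hr _ _
    have h3 : ∫ t in a..s, ‖h t‖ ≤ ∫ t in a..s, (M * ‖y t‖ + r t) := by
      rw [intervalIntegral.integral_of_le hs.1, intervalIntegral.integral_of_le hs.1]
      refine setIntegral_mono_on_ae ?_ ?_ measurableSet_Ioc ?_
      · exact (hy'.intervalIntegrable a s).norm.1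
      · exact ((iy.const_mul M).add ir).1
      · filter_upwards [hh] with x hx hxs using hx ⟨hxs.1.le, hxs.2.trans hs.2⟩
    rw [intervalIntegral.integral_add (iy.const_mul M) ir,
      intervalIntegral.integral_const_mul] at h3
    have h4 : ∫ t in a..s, r t ≤ ∫ t in a..b, r t :=
      intervalIntegral_mono_set_of_nonneg hr hr0 le_rfl hs.1 hs.2
    have h5 : 0 ≤ ∫ t in a..s, ‖y t‖ :=
      intervalIntegral.integral_nonneg hs.1 fun _ _ => norm_nonneg _
    have h6 : 0 ≤ ∫ t in a..s, ‖y' t‖ :=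
      intervalIntegral.integral_nonneg hs.1 fun _ _ => norm_nonneg _
    rw [intervalIntegral.integral_add iy iy']
    have h7 : ‖y s‖ ≤ ‖y s - y a‖ + ‖y a‖ := by simpa using norm_add_le (y s - y a) (y a)
    have h8 : ‖y' s‖ ≤ ‖y' s - y' a‖ + ‖y' a‖ := by simpa using norm_add_le (y' s - y' a) (y' a)
    have h9 : 0 ≤ M * ∫ t in a..s, ‖y' t‖ := mul_nonneg hM h6
    nlinarith
  have hA : 0 ≤ ‖y a‖ + ‖y' a‖ + ∫ x in a..b, r x := by
    linarith [norm_nonneg (y a), norm_nonneg (y' a)]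
  refine (le_mul_exp_of_le_add_mul_integral (hyc.norm.add hyc'.norm)
    (fun s => add_nonneg (norm_nonneg _) (norm_nonneg _))
    hA (by linarith) hint s hs).trans ?_
  gcongr
  exact hs.2

/-! ### Half-bound states -/

lemma Potential.eq_zero (Φ : Potential) {x : ℝ} (hx : x ∉ Icc (-1 : ℝ) 1) : Φ x = 0 :=
  image_eq_zero_of_notMem_tsupport fun h => hx (Φ.support' h)

lemma Potential.exists_bound (Φ : Potential) : ∃ M : ℝ, 0 ≤ M ∧ ∀ x, |Φ x| ≤ M := by
  obtain ⟨C, hC⟩ := Φ.bounded'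
  exact ⟨C, (abs_nonneg _).trans (hC 0), hC⟩

lemma IsSolution.isPrimitive {q u : ℝ → ℝ} (hu : IsSolution q u) :
    IsPrimitive (fun x => (u x : ℂ)) (fun x => ((deriv u x : ℝ) : ℂ)) ∧
      IsPrimitive (fun x => ((deriv u x : ℝ) : ℂ)) (fun x => ((q x * u x : ℝ) : ℂ)) := by
  have h2 : IsPrimitive (fun x => ((deriv u x : ℝ) : ℂ)) (fun x => ((q x * u x : ℝ) : ℂ)) := by
    refine ⟨fun x => ?_, fun a b => ?_⟩
    · obtain ⟨s, hs, hi⟩ := hu.2.1 x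
      exact ⟨s, hs, hi.ofReal⟩
    · rw [intervalIntegral.integral_ofReal, ← hu.2.2]
      push_cast
      rfl
  exact ⟨IsPrimitive.of_hasDerivAt (fun x => (hu.1 x).hasDerivAt.ofReal_comp)
    h2.continuous.locallyIntegrable, h2⟩

lemma IsSolution.comp_neg {q u : ℝ → ℝ} (hu : IsSolution q u) :
    IsSolution (fun x => q (-x)) (fun x => u (-x)) := by
  have hd : ∀ x, deriv (fun x => u (-x)) x = -deriv u (-x) := fun x => deriv_comp_neg u x
  refine ⟨hu.1.comp differentiable_neg, ?_, fun a b => ?_⟩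
  · rw [locallyIntegrable_iff]
    intro K hK
    have h1 : IntegrableOn (fun t => q t * u t) (-K) :=
      (locallyIntegrable_iff.mp hu.2.1) _ hK.neg
    have := (Measure.measurePreserving_neg (volume : Measure ℝ)).integrableOn_comp_preimage
      (f := fun t => q t * u t) (s := -K) (Homeomorph.neg ℝ).measurableEmbedding
    simpa [Function.comp_def] using this.mpr h1
  · rw [hd, hd, intervalIntegral.integral_comp_neg (fun t => q t * u t), ← hu.2.2]
    ring

/-- Outside the support of the potential, a half-bound state has zero derivative. -/
lemma IsHalfBoundState.deriv_eq_zero_of_ge {q u : ℝ → ℝ} (hu : IsHalfBoundState q u)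
    (hq : ∀ x, x ∉ Icc (-1 : ℝ) 1 → q x = 0) {s : ℝ} (hs : 1 ≤ s) : deriv u s = 0 := by
  obtain ⟨⟨hd, -, hint⟩, -, C, hC⟩ := hu
  have hconst : ∀ t, 1 ≤ t → deriv u t = deriv u 1 := fun t ht => by
    rw [← sub_eq_zero, hint]
    refine intervalIntegral.integral_zero_ae (Eventually.of_forall fun x hx => ?_)
    rw [uIoc_of_le ht] at hx
    rw [hq x fun hx' => absurd hx'.2 (not_le.mpr hx.1), zero_mul]
  rw [hconst s hs]
  by_contra hne
  -- Beyond the support `u` is affine, and a bounded affine function on a half-line has zero slope;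
  -- at the point `t` below the increment `2C + 1` exceeds the allowed `2C`.
  have hlin : ∀ t, 1 ≤ t → u t = u 1 + deriv u 1 * (t - 1) := fun t ht => by
    have h1 : ∫ x in (1 : ℝ)..t, deriv u 1 = u t - u 1 := by
      rw [← intervalIntegral.integral_eq_sub_of_hasDerivAt (f := u) (f' := fun _ => deriv u 1)]
      · intro x hx
        rw [uIcc_of_le ht] at hx
        rw [← hconst x hx.1]
        exact (hd x).hasDerivAt
      · simp
    rw [intervalIntegral.integral_const, smul_eq_mul] at h1
    linarith
  have hpos : 0 < |deriv u 1| := abs_pos.mpr hne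
  have hC0 : 0 ≤ C := (abs_nonneg _).trans (hC 0)
  set t := 1 + (2 * C + 1) / |deriv u 1| with ht
  have ht1 : 1 ≤ t := by
    rw [ht]
    have : 0 ≤ (2 * C + 1) / |deriv u 1| := by positivity
    linarith
  have h1 : |deriv u 1 * (t - 1)| = 2 * C + 1 := by
    rw [ht, add_sub_cancel_left, abs_mul, abs_of_nonneg (by positivity : 0 ≤ (2 * C + 1) / _)]
    field_simp
  have h2 : |deriv u 1 * (t - 1)| ≤ |u t| + |u 1| := by
    rw [show deriv u 1 * (t - 1) = u t - u 1 by rw [hlin t ht1]; ring]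
    exact abs_sub _ _
  linarith [hC t, hC 1]

lemma IsHalfBoundState.comp_neg {q u : ℝ → ℝ} (hu : IsHalfBoundState q u) :
    IsHalfBoundState (fun x => q (-x)) (fun x => u (-x)) := by
  refine ⟨hu.1.comp_neg, fun h => hu.2.1 (funext fun x => ?_), ?_⟩
  · simpa using congrFun h (-x)
  · obtain ⟨C, hC⟩ := hu.2.2
    exact ⟨C, fun s => hC _⟩

lemma IsHalfBoundState.deriv_eq_zero_of_le {q u : ℝ → ℝ} (hu : IsHalfBoundState q u)
    (hq : ∀ x, x ∉ Icc (-1 : ℝ) 1 → q x = 0) {s : ℝ} (hs : s ≤ -1) : deriv u s = 0 := by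
  have := hu.comp_neg.deriv_eq_zero_of_ge (fun x hx => hq _ fun hx' =>
    hx ⟨by linarith [hx'.2], by linarith [hx'.1]⟩) (s := -s) (by linarith)
  rw [deriv_comp_neg u, neg_neg, neg_eq_zero] at this
  exact this

lemma eq_zero_of_isPrimitive {y y' : ℝ → ℂ} {q : ℝ → ℝ} (hy : IsPrimitive y y')
    (hy' : IsPrimitive y' (fun x => q x * y x)) {M : ℝ} (hM : ∀ x, |q x| ≤ M) (h0 : y (-1) = 0)
    (h1 : y' (-1) = 0) : ∀ s ∈ Icc (-1 : ℝ) 1, y s = 0 := by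
  intro s hs
  have := hy.norm_add_norm_le hy' (a := -1) (b := 1) ((abs_nonneg _).trans (hM 0)) (r := fun _ => 0)
    (locallyIntegrable_const _) (fun _ => le_rfl) (Eventually.of_forall fun x _ => by
      rw [norm_mul, Complex.norm_real, add_zero]
      exact mul_le_mul_of_nonneg_right (hM x) (norm_nonneg _)) s hs
  rw [h0, h1, norm_zero, intervalIntegral.integral_zero, add_zero, add_zero, zero_mul] at this
  exact norm_le_zero_iff.mp (by linarith [norm_nonneg (y' s)])

/-- Since `u'(-1) = 0`, the vanishing of `u(-1)` would give zero Cauchy data, so `u = 0` on `[-1,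
1]` and then everywhere, `u` being constant on both outer half-lines. -/
lemma IsHalfBoundState.apply_neg_one_ne_zero {q u : ℝ → ℝ} (hu : IsHalfBoundState q u)
    (hq : ∀ x, x ∉ Icc (-1 : ℝ) 1 → q x = 0) {M : ℝ} (hM : ∀ x, |q x| ≤ M) : u (-1) ≠ 0 := by
  intro h0
  refine hu.2.1 (funext fun s => ?_)
  have hd := hu.1.1
  have hin : ∀ s ∈ Icc (-1 : ℝ) 1, u s = 0 := fun s hs => by
    have := eq_zero_of_isPrimitive hu.1.isPrimitive.1 (q := q)
      (by simpa using hu.1.isPrimitive.2) hM (by simp [h0])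
      (by simp [hu.deriv_eq_zero_of_le hq le_rfl]) s hs
    exact_mod_cast this
  rcases lt_or_ge s (-1) with hs | hs
  · have := (convex_Iic (-1 : ℝ)).is_const_of_fderivWithin_eq_zero (𝕜 := ℝ) (f := u)
      hd.differentiableOn (fun x hx => ?_) (mem_Iic.mpr hs.le) (mem_Iic.mpr le_rfl)
    · rw [this, h0]
      rfl
    · rw [(hd x).fderivWithin ((uniqueDiffOn_Iic _) x hx)]
      ext
      simpa using hu.deriv_eq_zero_of_le hq hx
  rcases le_or_gt s 1 with hs1 | hs1
  · exact hin s ⟨hs, hs1⟩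
  · have := (convex_Ici (1 : ℝ)).is_const_of_fderivWithin_eq_zero (𝕜 := ℝ) (f := u)
      hd.differentiableOn (fun x hx => ?_) (mem_Ici.mpr hs1.le) (mem_Ici.mpr le_rfl)
    · rw [this, hin 1 (by simp)]
      rfl
    · rw [(hd x).fderivWithin ((uniqueDiffOn_Ici _) x hx)]
      ext
      simpa using hu.deriv_eq_zero_of_ge hq hx

lemma IsHalfBoundState.apply_one_ne_zero {q u : ℝ → ℝ} (hu : IsHalfBoundState q u)
    (hq : ∀ x, x ∉ Icc (-1 : ℝ) 1 → q x = 0) {M : ℝ} (hM : ∀ x, |q x| ≤ M) : u 1 ≠ 0 := by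
  have := hu.comp_neg.apply_neg_one_ne_zero (fun x hx => hq _ fun hx' =>
    hx ⟨by linarith [hx'.2], by linarith [hx'.1]⟩) (fun x => hM _)
  simpa using this

/-- Half-bound states are unique up to a constant factor on the support of the potential. -/
lemma IsHalfBoundState.mul_eq_mul {q u v : ℝ → ℝ} (hu : IsHalfBoundState q u)
    (hv : IsHalfBoundState q v) (hq : ∀ x, x ∉ Icc (-1 : ℝ) 1 → q x = 0) {M : ℝ}
    (hM : ∀ x, |q x| ≤ M) : ∀ s ∈ Icc (-1 : ℝ) 1, u (-1) * v s = v (-1) * u s := by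
  intro s hs
  obtain ⟨u1, u2⟩ := hu.1.isPrimitive
  obtain ⟨v1, v2⟩ := hv.1.isPrimitive
  have := eq_zero_of_isPrimitive (q := q) ((v1.const_mul (u (-1))).sub (u1.const_mul (v (-1))))
    (by
      convert (v2.const_mul (u (-1))).sub (u2.const_mul (v (-1))) using 2
      push_cast
      ring) hM (by simp [mul_comm])
    (by simp [hu.deriv_eq_zero_of_le hq le_rfl, hv.deriv_eq_zero_of_le hq le_rfl]) s hs
  rw [sub_eq_zero] at this
  exact_mod_cast this

/-! ### Independence of `θ` and `κ` of the half-bound state -/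

section

variable (Φ Ψ : Potential) (α : ℝ)

lemma exists_bound_smul : ∃ M : ℝ, ∀ x, |α * Φ x| ≤ M := by
  obtain ⟨M, -, hM⟩ := Φ.exists_bound
  exact ⟨|α| * M, fun x => by
    rw [abs_mul]
    exact mul_le_mul_of_nonneg_left (hM x) (abs_nonneg _)⟩

lemma smul_eq_zero_of_notMem (x : ℝ) (hx : x ∉ Icc (-1 : ℝ) 1) : α * Φ x = 0 := by
  rw [Φ.eq_zero hx, mul_zero]

variable {Φ α}

theorem IsHalfBoundState.invariants (hα : α ∈ resonantSet Φ) {u : ℝ → ℝ}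
    (hu : IsHalfBoundState (fun s => α * Φ s) u) :
    u (-1) ≠ 0 ∧ u 1 ≠ 0 ∧ resonantMap Φ ⟨α, hα⟩ = u 1 / u (-1) ∧
      intercouplingMap Φ Ψ ⟨α, hα⟩ = 1 / (u (-1) * u 1) * ∫ s, Ψ s * u s ^ 2 := by
  obtain ⟨M, hM⟩ := exists_bound_smul Φ α
  have hq := smul_eq_zero_of_notMem Φ α
  set v := halfBoundState Φ ⟨α, hα⟩ with hvdef
  have hv : IsHalfBoundState (fun s => α * Φ s) v := hα.choose_spec
  have u1 := hu.apply_neg_one_ne_zero hq hM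
  have u2 := hu.apply_one_ne_zero hq hM
  have v1 := hv.apply_neg_one_ne_zero hq hM
  have hprop : ∀ s ∈ Icc (-1 : ℝ) 1, v s = v (-1) / u (-1) * u s := fun s hs => by
    have := hu.mul_eq_mul hv hq hM s hs
    field_simp
    linarith
  have e1 := hprop 1 (by simp)
  refine ⟨u1, u2, ?_, ?_⟩
  · rw [resonantMap, ← hvdef, e1]
    field_simp
  -- The squared proportionality factor cancels against the same factor in `v (-1) * v 1`.
  -- Proportionality is needed only on the support of `Ψ`.
  · have e2 : (fun s => Ψ s * v s ^ 2) = fun s => (v (-1) / u (-1)) ^ 2 * (Ψ s * u s ^ 2) := by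
      ext s
      by_cases hs : s ∈ Icc (-1 : ℝ) 1
      · rw [hprop s hs]
        ring
      · rw [Ψ.eq_zero hs]
        ring
    rw [intercouplingMap, ← hvdef, e2, integral_const_mul, e1]
    field_simp

end

/-! ### Asymptotics on the support of the squeezed potential -/

section Scaled

variable {Φ Ψ : Potential} {α β : ℝ} {u : ℝ → ℝ}

/-- `Y` solves the rescaled equation on `[-1, 1]`, with small right-hand side `r` and controlled
initial data at `-1`. -/
structure IsScaledSolution (Φ Ψ : Potential) (α β : ℝ) (ζ : ℂ) (C δ N : ℝ) (Y Y' r : ℝ → ℂ) :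
    Prop where
  primitive : IsPrimitive Y Y'
  primitive' : IsPrimitive Y'
    (fun s => (α * Φ s + δ ^ 2 * (β * Ψ s) - δ ^ 4 * ζ) * Y s - r s)
  locallyIntegrable : LocallyIntegrable r
  integral_le : ∫ s in (-1 : ℝ)..1, ‖r s‖ ≤ 2 * δ ^ 3 * N
  norm_le : ‖Y (-1)‖ ≤ C * N
  norm_deriv_le : ‖Y' (-1)‖ ≤ C * δ ^ 2 * N

/-- For `δ ≤ 1` the coefficient of the rescaled equation is bounded independently of `δ`, so
Grönwall gives a uniform bound. -/
lemma IsScaledSolution.exists_norm_le (Φ Ψ : Potential) (α β : ℝ) (ζ : ℂ) {C : ℝ} (hC : 0 ≤ C) :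
    ∃ K, 0 ≤ K ∧ ∀ δ N : ℝ, 0 < δ → δ ≤ 1 → 0 ≤ N → ∀ Y Y' r : ℝ → ℂ,
      IsScaledSolution Φ Ψ α β ζ C δ N Y Y' r → ∀ s ∈ Icc (-1 : ℝ) 1, ‖Y s‖ ≤ K * N := by
  obtain ⟨A, hA, hΦ⟩ := Φ.exists_bound
  obtain ⟨B, hB, hΨ⟩ := Ψ.exists_bound
  set M := |α| * A + |β| * B + ‖ζ‖
  have hM : 0 ≤ M := by positivity
  refine ⟨(2 * C + 2) * Real.exp ((M + 1) * (1 - -1)), by positivity, ?_⟩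
  intro δ N hδ hδ1 hN Y Y' r hY s hs
  have hp : ∀ n : ℕ, δ ^ n ≤ 1 := fun n => pow_le_one₀ hδ.le hδ1
  have h1 := hY.primitive.norm_add_norm_le hY.primitive' (a := -1) (b := 1) hM
    (locallyIntegrable_norm hY.locallyIntegrable) (fun _ => norm_nonneg _)
    (Eventually.of_forall fun x _ => by
      have e1 : ‖(α * Φ x + δ ^ 2 * (β * Ψ x) - δ ^ 4 * ζ : ℂ)‖ ≤ M := by
        have a1 : ‖(α * Φ x : ℂ)‖ ≤ |α| * A := by
          rw [norm_mul, Complex.norm_real, Complex.norm_real]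
          exact mul_le_mul_of_nonneg_left (hΦ x) (abs_nonneg _)
        have a2 : ‖(δ ^ 2 * (β * Ψ x) : ℂ)‖ ≤ |β| * B := by
          rw [norm_mul, norm_pow, norm_mul, Complex.norm_real, Complex.norm_real,
            Complex.norm_real, Real.norm_of_nonneg hδ.le]
          calc δ ^ 2 * (‖β‖ * ‖Ψ x‖) ≤ 1 * (|β| * B) := by
                gcongr
                · exact hp 2
                · exact le_rfl
                · exact hΨ x
            _ = _ := one_mul _
        have a3 : ‖(δ ^ 4 * ζ : ℂ)‖ ≤ ‖ζ‖ := by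
          rw [norm_mul, norm_pow, Complex.norm_real, Real.norm_of_nonneg hδ.le]
          exact mul_le_of_le_one_left (norm_nonneg _) (hp 4)
        exact (norm_sub_le _ _).trans (by linarith [norm_add_le (α * Φ x : ℂ) (δ ^ 2 * (β * Ψ x))])
      refine (norm_sub_le _ _).trans ?_
      rw [norm_mul]
      gcongr) s hs
  have h2 : ‖Y s‖ ≤ ‖Y s‖ + ‖Y' s‖ := by linarith [norm_nonneg (Y' s)]
  refine h2.trans (h1.trans ?_)
  have h3 : ‖Y (-1)‖ + ‖Y' (-1)‖ + ∫ x in (-1 : ℝ)..1, ‖r x‖ ≤ (2 * C + 2) * N := by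
    have b1 := hY.norm_le
    have b2 : C * δ ^ 2 * N ≤ C * N := by
      have : C * δ ^ 2 ≤ C := mul_le_of_le_one_right hC (hp 2)
      gcongr
    have b3 : 2 * δ ^ 3 * N ≤ 2 * N := by
      have := hp 3
      gcongr
      linarith
    linarith [hY.norm_deriv_le, hY.integral_le]
  calc _ ≤ (2 * C + 2) * N * Real.exp ((M + 1) * (1 - -1)) := by gcongr
    _ = _ := by ring

/-- The rescaled solution is close to a multiple of the half-bound state. -/
lemma IsScaledSolution.exists_norm_sub_le (Ψ : Potential) (β : ℝ) (ζ : ℂ)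
    (hu : IsHalfBoundState (fun s => α * Φ s) u) {C : ℝ} (hC : 0 ≤ C) :
    ∃ K, 0 ≤ K ∧ ∀ δ N : ℝ, 0 < δ → δ ≤ 1 → 0 ≤ N → ∀ Y Y' r : ℝ → ℂ,
      IsScaledSolution Φ Ψ α β ζ C δ N Y Y' r → ∀ s ∈ Icc (-1 : ℝ) 1,
        ‖Y s - Y (-1) / u (-1) * u s‖ ≤ K * δ ^ 2 * N := by
  obtain ⟨K₀, hK₀, hbd⟩ := IsScaledSolution.exists_norm_le Φ Ψ α β ζ hC
  obtain ⟨M, hM⟩ := exists_bound_smul Φ α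
  obtain ⟨B, hB, hΨ⟩ := Ψ.exists_bound
  have hq := smul_eq_zero_of_notMem Φ α
  have hu1 : (u (-1) : ℂ) ≠ 0 := Complex.ofReal_ne_zero.mpr (hu.apply_neg_one_ne_zero hq hM)
  have hud : deriv u (-1) = 0 := hu.deriv_eq_zero_of_le hq le_rfl
  have hM0 : 0 ≤ M := (abs_nonneg _).trans (hM 0)
  set G := (|β| * B + ‖ζ‖) * K₀
  have hG : 0 ≤ G := by positivity
  refine ⟨(C + 2 * G + 2) * Real.exp ((M + 1) * (1 - -1)), by positivity, ?_⟩
  intro δ N hδ hδ1 hN Y Y' r hY s hs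
  obtain ⟨u1, u2⟩ := hu.1.isPrimitive
  have d1 := hY.primitive.sub (u1.const_mul (Y (-1) / u (-1)))
  have d2 := hY.primitive'.sub (u2.const_mul (Y (-1) / u (-1)))
  have hr2 : LocallyIntegrable fun x => G * δ ^ 2 * N + ‖r x‖ :=
    (locallyIntegrable_const _).add (locallyIntegrable_norm hY.locallyIntegrable)
  have h1 := d1.norm_add_norm_le d2 (a := -1) (b := 1) hM0 hr2 (fun x => by positivity)
    (Eventually.of_forall fun x hx => by
      -- The difference solves the unperturbed equation up to a source `O(δ²) - r`. It vanishes at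
      -- `-1`, and its derivative there is `Y'(-1) = O(δ²)` because `u'(-1) = 0`.
      have e0 : ((α * Φ x + δ ^ 2 * (β * Ψ x) - δ ^ 4 * ζ) * Y x - r x) -
          Y (-1) / u (-1) * ((α * Φ x * u x : ℝ) : ℂ) =
          (α * Φ x : ℝ) * (Y x - Y (-1) / u (-1) * u x) +
            (δ ^ 2 * ((β * Ψ x : ℝ) - δ ^ 2 * ζ) * Y x - r x) := by
        push_cast
        ring
      rw [e0]
      refine (norm_add_le _ _).trans (add_le_add ?_ ((norm_sub_le _ _).trans ?_))
      · rw [norm_mul, Complex.norm_real]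
        exact mul_le_mul_of_nonneg_right (hM x) (norm_nonneg _)
      · gcongr
        rw [norm_mul, norm_mul, norm_pow, Complex.norm_real, Real.norm_of_nonneg hδ.le]
        have e1 : ‖((β * Ψ x : ℝ) - δ ^ 2 * ζ : ℂ)‖ ≤ |β| * B + ‖ζ‖ := by
          refine (norm_sub_le _ _).trans (add_le_add ?_ ?_)
          · rw [Complex.norm_real, norm_mul]
            exact mul_le_mul_of_nonneg_left (hΨ x) (abs_nonneg _)
          · rw [norm_mul, norm_pow, Complex.norm_real, Real.norm_of_nonneg hδ.le]
            exact mul_le_of_le_one_left (norm_nonneg _) (pow_le_one₀ hδ.le hδ1)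
        calc δ ^ 2 * ‖((β * Ψ x : ℝ) - δ ^ 2 * ζ : ℂ)‖ * ‖Y x‖
            ≤ δ ^ 2 * (|β| * B + ‖ζ‖) * (K₀ * N) := by
              gcongr
              exact hbd δ N hδ hδ1 hN Y Y' r hY x hx
          _ = G * δ ^ 2 * N := by ring) s hs
  have h2 := le_add_of_nonneg_right (a := ‖Y s - Y (-1) / u (-1) * u s‖)
    (norm_nonneg (Y' s - Y (-1) / u (-1) * (deriv u s : ℝ)))
  refine h2.trans (h1.trans ?_)
  have e1 : Y (-1) - Y (-1) / u (-1) * u (-1) = 0 := by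
    field_simp
    ring
  rw [e1, hud, norm_zero, Complex.ofReal_zero, mul_zero, sub_zero, zero_add,
    intervalIntegral.integral_add (by simp)
      (intervalIntegrable_of_locallyIntegrable (locallyIntegrable_norm hY.locallyIntegrable) _ _),
    intervalIntegral.integral_const, smul_eq_mul]
  have h3 : 2 * δ ^ 3 * N ≤ 2 * δ ^ 2 * N := by
    have : δ ^ 3 ≤ δ ^ 2 := pow_le_pow_of_le_one hδ.le hδ1 (by norm_num)
    gcongr
  have h4 : ‖Y' (-1)‖ + ((1 - -1) * (G * δ ^ 2 * N) + ∫ x in (-1 : ℝ)..1, ‖r x‖) ≤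
      (C + 2 * G + 2) * δ ^ 2 * N := by
    linarith [hY.norm_deriv_le, hY.integral_le]
  calc _ ≤ (C + 2 * G + 2) * δ ^ 2 * N * Real.exp ((M + 1) * (1 - -1)) := by gcongr
    _ = _ := by ring

lemma Potential.integral_mul_eq (Ψ : Potential) (v : ℝ → ℝ) :
    ∫ s in (-1 : ℝ)..1, Ψ s * v s = ∫ s, Ψ s * v s := by
  rw [intervalIntegral.integral_of_le (by norm_num), ← integral_Icc_eq_integral_Ioc]
  refine setIntegral_eq_integral_of_forall_compl_eq_zero fun x hx => ?_
  rw [Ψ.eq_zero hx, zero_mul]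

/-- The rescaled solution almost satisfies the coupling condition for derivatives. -/
lemma IsScaledSolution.exists_norm_deriv_sub_le (Ψ : Potential) (β : ℝ) (ζ : ℂ)
    (hu : IsHalfBoundState (fun s => α * Φ s) u) {C : ℝ} (hC : 0 ≤ C) :
    ∃ K, 0 ≤ K ∧ ∀ δ N : ℝ, 0 < δ → δ ≤ 1 → 0 ≤ N → ∀ Y Y' r : ℝ → ℂ,
      IsScaledSolution Φ Ψ α β ζ C δ N Y Y' r →
        ‖Y' 1 - ((u 1 / u (-1) : ℝ) : ℂ)⁻¹ * Y' (-1) - δ ^ 2 *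
          ((β * (1 / (u (-1) * u 1) * ∫ s, Ψ s * u s ^ 2) : ℝ) : ℂ) * Y (-1)‖
          ≤ K * δ ^ 3 * N := by
  obtain ⟨K₀, hK₀, hbd₀⟩ := IsScaledSolution.exists_norm_le Φ Ψ α β ζ hC
  obtain ⟨K₁, hK₁, hbd₁⟩ := IsScaledSolution.exists_norm_sub_le Ψ β ζ hu hC
  obtain ⟨M, hM⟩ := exists_bound_smul Φ α
  obtain ⟨B, hB, hΨ⟩ := Ψ.exists_bound
  obtain ⟨U, hU⟩ := hu.2.2
  have hU0 : 0 ≤ U := (abs_nonneg _).trans (hU 0)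
  have hq := smul_eq_zero_of_notMem Φ α
  have hul : (u (-1) : ℂ) ≠ 0 := Complex.ofReal_ne_zero.mpr (hu.apply_neg_one_ne_zero hq hM)
  have hur : (u 1 : ℂ) ≠ 0 := Complex.ofReal_ne_zero.mpr (hu.apply_one_ne_zero hq hM)
  have hudl : deriv u (-1) = 0 := hu.deriv_eq_zero_of_le hq le_rfl
  have hudr : deriv u 1 = 0 := hu.deriv_eq_zero_of_ge hq le_rfl
  set G := (|β| * B * K₁ + ‖ζ‖ * K₀) * U
  have hG : 0 ≤ G := by positivity
  refine ⟨(2 * G + 2 * U) / |u 1|, by positivity, ?_⟩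
  intro δ N hδ hδ1 hN Y Y' r hY
  obtain ⟨u1, u2⟩ := hu.1.isPrimitive
  set c := Y (-1) / u (-1) with hc
  -- This is the Wronskian `Y' u - Y u'`. In its derivative `αΦ` cancels, and at `±1` only `Y' u`
  -- survives since `u'(±1) = 0`.
  have hW := (hY.primitive'.mul u1).sub (hY.primitive.mul u2)
  have hcΨ : IntervalIntegrable (fun s => (((Ψ s * u s ^ 2 : ℝ)) : ℂ)) volume (-1) 1 := by
    have h1 : Integrable fun s => Ψ s * u s ^ 2 := by
      have := Ψ.integrable'.bdd_mul (f := fun s => u s ^ 2) (c := U ^ 2)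
        ((hu.1.1.continuous.pow 2).aestronglyMeasurable) (Eventually.of_forall fun s => by
          rw [norm_pow]
          exact pow_le_pow_left₀ (norm_nonneg _) (hU s) 2)
      simpa [mul_comm] using this
    exact h1.ofReal.intervalIntegrable
  have h1 := hW.2 (-1) 1
  beta_reduce at h1
  rw [hudl, hudr, Complex.ofReal_zero, mul_zero, mul_zero, sub_zero, sub_zero] at h1
  have h2 : ‖∫ s in (-1 : ℝ)..1, ((((α * Φ s + δ ^ 2 * (β * Ψ s) - δ ^ 4 * ζ) * Y s - r s) * u s +
      Y' s * (deriv u s : ℝ) - (Y' s * (deriv u s : ℝ) + Y s * ((α * Φ s * u s : ℝ) : ℂ))) -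
      δ ^ 2 * β * c * ((Ψ s * u s ^ 2 : ℝ) : ℂ))‖ ≤
      ∫ s in (-1 : ℝ)..1, (G * δ ^ 4 * N + U * ‖r s‖) := by
    refine intervalIntegral.norm_integral_le_of_norm_le (by norm_num)
      (Eventually.of_forall fun x hx => ?_) ?_
    · have hx' : x ∈ Icc (-1 : ℝ) 1 := ⟨hx.1.le, hx.2⟩
      have e0 : ((((α * Φ x + δ ^ 2 * (β * Ψ x) - δ ^ 4 * ζ) * Y x - r x) * u x +
          Y' x * (deriv u x : ℝ) - (Y' x * (deriv u x : ℝ) + Y x * ((α * Φ x * u x : ℝ) : ℂ))) -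
          δ ^ 2 * β * c * ((Ψ x * u x ^ 2 : ℝ) : ℂ)) =
          -- Replacing `Y` by `c u` in the term with `Ψ` costs only `O(δ⁴)`. The dominant error is
          -- `∫ r u = O(δ³)`, and it fixes the final rate.
          δ ^ 2 * (((β * Ψ x : ℝ) : ℂ) * (Y x - c * u x) - δ ^ 2 * ζ * Y x) * u x - r x * u x := by
        push_cast
        ring
      rw [e0]
      have hux : ‖(u x : ℂ)‖ ≤ U := by
        rw [Complex.norm_real]
        exact hU x
      have e1 : ‖((β * Ψ x : ℝ) : ℂ) * (Y x - c * u x)‖ ≤ |β| * B * (K₁ * δ ^ 2 * N) := by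
        rw [norm_mul, Complex.norm_real, norm_mul]
        gcongr
        · exact le_rfl
        · exact hΨ x
        · exact hbd₁ δ N hδ hδ1 hN Y Y' r hY x hx'
      have e2 : ‖(δ ^ 2 * ζ * Y x : ℂ)‖ ≤ δ ^ 2 * ‖ζ‖ * (K₀ * N) := by
        rw [norm_mul, norm_mul, norm_pow, Complex.norm_real, Real.norm_of_nonneg hδ.le]
        gcongr
        exact hbd₀ δ N hδ hδ1 hN Y Y' r hY x hx'
      refine (norm_sub_le _ _).trans (add_le_add ?_ ?_)
      · rw [norm_mul, norm_mul, norm_pow, Complex.norm_real, Real.norm_of_nonneg hδ.le]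
        calc δ ^ 2 * ‖((β * Ψ x : ℝ) : ℂ) * (Y x - c * u x) - δ ^ 2 * ζ * Y x‖ * ‖(u x : ℂ)‖
            ≤ δ ^ 2 * (|β| * B * (K₁ * δ ^ 2 * N) + δ ^ 2 * ‖ζ‖ * (K₀ * N)) * U := by
              gcongr
              exact (norm_sub_le _ _).trans (add_le_add e1 e2)
          _ = G * δ ^ 4 * N := by ring
      · rw [norm_mul, mul_comm]
        gcongr
    · exact (by simp : IntervalIntegrable (fun _ : ℝ => G * δ ^ 4 * N) volume (-1) 1).add
        ((intervalIntegrable_of_locallyIntegrable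
          (locallyIntegrable_norm hY.locallyIntegrable) _ _).const_mul _)
  rw [intervalIntegral.integral_sub (hW.intervalIntegrable _ _) (hcΨ.const_mul _), ← h1,
    intervalIntegral.integral_const_mul, intervalIntegral.integral_ofReal, Ψ.integral_mul_eq,
    intervalIntegral.integral_add (by simp) ((intervalIntegrable_of_locallyIntegrable
      (locallyIntegrable_norm hY.locallyIntegrable) _ _).const_mul _),
    intervalIntegral.integral_const, intervalIntegral.integral_const_mul, smul_eq_mul] at h2
  set J := ∫ s, Ψ s * u s ^ 2
  have h3 : G * δ ^ 4 * N ≤ G * δ ^ 3 * N := by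
    have : δ ^ 4 ≤ δ ^ 3 := pow_le_pow_of_le_one hδ.le hδ1 (by norm_num)
    gcongr
  have h4 : U * ∫ s in (-1 : ℝ)..1, ‖r s‖ ≤ U * (2 * δ ^ 3 * N) :=
    mul_le_mul_of_nonneg_left hY.integral_le hU0
  have e : Y' 1 - ((u 1 / u (-1) : ℝ) : ℂ)⁻¹ * Y' (-1) - δ ^ 2 *
      ((β * (1 / (u (-1) * u 1) * J) : ℝ) : ℂ) * Y (-1) =
      (Y' 1 * u 1 - Y' (-1) * u (-1) - δ ^ 2 * β * c * J) / u 1 := by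
    rw [hc]
    push_cast
    field_simp
  rw [e, norm_div, Complex.norm_real, Real.norm_eq_abs]
  have hu1 : 0 < |u 1| := abs_pos.mpr (hu.apply_one_ne_zero hq hM)
  rw [div_le_iff₀ hu1]
  have e5 : (2 * G + 2 * U) / |u 1| * δ ^ 3 * N * |u 1| = (2 * G + 2 * U) * δ ^ 3 * N := by
    field_simp
  rw [e5]
  linarith

end Scaled

/-! ### Asymptotics of the resolvents -/

/-- For `y'` this is Cauchy-Schwarz on `∫ ‖h‖`. For `y` a Lipschitz bound holds, weakened by `t - s
≤ √(t - s)` on a unit window to match. -/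
lemma IsRepOn.norm_sub_le_sqrt {S : Set ℝ} {f h : L2} {y y' : ℝ → ℂ} (hy : IsRepOn S f h y y')
    {a s t : ℝ} (hS : Ioo a (a + 1) ⊆ S) (hs : s ∈ Icc a (a + 1)) (ht : t ∈ Icc a (a + 1))
    (hst : s ≤ t) : ‖y t - y s‖ ≤ 30 * √(t - s) * (‖f‖ + ‖h‖) ∧
      ‖y' t - y' s‖ ≤ 30 * √(t - s) * (‖f‖ + ‖h‖) := by
  have h0 : 0 ≤ ‖f‖ + ‖h‖ := by positivity
  constructor
  · have h1 : ‖y t - y s‖ ≤ 30 * (‖f‖ + ‖h‖) * |t - s| := by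
      rw [hy.1.2]
      refine intervalIntegral.norm_integral_le_of_norm_le_const fun x hx => ?_
      exact (hy.norm_trace_le hS (uIcc_subset_Icc hs ht (uIoc_subset_uIcc hx))).2
    have h2 : |t - s| ≤ √(t - s) := by
      rw [abs_of_nonneg (by linarith)]
      refine Real.le_sqrt_of_sq_le ?_
      nlinarith [hs.1, ht.2]
    calc _ ≤ _ := h1
      _ ≤ 30 * (‖f‖ + ‖h‖) * √(t - s) := by gcongr
      _ = _ := by ring
  · have h1 := (hy.2.norm_sub_le hst).trans (intervalIntegral_norm_le h hst)
    have h2 := mul_nonneg (Real.sqrt_nonneg (t - s)) (norm_nonneg h)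
    have h3 := mul_nonneg (Real.sqrt_nonneg (t - s)) (norm_nonneg f)
    linarith

/-- The one-sided representatives of `w` outside `[-δ², δ²]` satisfy the coupling conditions with
parameters `θ`, `c` up to an error of order `δ`. -/
structure IsNearCoupled (C δ N θ c : ℝ) (w k : L2) (yl yl' yr yr' : ℝ → ℂ) : Prop where
  left : IsRepOn (Iio (-δ ^ 2)) w k yl yl'
  right : IsRepOn (Ioi (δ ^ 2)) w k yr yr'
  inner_le : ∀ᵐ x, x ∈ Icc (-δ ^ 2) (δ ^ 2) → ‖w x‖ ≤ C * N
  norm_le : ‖yl (-δ ^ 2)‖ ≤ C * N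
  norm_deriv_le : ‖yl' (-δ ^ 2)‖ ≤ C * N
  norm_sub_le : ‖yr (δ ^ 2) - θ * yl (-δ ^ 2)‖ ≤ C * δ * N
  norm_deriv_sub_le : ‖yr' (δ ^ 2) - ((θ : ℂ)⁻¹ * yl' (-δ ^ 2) + c * yl (-δ ^ 2))‖ ≤ C * δ * N

/-- Where `-w'' - ζ w = f`, the vector `-f - ζ w` is the second derivative of `w`. The bound feeds
the trace estimates with constants free of `δ`. -/
lemma norm_neg_sub_smul_le {ζ : ℂ} {f w : L2} {K : ℝ} (hw : ‖w‖ ≤ K * ‖f‖) :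
    ‖w‖ + ‖-f - ζ • w‖ ≤ (K + 1 + ‖ζ‖ * K) * ‖f‖ := by
  have h1 : ‖-f - ζ • w‖ ≤ ‖f‖ + ‖ζ‖ * ‖w‖ := by
    refine (norm_sub_le _ _).trans ?_
    rw [norm_neg, norm_smul]
  have h2 : ‖ζ‖ * ‖w‖ ≤ ‖ζ‖ * (K * ‖f‖) := by gcongr
  linarith

section

variable {Φ Ψ : Potential} {α β : ℝ} {u : ℝ → ℝ}

/-- Under `x = δ² s` the second derivative gains `δ⁴`, which turns the squeezed potential into `αΦ +
δ²βΨ`. The source `δ⁴ f(δ² s)` has integral `δ² ∫ ‖f‖` over a length `2δ²`, and Cauchy-Schwarz gives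
`δ³`. -/
lemma isScaledSolution_of_isPrimitive {ζ : ℂ} {C δ N : ℝ} (hδ : 0 < δ) {f : L2} (hf : ‖f‖ ≤ N)
    {y y' : ℝ → ℂ} (hy : IsPrimitive y y') (hy' : IsPrimitive y' fun x =>
      squeezed Φ Ψ α β (δ ^ 2) x * y x - f x - ζ * y x)
    (h1 : ‖y (-δ ^ 2)‖ ≤ C * N) (h2 : ‖y' (-δ ^ 2)‖ ≤ C * N) :
    IsScaledSolution Φ Ψ α β ζ C δ N (fun s => y (δ ^ 2 * s)) (fun s => δ ^ 2 * y' (δ ^ 2 * s))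
      (fun s => δ ^ 2 * (δ ^ 2 * f (δ ^ 2 * s))) := by
  have hε : δ ^ 2 ≠ 0 := by positivity
  have hδ' : (δ : ℂ) ≠ 0 := Complex.ofReal_ne_zero.mpr hδ.ne'
  have hr := ((IsPrimitive.integral (locallyIntegrable_L2 f) 0).comp_mul hε).const_mul
    ((δ ^ 2 : ℝ) : ℂ)
  refine ⟨by simpa using hy.comp_mul hε, ?_, by simpa using hr.1, ?_, by simpa using h1, ?_⟩
  · convert (hy'.comp_mul hε).const_mul ((δ ^ 2 : ℝ) : ℂ) using 2
    · push_cast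
      ring
    · rw [squeezed, mul_div_cancel_left₀ _ hε]
      push_cast
      field_simp
      ring
  · have e1 : ∀ s : ℝ, ‖(δ ^ 2 * (δ ^ 2 * f (δ ^ 2 * s)) : ℂ)‖ =
        δ ^ 2 * (δ ^ 2 * ‖f (δ ^ 2 * s)‖) := fun s => by
      rw [norm_mul, norm_mul, norm_pow, Complex.norm_real, Real.norm_of_nonneg hδ.le]
    simp only [e1]
    rw [intervalIntegral.integral_const_mul, intervalIntegral.integral_const_mul,
      intervalIntegral.mul_integral_comp_mul_left (f := fun x => ‖f x‖)]
    have e2 := intervalIntegral_norm_le f (show δ ^ 2 * -1 ≤ δ ^ 2 * 1 by nlinarith [sq_nonneg δ])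
    have e3 : √(δ ^ 2 * 1 - δ ^ 2 * -1) ≤ 2 * δ :=
      Real.sqrt_le_iff.mpr ⟨by positivity, by nlinarith [sq_nonneg δ]⟩
    calc _ ≤ δ ^ 2 * (2 * δ * N) := by
          refine mul_le_mul_of_nonneg_left (e2.trans ?_) (by positivity)
          exact mul_le_mul e3 hf (norm_nonneg _) (by positivity)
      _ = _ := by ring
  · rw [mul_neg_one, norm_mul, norm_pow, Complex.norm_real, Real.norm_of_nonneg hδ.le]
    calc δ ^ 2 * ‖y' (-δ ^ 2)‖ ≤ δ ^ 2 * (C * N) := by gcongr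
      _ = _ := by ring

lemma squeezed_eq_zero {ε : ℝ} (hε : 0 < ε) {x : ℝ} (hx : x ∉ Icc (-ε) ε) :
    squeezed Φ Ψ α β ε x = 0 := by
  have : x / ε ∉ Icc (-1 : ℝ) 1 := fun h => hx
    ⟨by have := (le_div_iff₀ hε).mp h.1; linarith, by have := (div_le_iff₀ hε).mp h.2; linarith⟩
  rw [squeezed, Φ.eq_zero this, Ψ.eq_zero this, mul_zero, mul_zero, add_zero]

/-- The bound `‖w‖ ≤ ‖f‖ / |Im ζ|` and the trace estimate on `[-δ² - 1, -δ²]`, where the potential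
vanishes almost everywhere, control the Cauchy data at `-δ²` uniformly in `δ`. The rescaled equation
then carries them across to `δ²`. -/
theorem exists_isNearCoupled (Ψ : Potential) (β : ℝ) {ζ : ℂ} (hζ : ζ.im ≠ 0)
    (hu : IsHalfBoundState (fun s => α * Φ s) u) :
    ∃ C, 0 ≤ C ∧ ∀ δ, 0 < δ → δ ≤ 1 → ∀ (f : L2)
      (w : (schrodingerOp Φ Ψ α β (δ ^ 2)).domain),
      schrodingerOp Φ Ψ α β (δ ^ 2) w - ζ • (w : L2) = f →
      ∃ yl yl' yr yr', IsNearCoupled C δ ‖f‖ (u 1 / u (-1))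
        (β * (1 / (u (-1) * u 1) * ∫ s, Ψ s * u s ^ 2)) (w : L2) (-f - ζ • (w : L2))
        yl yl' yr yr' := by
  set K := |ζ.im|⁻¹
  have hζ0 : 0 < |ζ.im| := abs_pos.mpr hζ
  have hK : 0 ≤ K := by positivity
  set C₁ := 30 * (K + 1 + ‖ζ‖ * K)
  have hC₁ : 0 ≤ C₁ := by positivity
  obtain ⟨K₀, hK₀, hbd₀⟩ := IsScaledSolution.exists_norm_le Φ Ψ α β ζ hC₁
  obtain ⟨K₁, hK₁, hbd₁⟩ := IsScaledSolution.exists_norm_sub_le Ψ β ζ hu hC₁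
  obtain ⟨K₂, hK₂, hbd₂⟩ := IsScaledSolution.exists_norm_deriv_sub_le Ψ β ζ hu hC₁
  refine ⟨C₁ + K₀ + K₁ + K₂, by positivity, ?_⟩
  intro δ hδ hδ1 f w hw
  have hε : 0 < δ ^ 2 := by positivity
  set N := ‖f‖
  have hN : 0 ≤ N := norm_nonneg f
  set k : L2 := -f - ζ • (w : L2)
  obtain ⟨h, y, y', hy, hh⟩ := schrodingerOp_spec w
  have hwn : ‖(w : L2)‖ ≤ K * ‖f‖ := by
    have := (isMaximalSymmetric_schrodingerOp Φ Ψ α β (δ ^ 2)).im_mul_norm_le ζ w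
    rw [hw] at this
    rwa [inv_mul_eq_div, le_div_iff₀ hζ0, mul_comm]
  have hwk : 30 * (‖(w : L2)‖ + ‖k‖) ≤ C₁ * N := by
    have := norm_neg_sub_smul_le (ζ := ζ) hwn
    calc _ ≤ 30 * ((K + 1 + ‖ζ‖ * K) * ‖f‖) := by gcongr
      _ = _ := by ring
  have hS : schrodingerOp Φ Ψ α β (δ ^ 2) w = f + ζ • (w : L2) := by rw [← hw]; abel
  have hh' : ∀ᵐ x, h x = squeezed Φ Ψ α β (δ ^ 2) x * y x - f x - ζ * y x := by
    filter_upwards [hh, Lp.coeFn_add f (ζ • (w : L2)), Lp.coeFn_smul ζ (w : L2), hy.3]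
      with x h1 h2 h3 h4
    rw [h1, hS, h2, Pi.add_apply, h3, Pi.smul_apply, h4 (mem_univ x), smul_eq_mul]
    ring
  have hk : ∀ᵐ x, x ∉ Icc (-δ ^ 2) (δ ^ 2) → k x = h x := by
    filter_upwards [hh', Lp.coeFn_sub (-f) (ζ • (w : L2)), Lp.coeFn_neg f,
      Lp.coeFn_smul ζ (w : L2), hy.3] with x h1 h2 h3 h4 h5 hx
    rw [h1, squeezed_eq_zero hε hx]
    change (-f - ζ • (w : L2) : L2) x = _
    rw [h2, Pi.sub_apply, h3, h4, Pi.neg_apply, Pi.smul_apply, h5 (mem_univ x), smul_eq_mul]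
    simp
  obtain ⟨yl, yl', hl, l1, l2⟩ := exists_isRepOn_of_eqOn (I := Iio (-δ ^ 2)) (c := -δ ^ 2)
    (f := (w : L2)) (fun x hx t ht ht0 => by
      rw [uIcc_of_ge (le_of_lt hx)] at ht
      exact lt_of_le_of_ne ht.2 ht0) (locallyIntegrable_L2 k) hy.1 hy.2
    (by filter_upwards [hy.3] with x hx _ using hx (mem_univ x))
    (by filter_upwards [hk] with x hx hxI using hx fun hx' => absurd hx'.1 (not_le.mpr hxI))
  obtain ⟨yr, yr', hr, r1, r2⟩ := exists_isRepOn_of_eqOn (I := Ioi (δ ^ 2)) (c := δ ^ 2)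
    (f := (w : L2)) (fun x hx t ht ht0 => by
      rw [uIcc_of_le (le_of_lt hx)] at ht
      exact lt_of_le_of_ne ht.1 ht0.symm) (locallyIntegrable_L2 k) hy.1 hy.2
    (by filter_upwards [hy.3] with x hx _ using hx (mem_univ x))
    (by filter_upwards [hk] with x hx hxI using hx fun hx' => absurd hx'.2 (not_le.mpr hxI))
  obtain ⟨t1, t2⟩ := hl.norm_trace_le (a := -δ ^ 2 - 1) (t := -δ ^ 2)
    (by rw [sub_add_cancel]; exact Ioo_subset_Iio_self) ⟨by linarith, by linarith⟩
  have b1 : ‖y (-δ ^ 2)‖ ≤ C₁ * N := by rw [← l1]; exact t1.trans hwk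
  have b2 : ‖y' (-δ ^ 2)‖ ≤ C₁ * N := by rw [← l2]; exact t2.trans hwk
  have hsc := isScaledSolution_of_isPrimitive hδ le_rfl hy.1 (hy.2.congr_ae hh') b1 b2
  have c0 := hbd₀ δ N hδ hδ1 hN _ _ _ hsc
  have c1 := hbd₁ δ N hδ hδ1 hN _ _ _ hsc 1 (by simp)
  have c2 := hbd₂ δ N hδ hδ1 hN _ _ _ hsc
  simp only [mul_one, mul_neg] at c1 c2
  have hle : ∀ a, 0 ≤ a → ∀ b, a ≤ b → a * N ≤ b * N := fun a _ b hab => by gcongr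
  refine ⟨yl, yl', yr, yr', hl, hr, ?_, ?_, ?_, ?_, ?_⟩
  · filter_upwards [hy.3] with x hx hxI
    rw [hx (mem_univ x)]
    have h1 := c0 (x / δ ^ 2) ⟨by rw [le_div_iff₀ hε]; linarith [hxI.1],
      by rw [div_le_iff₀ hε]; linarith [hxI.2]⟩
    rw [mul_div_cancel₀ _ hε.ne'] at h1
    exact h1.trans (hle _ hK₀ _ (by linarith))
  · rw [l1]
    exact b1.trans (hle _ hC₁ _ (by linarith))
  · rw [l2]
    exact b2.trans (hle _ hC₁ _ (by linarith))
  · rw [l1, r1]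
    have e : y (δ ^ 2) - ((u 1 / u (-1) : ℝ) : ℂ) * y (-δ ^ 2) =
        y (δ ^ 2) - y (-δ ^ 2) / u (-1) * u 1 := by
      push_cast
      ring
    rw [e]
    refine c1.trans ?_
    have : K₁ * δ ^ 2 ≤ (C₁ + K₀ + K₁ + K₂) * δ := by
      have h1 : δ ^ 2 ≤ δ := by nlinarith
      calc K₁ * δ ^ 2 ≤ (C₁ + K₀ + K₁ + K₂) * δ ^ 2 := by
            gcongr
            linarith
        _ ≤ _ := by gcongr
    gcongr
  · rw [l1, l2, r2]
    set T := β * (1 / (u (-1) * u 1) * ∫ s, Ψ s * u s ^ 2)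
    set θ := u 1 / u (-1)
    have e : (δ ^ 2 * y' (δ ^ 2) : ℂ) - (θ : ℂ)⁻¹ * (δ ^ 2 * y' (-δ ^ 2)) - δ ^ 2 * T * y (-δ ^ 2) =
        δ ^ 2 * (y' (δ ^ 2) - ((θ : ℂ)⁻¹ * y' (-δ ^ 2) + T * y (-δ ^ 2))) := by ring
    rw [e, norm_mul, norm_pow, Complex.norm_real, Real.norm_of_nonneg hδ.le] at c2
    have h3 : δ ^ 2 * ‖y' (δ ^ 2) - ((θ : ℂ)⁻¹ * y' (-δ ^ 2) + T * y (-δ ^ 2))‖ ≤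
        δ ^ 2 * (K₂ * δ * N) := c2.trans_eq (by ring)
    refine (le_of_mul_le_mul_left h3 hε).trans ?_
    gcongr
    linarith

end

/-- The boundary form of two pairs of traces that almost satisfy the same coupling conditions
is small. -/
lemma norm_boundary_form_le {θ c C δ N D : ℝ} (hθ : θ ≠ 0) (hC : 0 ≤ C) (hδ : 0 ≤ δ) (hN : 0 ≤ N)
    {p p' q q' a a' b b' zl zl' zr zr' : ℂ} (hp : ‖p‖ ≤ C * N) (hp' : ‖p'‖ ≤ C * N)
    (hq : ‖q - θ * p‖ ≤ C * δ * N) (hq' : ‖q' - ((θ : ℂ)⁻¹ * p' + c * p)‖ ≤ C * δ * N)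
    (hb : b = θ * a) (hb' : b' = (θ : ℂ)⁻¹ * a' + c * a) (hzr : ‖zr‖ ≤ C * D)
    (hzr' : ‖zr'‖ ≤ C * D) (hl : ‖zl - a‖ ≤ C * δ * D) (hl' : ‖zl' - a'‖ ≤ C * δ * D)
    (hr : ‖zr - b‖ ≤ C * δ * D) (hr' : ‖zr' - b'‖ ≤ C * δ * D) :
    ‖(q * conj zr' - q' * conj zr) + (p' * conj zl - p * conj zl')‖ ≤
      C ^ 2 * (4 + |θ| + |θ|⁻¹ + |c|) * δ * N * D := by
  have hθ' : (θ : ℂ) ≠ 0 := Complex.ofReal_ne_zero.mpr hθ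
  -- Exactly coupled traces annihilate the form: `θ p conj b' - (θ⁻¹ p' + c p) conj b = p conj a' -
  -- p' conj a`. Only products containing one defect remain.
  have e : (q * conj zr' - q' * conj zr) + (p' * conj zl - p * conj zl') =
      (q - θ * p) * conj zr' - (q' - ((θ : ℂ)⁻¹ * p' + c * p)) * conj zr +
        (θ * p * conj (zr' - b') - ((θ : ℂ)⁻¹ * p' + c * p) * conj (zr - b)) +
        (p' * conj (zl - a) - p * conj (zl' - a')) := by
    simp only [hb, hb', map_sub, map_add, map_mul, map_inv₀, Complex.conj_ofReal]
    field_simp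
    ring
  have hCN : 0 ≤ C * N := mul_nonneg hC hN
  have hCδ : 0 ≤ C * δ * N := by positivity
  have m : ∀ {x y : ℂ} {A B : ℝ}, 0 ≤ A → ‖x‖ ≤ A → ‖y‖ ≤ B → ‖x * conj y‖ ≤ A * B :=
    fun hA hx hy => by
      rw [norm_mul, RCLike.norm_conj]
      exact mul_le_mul hx hy (norm_nonneg _) hA
  have h1 : ‖(θ : ℂ) * p‖ ≤ |θ| * (C * N) := by
    rw [norm_mul, Complex.norm_real]
    exact mul_le_mul_of_nonneg_left hp (abs_nonneg _)
  have h2 : ‖(θ : ℂ)⁻¹ * p' + c * p‖ ≤ |θ|⁻¹ * (C * N) + |c| * (C * N) := by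
    refine (norm_add_le _ _).trans ?_
    rw [norm_mul, norm_mul, norm_inv, Complex.norm_real, Complex.norm_real]
    exact add_le_add (mul_le_mul_of_nonneg_left hp' (by positivity))
      (mul_le_mul_of_nonneg_left hp (abs_nonneg _))
  have t1 := m hCδ hq hzr'
  have t2 := m hCδ hq' hzr
  have t3 := m (by positivity) h1 hr'
  have t4 := m (by positivity) h2 hr
  have t5 := m hCN hp' hl
  have t6 := m hCN hp hl'
  rw [e]
  refine (norm_add_le _ _).trans ((add_le_add ((norm_add_le _ _).trans
    (add_le_add (norm_sub_le _ _) (norm_sub_le _ _))) (norm_sub_le _ _)).trans ?_)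
  linarith

/-! ### Traces of the dual function `z` -/

section

variable {ζ : ℂ} {μ ν : ℝ}

/-- Traces near the origin of functions in the range of the resolvent of the point interaction
operator. -/
lemma exists_traces_pointInteraction (hζ : ζ.im ≠ 0) (hμ : μ ≠ 0) :
    ∃ C, 0 ≤ C ∧ ∀ (d : L2) (z : (pointInteraction μ ν).domain),
      pointInteraction μ ν z - ζ • (z : L2) = d → ∃ zl zl' zr zr',
        IsRepOn (Iio 0) (z : L2) (-d - ζ • (z : L2) : L2) zl zl' ∧
        IsRepOn (Ioi 0) (z : L2) (-d - ζ • (z : L2) : L2) zr zr' ∧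
        zr 0 = μ * zl 0 ∧ zr' 0 = (μ : ℂ)⁻¹ * zl' 0 + ν * zl 0 ∧
        (∀ᵐ x, x ∈ Icc (-1) 1 → ‖(z : L2) x‖ ≤ C * ‖d‖) ∧
        ∀ δ, 0 < δ → δ ≤ 1 → ‖zr (δ ^ 2)‖ ≤ C * ‖d‖ ∧ ‖zr' (δ ^ 2)‖ ≤ C * ‖d‖ ∧
          ‖zl (-δ ^ 2) - zl 0‖ ≤ C * δ * ‖d‖ ∧ ‖zl' (-δ ^ 2) - zl' 0‖ ≤ C * δ * ‖d‖ ∧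
          ‖zr (δ ^ 2) - zr 0‖ ≤ C * δ * ‖d‖ ∧ ‖zr' (δ ^ 2) - zr' 0‖ ≤ C * δ * ‖d‖ := by
  set K := |ζ.im|⁻¹
  have hζ0 : 0 < |ζ.im| := abs_pos.mpr hζ
  have hK : 0 ≤ K := by positivity
  refine ⟨30 * (K + 1 + ‖ζ‖ * K), by positivity, fun d z hz => ?_⟩
  obtain ⟨h, zl, zl', zr, zr', eh, hl, hr, e1, e2⟩ := pointInteraction_spec z
  have hh : h = -d - ζ • (z : L2) := by
    rw [← hz, eh]
    abel
  subst hh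
  have hzn : ‖(z : L2)‖ ≤ K * ‖d‖ := by
    have := (isMaximalSymmetric_pointInteraction hμ ν).im_mul_norm_le ζ z
    rw [hz] at this
    rwa [inv_mul_eq_div, le_div_iff₀ hζ0, mul_comm]
  set S := ‖(z : L2)‖ + ‖-d - ζ • (z : L2)‖
  have hS : S ≤ (K + 1 + ‖ζ‖ * K) * ‖d‖ := norm_neg_sub_smul_le hzn
  have hS1 : 30 * S ≤ 30 * (K + 1 + ‖ζ‖ * K) * ‖d‖ := by linarith
  have hSδ : ∀ δ, 0 < δ → 30 * δ * S ≤ 30 * (K + 1 + ‖ζ‖ * K) * δ * ‖d‖ := fun δ hδ => by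
    calc 30 * δ * S ≤ 30 * δ * ((K + 1 + ‖ζ‖ * K) * ‖d‖) := by gcongr
      _ = _ := by ring
  have hIl : Ioo (-1 : ℝ) (-1 + 1) ⊆ Iio 0 := by
    rw [neg_add_cancel]
    exact Ioo_subset_Iio_self
  have hIr : Ioo (0 : ℝ) (0 + 1) ⊆ Ioi 0 := Ioo_subset_Ioi_self
  refine ⟨zl, zl', zr, zr', hl, hr, e1, e2, ?_, fun δ hδ hδ1 => ?_⟩
  · have h0 : ∀ᵐ x : ℝ, x ≠ 0 := by simp [ae_iff]
    filter_upwards [hl.3, hr.3, h0] with x h1 h2 h3 hx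
    rcases lt_or_gt_of_ne h3 with h | h
    · rw [h1 h]
      exact (hl.norm_trace_le hIl ⟨hx.1, by linarith⟩).1.trans hS1
    · rw [h2 h]
      exact (hr.norm_trace_le hIr ⟨h.le, by linarith [hx.2]⟩).1.trans hS1
  · have hδ2 : δ ^ 2 ≤ 1 := pow_le_one₀ hδ.le hδ1
    have hδ0 : 0 ≤ δ ^ 2 := by positivity
    have mr : δ ^ 2 ∈ Icc (0 : ℝ) (0 + 1) := ⟨hδ0, by linarith⟩
    -- The displacement from `0` to `±δ²` has square root `δ`, so the Hölder-1/2 bounds are of order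
    -- `δ`.
    obtain ⟨a1, a2⟩ := hr.norm_trace_le hIr mr
    obtain ⟨b1, b2⟩ := hr.norm_sub_le_sqrt hIr ⟨le_rfl, by linarith⟩ mr hδ0
    obtain ⟨c1, c2⟩ := hl.norm_sub_le_sqrt (s := -δ ^ 2) (t := 0) hIl
      ⟨by linarith, by linarith⟩ ⟨by linarith, by linarith⟩ (by linarith)
    rw [sub_zero, Real.sqrt_sq hδ.le] at b1 b2
    rw [zero_sub, neg_neg, Real.sqrt_sq hδ.le, norm_sub_rev] at c1 c2
    have := hSδ δ hδ
    exact ⟨a1.trans hS1, a2.trans hS1, c1.trans this, c2.trans this, b1.trans this, b2.trans this⟩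

end

/-- On an interval of length `2δ²` the `L₁` norm is at most `√2 δ` times the `L₂` norm, and in each
product the other factor is bounded. -/
lemma norm_intervalIntegral_inner_le {d w z f : L2} {δ A B : ℝ} (hδ : 0 < δ) (hA : 0 ≤ A) (hB : 0 ≤ B)
    (hw : ∀ᵐ x, x ∈ Icc (-δ ^ 2) (δ ^ 2) → ‖w x‖ ≤ A)
    (hz : ∀ᵐ x, x ∈ Icc (-δ ^ 2) (δ ^ 2) → ‖z x‖ ≤ B) :
    ‖∫ x in (-δ ^ 2)..(δ ^ 2), (inner ℂ (d x) (w x) - inner ℂ (z x) (f x))‖ ≤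
      2 * δ * (A * ‖d‖ + B * ‖f‖) := by
  have h0 : 0 ≤ δ ^ 2 := by positivity
  have hle : -δ ^ 2 ≤ δ ^ 2 := by linarith
  have hi : ∀ g : L2, IntervalIntegrable (fun x => ‖g x‖) volume (-δ ^ 2) (δ ^ 2) := fun g =>
    intervalIntegrable_of_locallyIntegrable (locallyIntegrable_norm (locallyIntegrable_L2 g)) _ _
  have hsq : √(δ ^ 2 - -δ ^ 2) ≤ 2 * δ :=
    Real.sqrt_le_iff.mpr ⟨by positivity, by nlinarith⟩
  have hg : ∀ g : L2, ∫ x in (-δ ^ 2)..(δ ^ 2), ‖g x‖ ≤ 2 * δ * ‖g‖ := fun g =>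
    (intervalIntegral_norm_le g hle).trans (mul_le_mul_of_nonneg_right hsq (norm_nonneg _))
  have h1 : ‖∫ x in (-δ ^ 2)..(δ ^ 2), (inner ℂ (d x) (w x) - inner ℂ (z x) (f x))‖ ≤
      ∫ x in (-δ ^ 2)..(δ ^ 2), (A * ‖d x‖ + B * ‖f x‖) := by
    refine intervalIntegral.norm_integral_le_of_norm_le hle ?_
      (((hi d).const_mul A).add ((hi f).const_mul B))
    filter_upwards [hw, hz] with x h1 h2 hx
    have hx' : x ∈ Icc (-δ ^ 2) (δ ^ 2) := ⟨hx.1.le, hx.2⟩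
    refine (norm_sub_le _ _).trans (add_le_add ((norm_inner_le_norm _ _).trans ?_)
      ((norm_inner_le_norm _ _).trans ?_))
    · rw [mul_comm]
      exact mul_le_mul_of_nonneg_right (h1 hx') (norm_nonneg _)
    · exact mul_le_mul_of_nonneg_right (h2 hx') (norm_nonneg _)
  refine h1.trans ?_
  rw [intervalIntegral.integral_add ((hi d).const_mul A) ((hi f).const_mul B),
    intervalIntegral.integral_const_mul, intervalIntegral.integral_const_mul]
  have h2 := mul_le_mul_of_nonneg_left (hg d) hA
  have h3 := mul_le_mul_of_nonneg_left (hg f) hB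
  linarith

/-! ### Comparison of the resolvents by duality -/

section

variable {Φ : Potential} {α : ℝ} {u : ℝ → ℝ}

theorem exists_norm_resolventAt_sub_le (Ψ : Potential) (β : ℝ) {ζ : ℂ} (hζ : ζ.im ≠ 0)
    (hu : IsHalfBoundState (fun s => α * Φ s) u) :
    ∃ L, 0 ≤ L ∧ ∀ δ, 0 < δ → δ ≤ 1 →
      ‖resolventAt (schrodingerOp Φ Ψ α β (δ ^ 2)) ζ -
        resolventAt (pointInteraction (u 1 / u (-1))
          (β * (1 / (u (-1) * u 1) * ∫ s, Ψ s * u s ^ 2))) ζ‖ ≤ L * δ := by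
  obtain ⟨M, hM⟩ := exists_bound_smul Φ α
  have hq := smul_eq_zero_of_notMem Φ α
  obtain ⟨C₁, hC₁, h₁⟩ := exists_isNearCoupled Ψ β hζ hu
  set θ := u 1 / u (-1)
  set c := β * (1 / (u (-1) * u 1) * ∫ s, Ψ s * u s ^ 2)
  have hθ : θ ≠ 0 := div_ne_zero (hu.apply_one_ne_zero hq hM) (hu.apply_neg_one_ne_zero hq hM)
  have hA := isMaximalSymmetric_pointInteraction hθ c
  have hζ' : (conj ζ).im ≠ 0 := by simpa using hζ
  obtain ⟨C₂, hC₂, h₂⟩ := exists_traces_pointInteraction (ν := c) hζ' hθ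
  have hR := IsMaximalSymmetric.mem_resolvents_iff.mp (hA.mem_resolvents hζ)
  have hR' := IsMaximalSymmetric.mem_resolvents_iff.mp (hA.mem_resolvents hζ')
  set C := C₁ + C₂
  set L := C ^ 2 * (4 + |θ| + |θ|⁻¹ + |c|) + 2 * (C₁ + C₂)
  refine ⟨L, by positivity, fun δ hδ hδ1 => ?_⟩
  have hB := isMaximalSymmetric_schrodingerOp Φ Ψ α β (δ ^ 2)
  have hRε := IsMaximalSymmetric.mem_resolvents_iff.mp (hB.mem_resolvents hζ)
  refine ContinuousLinearMap.opNorm_le_bound _ (by positivity) fun f => ?_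
  obtain ⟨hw, ew⟩ := hRε.1 f
  obtain ⟨hv, ev⟩ := hR.1 f
  rw [sub_apply]
  set w := resolventAt (schrodingerOp Φ Ψ α β (δ ^ 2)) ζ f
  set v := resolventAt (pointInteraction θ c) ζ f
  set d := w - v with hd
  obtain ⟨hz, ez⟩ := hR'.1 d
  set z := resolventAt (pointInteraction θ c) (conj ζ) d
  obtain ⟨yl, yl', yr, yr', hy⟩ := h₁ δ hδ hδ1 f ⟨w, hw⟩ ew
  obtain ⟨zl, zl', zr, zr', hl, hr, e1, e2, hz1, hz2⟩ := h₂ d ⟨z, hz⟩ ez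
  obtain ⟨g1, g2, g3, g4, g5, g6⟩ := hz2 δ hδ hδ1
  have hδ0 : 0 ≤ δ ^ 2 := by positivity
  have hδ2 : δ ^ 2 ≤ 1 := pow_le_one₀ hδ.le hδ1
  have hdv : inner ℂ d v = inner ℂ z f := by
    have h1 : inner ℂ (pointInteraction θ c ⟨z, hz⟩) v =
        inner ℂ z (pointInteraction θ c ⟨v, hv⟩) := hA.symm ⟨z, hz⟩ ⟨v, hv⟩
    rw [← ev, ← ez, inner_sub_left, inner_sub_right, h1, inner_smul_left, inner_smul_right,
      Complex.conj_conj]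
  have hdd : ((‖d‖ ^ 2 : ℝ) : ℂ) = inner ℂ d w - inner ℂ z f := by
    rw [← hdv, ← inner_sub_right, ← hd, inner_self_eq_norm_sq_to_K]
    norm_cast
  have i1 := L2.integrable_inner (𝕜 := ℂ) d w
  have i2 := L2.integrable_inner (𝕜 := ℂ) z f
  have i3 : Integrable fun x => inner ℂ (d x) (w x) - inner ℂ (z x) (f x) := i1.sub i2
  -- The spectral terms cancel since `z` is taken at `conj ζ`. The right-hand side is the integrand
  -- of Green's formula, with `-f - ζ w` and `-d - conj ζ z` as second derivatives.
  have hae : ∀ᵐ x, inner ℂ (d x) (w x) - inner ℂ (z x) (f x) =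
      inner ℂ (z x) ((-f - ζ • w : L2) x) - inner ℂ ((-d - conj ζ • z : L2) x) (w x) := by
    filter_upwards [Lp.coeFn_sub (-f) (ζ • w), Lp.coeFn_neg f, Lp.coeFn_smul ζ w,
      Lp.coeFn_sub (-d) (conj ζ • z), Lp.coeFn_neg d, Lp.coeFn_smul (conj ζ) z]
      with x a1 a2 a3 a4 a5 a6
    rw [a1, a4, Pi.sub_apply, Pi.sub_apply, a2, a3, a5, a6]
    simp only [RCLike.inner_apply, Pi.neg_apply, Pi.smul_apply, smul_eq_mul, map_sub, map_neg,
      map_mul, Complex.conj_conj]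
    ring
  have green_r : ∫ x in Ioi (δ ^ 2), (inner ℂ (d x) (w x) - inner ℂ (z x) (f x)) =
      yr (δ ^ 2) * conj (zr' (δ ^ 2)) - yr' (δ ^ 2) * conj (zr (δ ^ 2)) := by
    rw [← hy.right.green_Ioi hr subset_rfl (Ioi_subset_Ioi hδ0)]
    exact integral_congr_ae (ae_restrict_of_ae hae)
  have green_l : ∫ x in Iic (-δ ^ 2), (inner ℂ (d x) (w x) - inner ℂ (z x) (f x)) =
      yl' (-δ ^ 2) * conj (zl (-δ ^ 2)) - yl (-δ ^ 2) * conj (zl' (-δ ^ 2)) := by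
    rw [← hy.left.green_Iic hl subset_rfl (Iio_subset_Iio (by linarith))]
    exact integral_congr_ae (ae_restrict_of_ae hae)
  have hmid := norm_intervalIntegral_inner_le (d := d) (z := z) (f := f) (A := C₁ * ‖f‖)
    (B := C₂ * ‖d‖) hδ (by positivity) (by positivity) hy.inner_le (by
      filter_upwards [hz1] with x hx hxI
      exact hx ⟨by linarith [hxI.1], by linarith [hxI.2]⟩)
  set m := ∫ x in (-δ ^ 2)..(δ ^ 2), (inner ℂ (d x) (w x) - inner ℂ (z x) (f x)) with hm
  have hsplit : inner ℂ d w - inner ℂ z f =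
      ((yr (δ ^ 2) * conj (zr' (δ ^ 2)) - yr' (δ ^ 2) * conj (zr (δ ^ 2))) +
        (yl' (-δ ^ 2) * conj (zl (-δ ^ 2)) - yl (-δ ^ 2) * conj (zl' (-δ ^ 2)))) + m := by
    rw [L2.inner_def, L2.inner_def, ← integral_sub i1 i2,
      ← intervalIntegral.integral_Iic_add_Ioi (b := δ ^ 2) i3.integrableOn i3.integrableOn,
      green_r, ← green_l, hm, ← intervalIntegral.integral_Iic_sub_Iic i3.integrableOn
        i3.integrableOn]
    ring
  have hN := norm_nonneg f
  have hD := norm_nonneg d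
  have le1 : C₁ ≤ C := le_add_of_nonneg_right hC₂
  have le2 : C₂ ≤ C := le_add_of_nonneg_left hC₁
  have hform := norm_boundary_form_le (C := C) (δ := δ) (N := ‖f‖) (D := ‖d‖) hθ (by positivity)
    hδ.le hN (hy.norm_le.trans (by gcongr)) (hy.norm_deriv_le.trans (by gcongr))
    (hy.norm_sub_le.trans (by gcongr)) (hy.norm_deriv_sub_le.trans (by gcongr)) e1 e2
    (g1.trans (by gcongr)) (g2.trans (by gcongr)) (g3.trans (by gcongr)) (g4.trans (by gcongr))
    (g5.trans (by gcongr)) (g6.trans (by gcongr))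
  -- All bounds on `z` are proportional to `‖d‖`, so one factor `‖d‖` can be cancelled.
  have hfin : ‖d‖ ^ 2 ≤ L * δ * ‖f‖ * ‖d‖ := by
    have h3 : ‖d‖ ^ 2 = ‖((‖d‖ ^ 2 : ℝ) : ℂ)‖ := by
      rw [Complex.norm_real, Real.norm_of_nonneg (by positivity)]
    rw [h3, hdd, hsplit]
    refine (norm_add_le _ _).trans ((add_le_add hform hmid).trans_eq ?_)
    ring
  rcases hD.eq_or_lt with h0 | h0
  · rw [← h0]
    positivity
  · rw [sq] at hfin
    exact le_of_mul_le_mul_right hfin h0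

end

/-! ### The rate for all positive `ε` -/

section

variable {Φ : Potential} {α : ℝ} {u : ℝ → ℝ}

theorem exists_norm_resolventAt_sub_le_rpow (Ψ : Potential) (β : ℝ) {ζ : ℂ} (hζ : ζ.im ≠ 0)
    (hu : IsHalfBoundState (fun s => α * Φ s) u) :
    ∃ C : ℝ, ∀ ε : ℝ, 0 < ε →
      ‖resolventAt (schrodingerOp Φ Ψ α β ε) ζ -
        resolventAt (pointInteraction (u 1 / u (-1))
          (β * (1 / (u (-1) * u 1) * ∫ s, Ψ s * u s ^ 2))) ζ‖ ≤ C * ε ^ (1 / 2 : ℝ) := by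
  obtain ⟨M, hM⟩ := exists_bound_smul Φ α
  have hq := smul_eq_zero_of_notMem Φ α
  have hθ := div_ne_zero (hu.apply_one_ne_zero hq hM) (hu.apply_neg_one_ne_zero hq hM)
  have hA := isMaximalSymmetric_pointInteraction hθ
    (β * (1 / (u (-1) * u 1) * ∫ s, Ψ s * u s ^ 2))
  obtain ⟨L, hL, h⟩ := exists_norm_resolventAt_sub_le Ψ β hζ hu
  have hK : 0 ≤ 2 / |ζ.im| := by positivity
  refine ⟨L + 2 / |ζ.im|, fun ε hε => ?_⟩
  rw [← Real.sqrt_eq_rpow]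
  have hs : 0 < √ε := Real.sqrt_pos.mpr hε
  rcases le_or_gt ε 1 with h1 | h1
  · have h2 := h (√ε) hs (Real.sqrt_le_one.mpr h1)
    rw [Real.sq_sqrt hε.le] at h2
    refine h2.trans ?_
    gcongr
    linarith
  -- For `ε > 1` nothing has to converge: both resolvents have norm at most `1 / |Im ζ|`, and `√ε ≥
  -- 1`.
  · have hB := isMaximalSymmetric_schrodingerOp Φ Ψ α β ε
    have n1 : ∀ {A : L2 →ₗ.[ℂ] L2}, IsMaximalSymmetric A → ‖resolventAt A ζ‖ ≤ 1 / |ζ.im| :=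
      fun hA => ContinuousLinearMap.opNorm_le_bound _ (by positivity) fun f => by
        have := hA.resolvent_norm_le hζ
          (IsMaximalSymmetric.mem_resolvents_iff.mp (hA.mem_resolvents hζ)) f
        rwa [one_div, inv_mul_eq_div]
    have h3 : 1 ≤ √ε := Real.one_le_sqrt.mpr h1.le
    calc _ ≤ 1 / |ζ.im| + 1 / |ζ.im| := (norm_sub_le _ _).trans (add_le_add (n1 hB) (n1 hA))
      _ = 2 / |ζ.im| := by ring
      _ ≤ (L + 2 / |ζ.im|) * 1 := by linarith
      _ ≤ _ := by gcongr

end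

end PointInteraction

end

theorem mainTheorem1 (Φ Ψ : Potential) (α β : ℝ) (hα : α ∈ resonantSet Φ) :
    -- the numbers `θ_α` and `κ_α` do not depend on the choice of the half-bound state
    (∀ u : ℝ → ℝ, IsHalfBoundState (fun s => α * Φ s) u →
      u (-1) ≠ 0 ∧ u 1 ≠ 0 ∧ resonantMap Φ ⟨α, hα⟩ = u 1 / u (-1) ∧
        intercouplingMap Φ Ψ ⟨α, hα⟩ = 1 / (u (-1) * u 1) * ∫ s, Ψ s * u s ^ 2) ∧
    -- the operators are self-adjoint
    (∀ ε : ℝ, 0 < ε → IsSelfAdjoint (schrodingerOp Φ Ψ α β ε)) ∧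
    IsSelfAdjoint
      (pointInteraction (resonantMap Φ ⟨α, hα⟩) (β * intercouplingMap Φ Ψ ⟨α, hα⟩)) ∧
    -- norm resolvent convergence
    NormResolventTendsto (fun ε : ℝ => schrodingerOp Φ Ψ α β ε) (𝓝[>] 0)
      (pointInteraction (resonantMap Φ ⟨α, hα⟩) (β * intercouplingMap Φ Ψ ⟨α, hα⟩)) ∧
    -- the rate of convergence
    ∀ ζ : ℂ, ζ.im ≠ 0 → ∃ C : ℝ, ∀ ε : ℝ, 0 < ε →
      ζ ∈ resolvents (schrodingerOp Φ Ψ α β ε) ∧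
      ‖resolventAt (schrodingerOp Φ Ψ α β ε) ζ -
          resolventAt (pointInteraction (resonantMap Φ ⟨α, hα⟩)
            (β * intercouplingMap Φ Ψ ⟨α, hα⟩)) ζ‖ ≤ C * ε ^ (1 / 2 : ℝ) := by
  have hinv : ∀ u : ℝ → ℝ, IsHalfBoundState (fun s => α * Φ s) u →
      u (-1) ≠ 0 ∧ u 1 ≠ 0 ∧ resonantMap Φ ⟨α, hα⟩ = u 1 / u (-1) ∧
        intercouplingMap Φ Ψ ⟨α, hα⟩ = 1 / (u (-1) * u 1) * ∫ s, Ψ s * u s ^ 2 :=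
    fun u hu => hu.invariants Ψ hα
  obtain ⟨u, hu⟩ := id hα
  obtain ⟨h1, h2, h3, h4⟩ := hinv u hu
  have hA : IsMaximalSymmetric
      (pointInteraction (resonantMap Φ ⟨α, hα⟩) (β * intercouplingMap Φ Ψ ⟨α, hα⟩)) := by
    rw [h3]
    exact isMaximalSymmetric_pointInteraction (div_ne_zero h2 h1) _
  have hB := isMaximalSymmetric_schrodingerOp Φ Ψ α β
  have hrate : ∀ ζ : ℂ, ζ.im ≠ 0 → ∃ C : ℝ, ∀ ε : ℝ, 0 < ε →
      ζ ∈ resolvents (schrodingerOp Φ Ψ α β ε) ∧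
      ‖resolventAt (schrodingerOp Φ Ψ α β ε) ζ -
          resolventAt (pointInteraction (resonantMap Φ ⟨α, hα⟩)
            (β * intercouplingMap Φ Ψ ⟨α, hα⟩)) ζ‖ ≤ C * ε ^ (1 / 2 : ℝ) := by
    intro ζ hζ
    obtain ⟨C, hC⟩ := exists_norm_resolventAt_sub_le_rpow Ψ β hζ hu
    rw [h3, h4]
    exact ⟨C, fun ε hε => ⟨(hB ε).mem_resolvents hζ, hC ε hε⟩⟩
  refine ⟨hinv, fun ε _ => (hB ε).isSelfAdjoint, hA.isSelfAdjoint, fun ζ hζ =>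
    ⟨hA.mem_resolvents hζ, Eventually.of_forall fun ε => (hB ε).mem_resolvents hζ, ?_⟩, hrate⟩
  obtain ⟨C, hC⟩ := hrate ζ hζ
  have hlim : Tendsto (fun ε : ℝ => C * ε ^ (1 / 2 : ℝ)) (𝓝[>] 0) (𝓝 0) := by
    have h := ((Real.continuous_rpow_const (q := 1 / 2) (by norm_num)).tendsto 0).const_mul C
    rw [Real.zero_rpow (by norm_num), mul_zero] at h
    exact h.mono_left nhdsWithin_le_nhds
  refine squeeze_zero' (Eventually.of_forall fun _ => norm_nonneg _) ?_ hlim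
  filter_upwards [self_mem_nhdsWithin] with ε hε using (hC ε hε).2
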